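/- All algebras are associative algebras over $\mathbb C$, possibly without unit; for a non-degenerate algebra $A$, $M(A)$ is its multiplier algebra, $\tau$ the flip, and for $X\in M(A\otimes A)$ the elements $X^{12},X^{13},X^{23}\in M(A\otimes A\otimes A)$ are given by the usual leg numbering. A weak multiplier Hopf algebra $(A,\Delta)$ is a non-degenerate idempotent algebra $A$ with a full coproduct $\Delta:A\to M(A\otimes A)$ and a counit $\varepsilon$, such that, with $T_1(a\otimes b)=\Delta(a)(1\otimes b)$ and $T_2(a\otimes b)=(a\otimes 1)\Delta(b)$: (i) there is an idempotent $E\in M(A\otimes A)$ with $T_1(A\otimes A)=E(A\otimes A)$ and $T_2(A\otimes A)=(A\otimes A)E$; (ii) $(\mathrm{id}\otimes\Delta)E=(E\otimes1)(1\otimes E)=(1\otimes E)(E\otimes 1)$; (iii) $\ker T_i=(1-G_i)(A\otimes A)$ for $i=1,2$, where $G_1,G_2$ are the linear maps from $A\otimes A$ to itself given by $(G_1\otimes \mathrm{id})(\Delta_{13}(a)(1\otimes b\otimes c))=\Delta_{13}(a)(1\otimes E)(1\otimes b\otimes c)$ and $(\mathrm{id}\otimes G_2)((a\otimes b\otimes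 1)\Delta_{13}(c))=(a\otimes b\otimes1)(E\otimes 1)\Delta_{13}(c)$. It is regular if $\Delta(a)(b\otimes 1),(1\otimes a)\Delta(b)\in A\otimes A$ for all $a,b\in A$ and $(A,\Delta^{cop})$, $\Delta^{cop}=\tau\Delta$, is also a weak multiplier Hopf algebra. The maps $\Delta$, $\Delta\otimes \mathrm{id}$, $\mathrm{id}\otimes\Delta$ are extended to multipliers so that $1$ is sent to $E$, $E\otimes 1$, $1\otimes E$ respectively. The antipode is the unique linear map $S:A\to M(A)$ with $\sum a_{(1)}S(a_{(2)})a_{(3)}=a$ and $\sum S(a_{(1)})a_{(2)}S(a_{(3)})=S(a)$ for which $P_1(a\otimes b)=\sum a_{(1)}\otimes S(a_{(2)})b$ and $P_2(a\otimes b)=\sum aS(b_{(1)})\otimes b_{(2)}$ map $A\otimes A$ to itself and satisfy $T_1P_1(p)=Ep$, $T_2P_2(p)=pE$ for all $p\in A\otimes A$. In the regular case $S$ is a bijective anti-homomorphism of $A$ onto $A$, and it is extended to $M(A)$. A quasitriangular weak multiplier Hopf algebra is a pair $(A,R)$ of a regular weak multiplier Hopf algebra $A$ and an element $R\in M(A\otimes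 A)$ such that there is $\bar R\in M(A\otimes A)$ with $R\bar R=E^{cop}$, $\bar RR=E$, $RE=R$, $\bar RE^{cop}=\bar R$ (where $E^{cop}=\tau(E)$), and $$(\Delta\otimes \mathrm{id})(R)=R^{13}R^{23},\qquad (\mathrm{id}\otimes\Delta)(R)=R^{13}R^{12},\qquad \Delta^{cop}(a)R=R\Delta(a)\quad (a\in A).$$ **Proposition.** Let $(A,R)$ be a quasitriangular weak multiplier Hopf algebra such that $R(a\otimes1)$, $(a\otimes1)R$, $R(1\otimes a)$, $(1\otimes a)R$ lie in $A\otimes A$ for all $a\in A$. Then $A$ has a unique antipode $S$, it is a bijection of $A$, and there is a unique multiplier $u\in M(A)$ with $$ua=\sum S(R_2)R_1a,\qquad au=uS^{-2}(a)\qquad(a\in A),$$ where $R(a\otimes 1)=\sum R_1a\otimes R_2\in A\otimes A$. The elements $u$ and $v=S(u)$ are invertible in $M(A)$, and (1) $uv=vu$, and $uv$ is central in $M(A)$; (2) $h=uv^{-1}$ is a grouplike element of $M(A)$, that is, $h$ is invertible and $\Delta(h)=(h\otimes h)E=E(h\otimes h)$; and $S^4(a)=hah^{-1}$ for all $a\in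 A$. -/

import Mathlib

open scoped TensorProduct

noncomputable section

namespace WMHA

/-! ### Multiplier algebras of (possibly non-unital) complex algebras -/

section Multiplier

variable (A : Type*) [NonUnitalRing A] [Module ℂ A] [IsScalarTower ℂ A A] [SMulCommClass ℂ A A]

/-- The multiplier algebra `M(A)`: pairs `(l, r)` of linear maps on `A`, where `l` is a left
multiplier, `r` is a right multiplier and `r(a) b = a l(b)`. Left multipliers are composed in the
usual order and right multipliers in the opposite one. -/
def multiplierAlgebra : Subalgebra ℂ (Module.End ℂ A × (Module.End ℂ A)ᵐᵒᵖ) where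
  carrier := {p | (∀ a b, p.1 (a * b) = p.1 a * b) ∧
    (∀ a b, p.2.unop (a * b) = a * p.2.unop b) ∧ ∀ a b, p.2.unop a * b = a * p.1 b}
  mul_mem' := by
    rintro p q ⟨h1, h2, h3⟩ ⟨k1, k2, k3⟩
    refine ⟨fun a b => ?_, fun a b => ?_, fun a b => ?_⟩
    · simp [h1, k1]
    · simp [h2, k2]
    · simp [h3, k3]
  add_mem' := by
    rintro p q ⟨h1, h2, h3⟩ ⟨k1, k2, k3⟩
    refine ⟨fun a b => ?_, fun a b => ?_, fun a b => ?_⟩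
    · simp [h1, k1, add_mul]
    · simp [h2, k2, mul_add]
    · simp [h3, k3, add_mul, mul_add]
  algebraMap_mem' := by
    intro c
    refine ⟨fun a b => ?_, fun a b => ?_, fun a b => ?_⟩
    · simp [Algebra.algebraMap_eq_smul_one, smul_mul_assoc]
    · simp [Algebra.algebraMap_eq_smul_one, mul_smul_comm]
    · simp [Algebra.algebraMap_eq_smul_one, smul_mul_assoc, mul_smul_comm]

/-- The multiplier algebra `M(A)` as a type. -/
abbrev Mult : Type _ := ↥(multiplierAlgebra A)

variable {A}

/-- The left action `a ↦ m a` of a multiplier. -/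
def Mult.l (m : Mult A) : A →ₗ[ℂ] A := m.1.1

/-- The right action `a ↦ a m` of a multiplier. -/
def Mult.r (m : Mult A) : A →ₗ[ℂ] A := m.1.2.unop

/-- A multiplier from its left and right actions. -/
def Mult.mk (l r : A →ₗ[ℂ] A) (hl : ∀ a b, l (a * b) = l a * b)
    (hr : ∀ a b, r (a * b) = a * r b) (hlr : ∀ a b, r a * b = a * l b) : Mult A :=
  ⟨(l, MulOpposite.op r), hl, hr, hlr⟩

theorem Mult.l_mul (m : Mult A) (a b : A) : m.l (a * b) = m.l a * b := m.2.1 a b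

theorem Mult.r_mul (m : Mult A) (a b : A) : m.r (a * b) = a * m.r b := m.2.2.1 a b

theorem Mult.r_mul_eq (m : Mult A) (a b : A) : m.r a * b = a * m.l b := m.2.2.2 a b

theorem Mult.ext_lr {m n : Mult A} (hl : m.l = n.l) (hr : m.r = n.r) : m = n :=
  Subtype.ext (Prod.ext hl (MulOpposite.unop_injective hr))

/-- The canonical map `A → M(A)`; it is injective when the product of `A` is non-degenerate. -/
def incl : A →ₗ[ℂ] Mult A where
  toFun a := Mult.mk (LinearMap.mulLeft ℂ a) (LinearMap.mulRight ℂ a)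
    (by simp [mul_assoc]) (by simp [mul_assoc]) (by simp [mul_assoc])
  map_add' a b := Mult.ext_lr (by ext x; simp [Mult.l, Mult.mk, add_mul])
    (by ext x; simp [Mult.r, Mult.mk, mul_add])
  map_smul' c a := Mult.ext_lr (by ext x; simp [Mult.l, Mult.mk, smul_mul_assoc])
    (by ext x; simp [Mult.r, Mult.mk, mul_smul_comm])

variable {B : Type*} [NonUnitalRing B] [Module ℂ B] [IsScalarTower ℂ B B] [SMulCommClass ℂ B B]

/-- The map `(x, y) ↦ x ⊗ y` from `M(A) × M(B)` to `M(A ⊗ B)`, as a bilinear map. -/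
def mtensor : Mult A →ₗ[ℂ] Mult B →ₗ[ℂ] Mult (A ⊗[ℂ] B) :=
  LinearMap.mk₂ ℂ
    (fun x y => Mult.mk (TensorProduct.map x.l y.l) (TensorProduct.map x.r y.r)
      (fun p q => by
        induction p with
        | zero => simp
        | add p p' hp hp' => simp [add_mul, hp, hp']
        | tmul a b =>
          induction q with
          | zero => simp
          | add q q' hq hq' => simp [mul_add, hq, hq']
          | tmul c d => simp [x.l_mul, y.l_mul])
      (fun p q => by
        induction p with
        | zero => simp
        | add p p' hp hp' => simp [add_mul, hp, hp']
        | tmul a b =>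
          induction q with
          | zero => simp
          | add q q' hq hq' => simp [mul_add, hq, hq']
          | tmul c d => simp [x.r_mul, y.r_mul])
      (fun p q => by
        induction p with
        | zero => simp
        | add p p' hp hp' => simp [add_mul, hp, hp']
        | tmul a b =>
          induction q with
          | zero => simp
          | add q q' hq hq' => simp only [mul_add, map_add, hq, hq']
          | tmul c d => simp [x.r_mul_eq, y.r_mul_eq]))
    (fun x x' y => Mult.ext_lr (TensorProduct.map_add_left x.l x'.l y.l)
      (TensorProduct.map_add_left x.r x'.r y.r))
    (fun c x y => Mult.ext_lr (TensorProduct.map_smul_left c x.l y.l)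
      (TensorProduct.map_smul_left c x.r y.r))
    (fun x y y' => Mult.ext_lr (TensorProduct.map_add_right x.l y.l y'.l)
      (TensorProduct.map_add_right x.r y.r y'.r))
    (fun c x y => Mult.ext_lr (TensorProduct.map_smul_right c x.l y.l)
      (TensorProduct.map_smul_right c x.r y.r))

/-- Transport of multipliers along an isomorphism of algebras. -/
def Mult.transport (e : A ≃ₗ[ℂ] B) (he : ∀ a b, e (a * b) = e a * e b) : Mult A →ₗ[ℂ] Mult B where
  toFun m := Mult.mk (e.conj m.l) (e.conj m.r)
    (fun a b => by
      have hs : e.symm (a * b) = e.symm a * e.symm b := e.injective (by simp [he])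
      simp [LinearEquiv.conj_apply, hs, m.l_mul, he])
    (fun a b => by
      have hs : e.symm (a * b) = e.symm a * e.symm b := e.injective (by simp [he])
      simp [LinearEquiv.conj_apply, hs, m.r_mul, he])
    (fun a b => e.symm.injective (by
      have hs : ∀ a b, e.symm (a * b) = e.symm a * e.symm b :=
        fun a b => e.injective (by simp [he])
      simp [LinearEquiv.conj_apply, hs, m.r_mul_eq]))
  map_add' m n := Mult.ext_lr (map_add e.conj m.l n.l) (map_add e.conj m.r n.r)
  map_smul' c m := Mult.ext_lr (map_smul e.conj c m.l) (map_smul e.conj c m.r)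

/-- `IsExtension Φ e m X` says that `X` is the value at `m ∈ M(A)` of the extension
`M(A) → M(B)`, with `1 ↦ e`, of the homomorphism `Φ : A → M(B)`. When `e` is an idempotent with
`Φ(A) B = e B` and `B Φ(A) = B e`, there is exactly one such `X` for every `m`. -/
def IsExtension (Φ : A →ₗ[ℂ] Mult B) (e : Mult B) (m : Mult A) (X : Mult B) : Prop :=
  (∀ a, X * Φ a = Φ (m.l a)) ∧ (∀ a, Φ a * X = Φ (m.r a)) ∧ e * X = X ∧ X * e = X

end Multiplier

section Legs

variable {A : Type*} [NonUnitalRing A] [Module ℂ A] [IsScalarTower ℂ A A] [SMulCommClass ℂ A A]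

theorem comm_mul (p q : A ⊗[ℂ] A) : TensorProduct.comm ℂ A A (p * q) =
    TensorProduct.comm ℂ A A p * TensorProduct.comm ℂ A A q := by
  induction p with
  | zero => simp
  | add p p' hp hp' => simp only [add_mul, map_add, hp, hp']
  | tmul a b =>
    induction q with
    | zero => simp
    | add q q' hq hq' => simp only [mul_add, map_add, hq, hq']
    | tmul c d => simp

theorem assoc_mul (p q : (A ⊗[ℂ] A) ⊗[ℂ] A) : TensorProduct.assoc ℂ A A A (p * q) =
    TensorProduct.assoc ℂ A A A p * TensorProduct.assoc ℂ A A A q := by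
  induction p with
  | zero => simp
  | add p p' hp hp' => simp only [add_mul, map_add, hp, hp']
  | tmul x b =>
    induction q with
    | zero => simp
    | add q q' hq hq' => simp only [mul_add, map_add, hq, hq']
    | tmul y d =>
      induction x with
      | zero => simp
      | add x x' hx hx' => simp only [TensorProduct.add_tmul, add_mul, map_add, hx, hx']
      | tmul a a' =>
        induction y with
        | zero => simp
        | add y y' hy hy' => simp only [TensorProduct.add_tmul, mul_add, map_add, hy, hy']
        | tmul c c' => simp

theorem swap_mul (p q : A ⊗[ℂ] (A ⊗[ℂ] A)) :
    (TensorProduct.comm ℂ A A).lTensor A (p * q) =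
    (TensorProduct.comm ℂ A A).lTensor A p * (TensorProduct.comm ℂ A A).lTensor A q := by
  induction p with
  | zero => simp
  | add p p' hp hp' => simp only [add_mul, map_add, hp, hp']
  | tmul a x =>
    induction q with
    | zero => simp
    | add q q' hq hq' => simp only [mul_add, map_add, hq, hq']
    | tmul b y => simp [comm_mul]

/-- The flip `τ` on `M(A ⊗ A)`. For the idempotent `E` it gives `E^cop`. -/
def flip : Mult (A ⊗[ℂ] A) →ₗ[ℂ] Mult (A ⊗[ℂ] A) :=
  Mult.transport (TensorProduct.comm ℂ A A) comm_mul

/-- The identification `M((A ⊗ A) ⊗ A) → M(A ⊗ (A ⊗ A))`. -/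
def massoc : Mult ((A ⊗[ℂ] A) ⊗[ℂ] A) →ₗ[ℂ] Mult (A ⊗[ℂ] (A ⊗[ℂ] A)) :=
  Mult.transport (TensorProduct.assoc ℂ A A A) assoc_mul

/-- `X ↦ X¹² = X ⊗ 1`. -/
def leg12 (X : Mult (A ⊗[ℂ] A)) : Mult (A ⊗[ℂ] (A ⊗[ℂ] A)) :=
  massoc (mtensor X 1)

/-- `X ↦ X²³ = 1 ⊗ X`. -/
def leg23 (X : Mult (A ⊗[ℂ] A)) : Mult (A ⊗[ℂ] (A ⊗[ℂ] A)) :=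
  mtensor 1 X

/-- `X ↦ X¹³`, obtained from `X¹²` by flipping the second and the third leg. -/
def leg13 (X : Mult (A ⊗[ℂ] A)) : Mult (A ⊗[ℂ] (A ⊗[ℂ] A)) :=
  Mult.transport ((TensorProduct.comm ℂ A A).lTensor A) swap_mul (leg12 X)

/-- `Δ ⊗ id : A ⊗ A → M(A ⊗ A ⊗ A)`. -/
def comulTensorId (Δ : A →ₗ[ℂ] Mult (A ⊗[ℂ] A)) : A ⊗[ℂ] A →ₗ[ℂ] Mult (A ⊗[ℂ] (A ⊗[ℂ] A)) :=
  massoc ∘ₗ TensorProduct.lift (mtensor.compl₁₂ Δ incl)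

/-- `id ⊗ Δ : A ⊗ A → M(A ⊗ A ⊗ A)`. -/
def idTensorComul (Δ : A →ₗ[ℂ] Mult (A ⊗[ℂ] A)) : A ⊗[ℂ] A →ₗ[ℂ] Mult (A ⊗[ℂ] (A ⊗[ℂ] A)) :=
  TensorProduct.lift (mtensor.compl₁₂ incl Δ)

end Legs

/-! ### Weak multiplier Hopf algebras -/

/-- A coproduct on `A`. The canonical maps `T₁(a ⊗ b) = Δ(a)(1 ⊗ b)` and
`T₂(a ⊗ b) = (a ⊗ 1)Δ(b)` are part of the data: that they exist means that these elements of
`M(A ⊗ A)` lie in `A ⊗ A`, and they are determined by `Δ` when the product of `A` is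
non-degenerate. -/
structure Coproduct (A : Type*) [NonUnitalRing A] [Module ℂ A] [IsScalarTower ℂ A A]
    [SMulCommClass ℂ A A] where
  /-- the coproduct `Δ` -/
  comul : A →ₗ[ℂ] Mult (A ⊗[ℂ] A)
  comul_mul : ∀ a b, comul (a * b) = comul a * comul b
  /-- the canonical map `T₁` -/
  T₁ : A ⊗[ℂ] A →ₗ[ℂ] A ⊗[ℂ] A
  /-- the canonical map `T₂` -/
  T₂ : A ⊗[ℂ] A →ₗ[ℂ] A ⊗[ℂ] A
  T₁_spec : ∀ a b, incl (T₁ (a ⊗ₜ b)) = comul a * mtensor 1 (incl b)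
  T₂_spec : ∀ a b, incl (T₂ (a ⊗ₜ b)) = mtensor (incl a) 1 * comul b
  /-- `(c ⊗ 1 ⊗ 1)(Δ ⊗ id)(Δ(a)(1 ⊗ b)) = (id ⊗ Δ)((c ⊗ 1)Δ(a))(1 ⊗ 1 ⊗ b)` -/
  coassoc : ∀ a b c,
    mtensor (incl c) 1 * comulTensorId comul (T₁ (a ⊗ₜ b)) =
      idTensorComul comul (T₂ (c ⊗ₜ a)) * mtensor 1 (mtensor 1 (incl b))

/-- A weak multiplier Hopf algebra `(A, Δ)`. The counit and the idempotent `E` are determined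
by `Δ`. -/
structure WeakMultiplierHopfAlgebra (A : Type*) [NonUnitalRing A] [Module ℂ A]
    [IsScalarTower ℂ A A] [SMulCommClass ℂ A A] extends Coproduct A where
  nondegenerate_left : ∀ a : A, (∀ b, a * b = 0) → a = 0
  nondegenerate_right : ∀ a : A, (∀ b, b * a = 0) → a = 0
  idempotent : Submodule.span ℂ {x : A | ∃ a b, x = a * b} = ⊤
  /-- the left leg of `Δ` is all of `A` -/
  full_left : ∀ V : Submodule ℂ A,
    (∀ a b, T₁ (a ⊗ₜ b) ∈ LinearMap.range (V.subtype.rTensor A)) → V = ⊤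
  /-- the right leg of `Δ` is all of `A` -/
  full_right : ∀ V : Submodule ℂ A,
    (∀ a b, T₂ (a ⊗ₜ b) ∈ LinearMap.range (V.subtype.lTensor A)) → V = ⊤
  /-- the counit `ε` -/
  counit : A →ₗ[ℂ] ℂ
  counit_left : ∀ a b, TensorProduct.lid ℂ A (counit.rTensor A (T₁ (a ⊗ₜ b))) = a * b
  counit_right : ∀ a b, TensorProduct.rid ℂ A (counit.lTensor A (T₂ (a ⊗ₜ b))) = a * b
  /-- the canonical idempotent `E` -/
  E : Mult (A ⊗[ℂ] A)
  E_idem : E * E = E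
  range_T₁ : LinearMap.range T₁ = LinearMap.range E.l
  range_T₂ : LinearMap.range T₂ = LinearMap.range E.r
  /-- `(id ⊗ Δ)E = (E ⊗ 1)(1 ⊗ E)` -/
  comul_E : IsExtension (idTensorComul comul) (leg23 E) E (leg12 E * leg23 E)
  E_comm : leg12 E * leg23 E = leg23 E * leg12 E
  /-- `Ker T₁ = (1 - G₁)(A ⊗ A)` with
  `(G₁ ⊗ id)(Δ₁₃(a)(1 ⊗ b ⊗ c)) = Δ₁₃(a)(1 ⊗ E)(1 ⊗ b ⊗ c)`: for `t ∈ A ⊗ A ⊗ A` with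
  `t = Δ₁₃(a)(1 ⊗ b ⊗ c)` the element `(G₁ ⊗ id)(t)` is the right-hand side. -/
  ker_T₁ : ∃ G₁ : A ⊗[ℂ] A →ₗ[ℂ] A ⊗[ℂ] A,
    (∀ a b c, ∀ t : A ⊗[ℂ] (A ⊗[ℂ] A),
      incl t = leg13 (comul a) * mtensor 1 (incl (b ⊗ₜ c)) →
      incl (TensorProduct.assoc ℂ A A A
          (G₁.rTensor A ((TensorProduct.assoc ℂ A A A).symm t))) =
        leg13 (comul a) * leg23 E * mtensor 1 (incl (b ⊗ₜ c))) ∧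
    LinearMap.ker T₁ = LinearMap.range (LinearMap.id - G₁)
  /-- `Ker T₂ = (1 - G₂)(A ⊗ A)` with
  `(id ⊗ G₂)((a ⊗ b ⊗ 1)Δ₁₃(c)) = (a ⊗ b ⊗ 1)(E ⊗ 1)Δ₁₃(c)`. -/
  ker_T₂ : ∃ G₂ : A ⊗[ℂ] A →ₗ[ℂ] A ⊗[ℂ] A,
    (∀ a b c, ∀ t : A ⊗[ℂ] (A ⊗[ℂ] A),
      incl t = leg12 (incl (a ⊗ₜ b)) * leg13 (comul c) →
      incl (G₂.lTensor A t) = leg12 (incl (a ⊗ₜ b)) * leg12 E * leg13 (comul c)) ∧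
    LinearMap.ker T₂ = LinearMap.range (LinearMap.id - G₂)

section Theory

variable {A : Type*} [NonUnitalRing A] [Module ℂ A] [IsScalarTower ℂ A A] [SMulCommClass ℂ A A]

/-- Regularity: `Δ(a)(b ⊗ 1)` and `(1 ⊗ a)Δ(b)` lie in `A ⊗ A`, and `(A, Δ^cop)` is again a weak
multiplier Hopf algebra. -/
def WeakMultiplierHopfAlgebra.IsRegular (W : WeakMultiplierHopfAlgebra A) : Prop :=
  (∀ a b, W.comul a * mtensor (incl b) 1 ∈ LinearMap.range (incl (A := A ⊗[ℂ] A))) ∧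
  (∀ a b, mtensor 1 (incl a) * W.comul b ∈ LinearMap.range (incl (A := A ⊗[ℂ] A))) ∧
  ∃ W' : WeakMultiplierHopfAlgebra A, ∀ a, W'.comul a = flip (W.comul a)

/-- The map `x ⊗ y ↦ S(x) y`, for `S : A → M(A)`. -/
def applyMul (S : A →ₗ[ℂ] Mult A) : A ⊗[ℂ] A →ₗ[ℂ] A :=
  TensorProduct.lift
    (LinearMap.mk₂ ℂ (fun x y => (S x).l y)
      (fun x x' y => by rw [map_add]; rfl) (fun c x y => by rw [map_smul]; rfl)
      (fun x y y' => map_add _ _ _) (fun c x y => map_smul _ _ _))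

/-- The map `x ↦ S(x) b`. -/
def mulOnRight (S : A →ₗ[ℂ] Mult A) (b : A) : A →ₗ[ℂ] A where
  toFun x := (S x).l b
  map_add' x y := by rw [map_add]; rfl
  map_smul' c x := by rw [map_smul]; rfl

/-- The map `x ↦ a S(x)`. -/
def mulOnLeft (S : A →ₗ[ℂ] Mult A) (a : A) : A →ₗ[ℂ] A where
  toFun x := (S x).r a
  map_add' x y := by rw [map_add]; rfl
  map_smul' c x := by rw [map_smul]; rfl

/-- `S : A → M(A)` is the antipode. There are maps `P₁(a ⊗ b) = ∑ a₁ ⊗ S(a₂) b` and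
`P₂(a ⊗ b) = ∑ a S(b₁) ⊗ b₂` from `A ⊗ A` to itself (the legs are covered by `c`) with
`T₁ P₁ = E ·` and `T₂ P₂ = · E`, and `∑ a₁ S(a₂) a₃ = a` and `∑ S(a₁) a₂ S(a₃) = S(a)`
(covered by `b` on the right). -/
def WeakMultiplierHopfAlgebra.IsAntipode (W : WeakMultiplierHopfAlgebra A)
    (S : A →ₗ[ℂ] Mult A) : Prop :=
  ∃ P₁ P₂ : A ⊗[ℂ] A →ₗ[ℂ] A ⊗[ℂ] A,
    (∀ a b c, (LinearMap.mulLeft ℂ c).rTensor A (P₁ (a ⊗ₜ b)) =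
      (mulOnRight S b).lTensor A (W.T₂ (c ⊗ₜ a))) ∧
    (∀ a b c, (LinearMap.mulRight ℂ c).lTensor A (P₂ (a ⊗ₜ b)) =
      (mulOnLeft S a).rTensor A (W.T₁ (b ⊗ₜ c))) ∧
    (∀ p, W.T₁ (P₁ p) = W.E.l p) ∧
    (∀ p, W.T₂ (P₂ p) = W.E.r p) ∧
    (∀ a b, LinearMap.mul' ℂ A (P₁ (W.T₁ (a ⊗ₜ b))) = a * b) ∧
    (∀ a b, applyMul S (W.T₁ (P₁ (a ⊗ₜ b))) = (S a).l b)

/-- `R ∈ M(A ⊗ A)` is an `E`-inverse element: there is an `R'` with `R R' = E^cop`, `R' R = E`,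
`R E = R` and `R' E^cop = R'`. -/
def WeakMultiplierHopfAlgebra.IsEInverse (W : WeakMultiplierHopfAlgebra A)
    (R : Mult (A ⊗[ℂ] A)) : Prop :=
  ∃ R' : Mult (A ⊗[ℂ] A),
    R * R' = flip W.E ∧ R' * R = W.E ∧ R * W.E = R ∧ R' * flip W.E = R'

/-- `(A, R)` is a quasitriangular weak multiplier Hopf algebra. -/
structure WeakMultiplierHopfAlgebra.IsQuasitriangular (W : WeakMultiplierHopfAlgebra A)
    (R : Mult (A ⊗[ℂ] A)) : Prop where
  regular : W.IsRegular
  eInverse : W.IsEInverse R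
  /-- `(Δ ⊗ id)(R) = R¹³ R²³` -/
  comul_id : IsExtension (comulTensorId W.comul) (leg12 W.E) R (leg13 R * leg23 R)
  /-- `(id ⊗ Δ)(R) = R¹³ R¹²` -/
  id_comul : IsExtension (idTensorComul W.comul) (leg23 W.E) R (leg13 R * leg12 R)
  /-- `Δ^cop(a) R = R Δ(a)` -/
  intertwine : ∀ a, flip (W.comul a) * R = R * W.comul a

/-- `R(a ⊗ 1)`, `(a ⊗ 1)R`, `R(1 ⊗ a)` and `(1 ⊗ a)R` lie in `A ⊗ A` for all `a ∈ A`. -/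
def IsCovered (R : Mult (A ⊗[ℂ] A)) : Prop :=
  ∀ a : A, R * mtensor (incl a) 1 ∈ LinearMap.range (incl (A := A ⊗[ℂ] A)) ∧
    mtensor (incl a) 1 * R ∈ LinearMap.range (incl (A := A ⊗[ℂ] A)) ∧
    R * mtensor 1 (incl a) ∈ LinearMap.range (incl (A := A ⊗[ℂ] A)) ∧
    mtensor 1 (incl a) * R ∈ LinearMap.range (incl (A := A ⊗[ℂ] A))

/-- `u ∈ M(A)` is the Drinfeld element of `R` for the antipode `S : A → A`:
`u a = ∑ S(R₂) R₁ a`, where `R(a ⊗ 1) = ∑ R₁ a ⊗ R₂ ∈ A ⊗ A`, and `a u = u S⁻²(a)`. -/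
def IsDrinfeldElement (S : A ≃ₗ[ℂ] A) (R : Mult (A ⊗[ℂ] A)) (u : Mult A) : Prop :=
  (∀ a, ∀ p : A ⊗[ℂ] A, incl p = R * mtensor (incl a) 1 →
    u.l a = LinearMap.mul' ℂ A (S.toLinearMap.rTensor A (TensorProduct.comm ℂ A A p))) ∧
  ∀ a, u.r a = u.l (S.symm (S.symm a))

/-- `n = S(m)` for the extension to `M(A)` of the anti-automorphism `S` of `A`, that is,
`n S(a) = S(a m)` and `S(a) n = S(m a)` for all `a ∈ A`. -/
def IsAntiExtension (S : A ≃ₗ[ℂ] A) (m n : Mult A) : Prop :=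
  (∀ a, n.l (S a) = S (m.r a)) ∧ ∀ a, n.r (S a) = S (m.l a)

/-- An element `h` of `M(A)` is grouplike if it is invertible and
`Δ(h) = (h ⊗ h) E = E (h ⊗ h)`, for the extension of `Δ` to `M(A)` with `Δ(1) = E`. -/
def WeakMultiplierHopfAlgebra.IsGrouplike (W : WeakMultiplierHopfAlgebra A) (h : Mult A) : Prop :=
  IsUnit h ∧ IsExtension W.comul W.E h (mtensor h h * W.E) ∧
    mtensor h h * W.E = W.E * mtensor h h

end Theory

end WMHA

end

/-! The argument is Drinfeld's for quasitriangular Hopf algebras, carried out without a unit and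
with E in the role of 1. Sweedler sums only make sense with enough legs covered by elements of A. An
identity of multipliers is therefore tested after multiplying by elements of A, or by values of Δ
(`eq_of_mul_D`), and an identity linear in the first leg of Δ is tested by fullness (`full_ext`).

Antipode. The axioms do not contain S, so it is constructed. With G₁ the map describing ker T₁, put
ε_s(a)b = (ε ⊗ id)G₁(a ⊗ b) (`es`). These source elements satisfy ∑ ε_s(a₁) ⊗ a₂ = (1 ⊗ a)E
(`es_T₁`, `er_T₁`), which makes them multipliers and yields Δ(ε_s(a)b) = (1 ⊗ ε_s(a))Δ(b). Since
`es` kills ker T₁, the value S(a)b := es(w), for any w with T₁(w) = E(a ⊗ b), is well defined (`s`).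
Regularity provides the same map S' for Δ^cop, and S'(S(a)b) = S'(b)a (`s_s`) forces both maps into
A and makes them mutually inverse. S reverses the coproduct (`D_S`) because Δ∘S and (S ⊗ S)∘Δ^cop
have the same convolution product with Δ, namely Δ∘ε_s.

Drinfeld element. The intertwining relation and (ε_s(a) ⊗ 1)R = R(1 ⊗ ε_s(a)) give S²(c)u = uc
(`drl_S_S_mul`), so u is a multiplier with au = uS⁻²(a). Writing E^cop = R R̄ shows that u acts
surjectively, hence u is invertible. Applying S gives vS²(m) = mv and S(v) = u, from which uv = vu
and the centrality of uv follow.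

Grouplike element. From (Δ ⊗ id)(R) = R¹³R²³ one gets (S ⊗ id)(R) = R̄ (`inj_S_cov₂`). The same for
τ(R) and Δ^cop gives (id ⊗ S⁻¹)(R) = R̄, and together (S ⊗ S)(R) = R (`aSS_R`). Then Δ(u) = R̄R̄²¹(u
⊗ u) (`D_u_l`), and S turns this into Δ(v) = (v ⊗ v)R̄R̄²¹ (`D_v_r`). The factor R̄R̄²¹ is fixed by
S² ⊗ S², commutes with Δ(a), and has R²¹R as inverse relative to E. It therefore cancels when Δ(hv)
is compared with Δ(u), leaving Δ(h) = (h ⊗ h)E (`D_h_l`). Finally S⁴(a)u = uS²(a) and vS²(a) = av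
give S⁴(a)h = ha. -/

noncomputable section

set_option linter.unusedSectionVars false

namespace WMHA

/-! ### Separating families of linear maps and tensor products. -/

section Tensor

variable {V B C : Type*} [AddCommGroup V] [Module ℂ V] [AddCommGroup B] [Module ℂ B]
  [AddCommGroup C] [Module ℂ C]

/-- A jointly injective family of maps stays jointly injective after tensoring on the left. -/
theorem lTensor_separating {ι : Type*} (f : ι → B →ₗ[ℂ] C) (hf : ∀ b, (∀ i, f i b = 0) → b = 0)
    (x : V ⊗[ℂ] B) (hx : ∀ i, (f i).lTensor V x = 0) : x = 0 := by
  classical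
  let 𝒷 := Module.Basis.ofVectorSpace ℂ V
  have key : ∀ (g : B →ₗ[ℂ] C) (y : V ⊗[ℂ] B) j,
      TensorProduct.equivFinsuppOfBasisLeft 𝒷 (g.lTensor V y) j =
        g (TensorProduct.equivFinsuppOfBasisLeft 𝒷 y j) := by
    intro g y j
    induction y with
    | zero => simp only [map_zero, Finsupp.coe_zero, Pi.zero_apply]
    | add y y' hy hy' => simp only [map_add, Finsupp.coe_add, Pi.add_apply, hy, hy']
    | tmul v b => simp
  refine (TensorProduct.equivFinsuppOfBasisLeft 𝒷 (N := B)).injective ?_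
  ext j
  rw [map_zero, Finsupp.coe_zero, Pi.zero_apply]
  refine hf _ fun i => ?_
  rw [← key, hx, map_zero, Finsupp.coe_zero, Pi.zero_apply]

/-- A jointly injective family of maps stays jointly injective after tensoring on the right. -/
theorem rTensor_separating {ι : Type*} (f : ι → B →ₗ[ℂ] C) (hf : ∀ b, (∀ i, f i b = 0) → b = 0)
    (x : B ⊗[ℂ] V) (hx : ∀ i, (f i).rTensor V x = 0) : x = 0 := by
  refine (TensorProduct.comm ℂ B V).injective ?_
  rw [map_zero]
  refine lTensor_separating f hf _ fun i => ?_
  rw [← LinearMap.comm_comp_rTensor_comp_comm_eq]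
  simp [hx]

end Tensor

/-! ### Multipliers of non-degenerate algebras and leg numbering. -/

section Multipliers

/-- Multipliers of `A`, as a plain structure. -/
@[ext]
structure Multiplier (A : Type*) [NonUnitalRing A] [Module ℂ A] where
  l : A →ₗ[ℂ] A
  r : A →ₗ[ℂ] A
  l_mul : ∀ a b, l (a * b) = l a * b
  r_mul : ∀ a b, r (a * b) = a * r b
  compat : ∀ a b, r a * b = a * l b

/-- The product of `A` is non-degenerate. -/
class NonDeg (A : Type*) [NonUnitalRing A] : Prop where
  left : ∀ a : A, (∀ b, a * b = 0) → a = 0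
  right : ∀ a : A, (∀ b, b * a = 0) → a = 0

theorem eq_of_mul_right {A : Type*} [NonUnitalRing A] [NonDeg A] {a b : A}
    (h : ∀ c, a * c = b * c) : a = b := by
  rw [← sub_eq_zero]
  exact NonDeg.left _ fun c => by rw [sub_mul, h, sub_self]

theorem eq_of_mul_left {A : Type*} [NonUnitalRing A] [NonDeg A] {a b : A}
    (h : ∀ c, c * a = c * b) : a = b := by
  rw [← sub_eq_zero]
  exact NonDeg.right _ fun c => by rw [mul_sub, h, sub_self]

namespace Multiplier

section Basic

variable {A : Type*} [NonUnitalRing A] [Module ℂ A]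

instance : Zero (Multiplier A) :=
  ⟨⟨0, 0, fun _ b => (zero_mul b).symm, fun a _ => (mul_zero a).symm,
    fun a b => (zero_mul b).trans (mul_zero a).symm⟩⟩

instance : Add (Multiplier A) :=
  ⟨fun m n => ⟨m.l + n.l, m.r + n.r,
    fun a b => by simp only [LinearMap.add_apply, m.l_mul, n.l_mul, add_mul],
    fun a b => by simp only [LinearMap.add_apply, m.r_mul, n.r_mul, mul_add],
    fun a b => by simp only [LinearMap.add_apply, m.compat, n.compat, mul_add, add_mul]⟩⟩

instance : Neg (Multiplier A) :=
  ⟨fun m => ⟨-m.l, -m.r,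
    fun a b => by simp only [LinearMap.neg_apply, m.l_mul, neg_mul],
    fun a b => by simp only [LinearMap.neg_apply, m.r_mul, mul_neg],
    fun a b => by simp only [LinearMap.neg_apply, m.compat, mul_neg, neg_mul]⟩⟩

instance : Ring (Multiplier A) where
  mul m n := ⟨m.l ∘ₗ n.l, n.r ∘ₗ m.r,
    fun a b => by simp only [LinearMap.comp_apply, m.l_mul, n.l_mul],
    fun a b => by simp only [LinearMap.comp_apply, m.r_mul, n.r_mul],
    fun a b => by simp only [LinearMap.comp_apply, m.compat, n.compat]⟩
  one := ⟨LinearMap.id, LinearMap.id, fun _ _ => rfl, fun _ _ => rfl, fun _ _ => rfl⟩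
  mul_assoc _ _ _ := rfl
  one_mul _ := rfl
  mul_one _ := rfl
  add_assoc m n k := Multiplier.ext (add_assoc m.l n.l k.l) (add_assoc m.r n.r k.r)
  zero_add m := Multiplier.ext (zero_add m.l) (zero_add m.r)
  add_zero m := Multiplier.ext (add_zero m.l) (add_zero m.r)
  add_comm m n := Multiplier.ext (add_comm m.l n.l) (add_comm m.r n.r)
  neg_add_cancel m := Multiplier.ext (neg_add_cancel m.l) (neg_add_cancel m.r)
  left_distrib m n k := Multiplier.ext (LinearMap.comp_add n.l k.l m.l)
    (LinearMap.add_comp m.r k.r n.r)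
  right_distrib m n k := Multiplier.ext (LinearMap.add_comp k.l n.l m.l)
    (LinearMap.comp_add m.r n.r k.r)
  zero_mul m := Multiplier.ext (LinearMap.zero_comp m.l) (LinearMap.comp_zero m.r)
  mul_zero m := Multiplier.ext (LinearMap.comp_zero m.l) (LinearMap.zero_comp m.r)
  nsmul := nsmulRec
  zsmul := zsmulRec

@[simp] theorem mul_l (m n : Multiplier A) (a : A) : (m * n).l a = m.l (n.l a) := rfl
@[simp] theorem mul_r (m n : Multiplier A) (a : A) : (m * n).r a = n.r (m.r a) := rfl

theorem ext_l [NonDeg A] {m n : Multiplier A} (h : ∀ a, m.l a = n.l a) : m = n :=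
  Multiplier.ext (LinearMap.ext h) (LinearMap.ext fun a => eq_of_mul_right fun c => by
    rw [m.compat, n.compat, h])

theorem ext_r [NonDeg A] {m n : Multiplier A} (h : ∀ a, m.r a = n.r a) : m = n :=
  ext_l fun a => eq_of_mul_left fun c => by rw [← m.compat, ← n.compat, h]

theorem l_r [NonDeg A] (m n : Multiplier A) (a : A) : m.l (n.r a) = n.r (m.l a) :=
  eq_of_mul_right fun c => by rw [← m.l_mul, n.compat, n.compat, m.l_mul]

/-- A multiplier of a non-degenerate algebra from a compatible pair of linear maps. -/
def of [NonDeg A] (l r : A →ₗ[ℂ] A) (h : ∀ a b, r a * b = a * l b) : Multiplier A :=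
  ⟨l, r, fun a b => eq_of_mul_left fun c => by rw [← h, ← mul_assoc, ← mul_assoc, ← h],
    fun a b => eq_of_mul_right fun c => by rw [h, mul_assoc, mul_assoc, h], h⟩

/-- An element of `A` as a multiplier. -/
def inj [IsScalarTower ℂ A A] [SMulCommClass ℂ A A] (a : A) : Multiplier A :=
  ⟨LinearMap.mulLeft ℂ a, LinearMap.mulRight ℂ a, fun b c => (mul_assoc a b c).symm,
    fun b c => mul_assoc b c a, fun b c => mul_assoc b a c⟩

variable [IsScalarTower ℂ A A] [SMulCommClass ℂ A A]

@[simp] theorem inj_l (a b : A) : (inj a).l b = a * b := rfl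
@[simp] theorem inj_r (a b : A) : (inj a).r b = b * a := rfl

theorem inj_add (a b : A) : inj (a + b) = inj a + inj b :=
  Multiplier.ext (LinearMap.ext fun c => add_mul a b c) (LinearMap.ext fun c => mul_add c a b)

@[simp] theorem inj_zero : inj (0 : A) = 0 :=
  Multiplier.ext (LinearMap.ext fun c => zero_mul c) (LinearMap.ext fun c => mul_zero c)

theorem inj_mul (a b : A) : inj (a * b) = inj a * inj b :=
  Multiplier.ext (LinearMap.ext fun c => mul_assoc a b c)
    (LinearMap.ext fun c => (mul_assoc c a b).symm)

theorem inj_injective [NonDeg A] : Function.Injective (inj : A → Multiplier A) :=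
  fun a b h => eq_of_mul_right fun c => by
    rw [← inj_l, ← inj_l, h]

theorem mul_inj [NonDeg A] (m : Multiplier A) (a : A) : m * inj a = inj (m.l a) :=
  ext_l fun x => by rw [mul_l, inj_l, inj_l, m.l_mul]

theorem inj_mul' [NonDeg A] (m : Multiplier A) (a : A) : inj a * m = inj (m.r a) :=
  ext_l fun x => by rw [mul_l, inj_l, inj_l, m.compat]

theorem eq_of_mul_inj [NonDeg A] {m n : Multiplier A} (h : ∀ a, m * inj a = n * inj a) :
    m = n := ext_l fun a => inj_injective (by rw [← mul_inj, ← mul_inj, h])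

theorem eq_of_inj_mul [NonDeg A] {m n : Multiplier A} (h : ∀ a, inj a * m = inj a * n) :
    m = n := ext_r fun a => inj_injective (by rw [← inj_mul', ← inj_mul', h])

/-- The passage from `M(A)` to the plain structure. -/
def up (m : Mult A) : Multiplier A := ⟨m.l, m.r, m.l_mul, m.r_mul, m.r_mul_eq⟩

/-- The passage from the plain structure to `M(A)`. -/
def down (m : Multiplier A) : Mult A := Mult.mk m.l m.r m.l_mul m.r_mul m.compat

@[simp] theorem up_down (m : Multiplier A) : up (down m) = m := rfl
@[simp] theorem down_up (m : Mult A) : down (up m) = m := rfl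

theorem up_injective : Function.Injective (up : Mult A → Multiplier A) :=
  fun m n h => by rw [← down_up m, h, down_up]

theorem up_mul (m n : Mult A) : up (m * n) = up m * up n := rfl
theorem up_one : up (1 : Mult A) = 1 := rfl

end Basic

section Tensor

variable {A B : Type*} [NonUnitalRing A] [Module ℂ A] [IsScalarTower ℂ A A]
  [SMulCommClass ℂ A A] [NonUnitalRing B] [Module ℂ B] [IsScalarTower ℂ B B]
  [SMulCommClass ℂ B B]

theorem tmul_mul (a : A) (b : B) (x : A ⊗[ℂ] B) :
    (a ⊗ₜ b) * x = TensorProduct.map (LinearMap.mulLeft ℂ a) (LinearMap.mulLeft ℂ b) x := by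
  induction x with
  | zero => rw [mul_zero, map_zero]
  | add x y hx hy => rw [mul_add, map_add, hx, hy]
  | tmul c d => rw [Algebra.TensorProduct.tmul_mul_tmul]; rfl

theorem mul_tmul (a : A) (b : B) (x : A ⊗[ℂ] B) :
    x * (a ⊗ₜ b) = TensorProduct.map (LinearMap.mulRight ℂ a) (LinearMap.mulRight ℂ b) x := by
  induction x with
  | zero => rw [zero_mul, map_zero]
  | add x y hx hy => rw [add_mul, map_add, hx, hy]
  | tmul c d => rw [Algebra.TensorProduct.tmul_mul_tmul]; rfl

instance [NonDeg A] [NonDeg B] : NonDeg (A ⊗[ℂ] B) where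
  left x hx := by
    refine rTensor_separating (fun a : A => LinearMap.mulRight ℂ a)
      (fun b hb => NonDeg.left b hb) x fun a => ?_
    refine lTensor_separating (fun a : B => LinearMap.mulRight ℂ a)
      (fun b hb => NonDeg.left b hb) _ fun b => ?_
    rw [← LinearMap.comp_apply, LinearMap.lTensor_comp_rTensor, ← mul_tmul, hx]
  right x hx := by
    refine rTensor_separating (fun a : A => LinearMap.mulLeft ℂ a)
      (fun b hb => NonDeg.right b hb) x fun a => ?_
    refine lTensor_separating (fun a : B => LinearMap.mulLeft ℂ a)
      (fun b hb => NonDeg.right b hb) _ fun b => ?_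
    rw [← LinearMap.comp_apply, LinearMap.lTensor_comp_rTensor, ← tmul_mul, hx]

/-- The tensor product of two multipliers. -/
def tens (x : Multiplier A) (y : Multiplier B) : Multiplier (A ⊗[ℂ] B) := up (mtensor x.down y.down)

@[simp] theorem tens_l_tmul (x : Multiplier A) (y : Multiplier B) (a : A) (b : B) :
    (tens x y).l (a ⊗ₜ b) = x.l a ⊗ₜ y.l b := rfl

theorem up_mtensor (x : Mult A) (y : Mult B) : up (mtensor x y) = tens (up x) (up y) := rfl

theorem tens_mul (x x' : Multiplier A) (y y' : Multiplier B) :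
    tens x y * tens x' y' = tens (x * x') (y * y') :=
  Multiplier.ext (TensorProduct.ext' fun _ _ => rfl) (TensorProduct.ext' fun _ _ => rfl)

@[simp] theorem tens_one : tens (1 : Multiplier A) (1 : Multiplier B) = 1 :=
  Multiplier.ext (TensorProduct.ext' fun _ _ => rfl) (TensorProduct.ext' fun _ _ => rfl)

theorem inj_tmul (a : A) (b : B) : inj (a ⊗ₜ[ℂ] b) = tens (inj a) (inj b) :=
  Multiplier.ext (LinearMap.ext fun x => tmul_mul a b x) (LinearMap.ext fun x => mul_tmul a b x)

/-- `x ⊗ 1`. -/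
def fst (x : Multiplier A) : Multiplier (A ⊗[ℂ] B) := tens x 1

/-- `1 ⊗ y`. -/
def snd (y : Multiplier B) : Multiplier (A ⊗[ℂ] B) := tens 1 y

theorem fst_mul (x y : Multiplier A) : (fst (x * y) : Multiplier (A ⊗[ℂ] B)) = fst x * fst y := by
  rw [fst, fst, fst, tens_mul, mul_one]

theorem snd_mul (x y : Multiplier B) : (snd (x * y) : Multiplier (A ⊗[ℂ] B)) = snd x * snd y := by
  rw [snd, snd, snd, tens_mul, mul_one]

theorem fst_mul_snd (x : Multiplier A) (y : Multiplier B) : fst x * snd y = tens x y := by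
  rw [fst, snd, tens_mul, one_mul, mul_one]

theorem snd_mul_fst (x : Multiplier A) (y : Multiplier B) : snd y * fst x = tens x y := by
  rw [fst, snd, tens_mul, one_mul, mul_one]

theorem fst_snd_comm (x : Multiplier A) (y : Multiplier B) : fst x * snd y = snd y * fst x := by
  rw [fst_mul_snd, snd_mul_fst]

theorem eq_of_mul_snd_inj [NonDeg A] [NonDeg B] {X Y : Multiplier (A ⊗[ℂ] B)}
    (h : ∀ b, X * snd (inj b) = Y * snd (inj b)) : X = Y :=
  ext_r fun z => sub_eq_zero.1 (lTensor_separating (fun b : B => LinearMap.mulRight ℂ b)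
    (fun b hb => NonDeg.left b hb) _ fun b => by
      have := congrArg (fun m => Multiplier.r m z) (h b)
      rw [map_sub, sub_eq_zero]
      exact this)

theorem eq_of_fst_inj_mul [NonDeg A] [NonDeg B] {X Y : Multiplier (A ⊗[ℂ] B)}
    (h : ∀ a, fst (inj a) * X = fst (inj a) * Y) : X = Y :=
  ext_l fun z => sub_eq_zero.1 (rTensor_separating (fun b : A => LinearMap.mulLeft ℂ b)
    (fun b hb => NonDeg.right b hb) _ fun b => by
      have := congrArg (fun m => Multiplier.l m z) (h b)
      rw [map_sub, sub_eq_zero]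
      exact this)

theorem eq_of_snd_inj_mul [NonDeg A] [NonDeg B] {X Y : Multiplier (A ⊗[ℂ] B)}
    (h : ∀ b, snd (inj b) * X = snd (inj b) * Y) : X = Y :=
  ext_l fun z => sub_eq_zero.1 (lTensor_separating (fun b : B => LinearMap.mulLeft ℂ b)
    (fun b hb => NonDeg.right b hb) _ fun b => by
      have := congrArg (fun m => Multiplier.l m z) (h b)
      rw [map_sub, sub_eq_zero]
      exact this)

@[simp] theorem fst_l_tmul (x : Multiplier A) (a : A) (b : B) :
    (fst x).l (a ⊗ₜ[ℂ] b) = x.l a ⊗ₜ b := rfl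

@[simp] theorem fst_r_tmul (x : Multiplier A) (a : A) (b : B) :
    (fst x).r (a ⊗ₜ[ℂ] b) = x.r a ⊗ₜ b := rfl

@[simp] theorem snd_l_tmul (y : Multiplier B) (a : A) (b : B) :
    (snd y).l (a ⊗ₜ[ℂ] b) = a ⊗ₜ y.l b := rfl

@[simp] theorem snd_r_tmul (y : Multiplier B) (a : A) (b : B) :
    (snd y).r (a ⊗ₜ[ℂ] b) = a ⊗ₜ y.r b := rfl

theorem fst_l (x : Multiplier A) (z : A ⊗[ℂ] B) : (fst x).l z = x.l.rTensor B z := rfl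

theorem fst_r (x : Multiplier A) (z : A ⊗[ℂ] B) : (fst x).r z = x.r.rTensor B z := rfl

theorem snd_l (y : Multiplier B) (z : A ⊗[ℂ] B) : (snd y).l z = y.l.lTensor A z := rfl

theorem snd_r (y : Multiplier B) (z : A ⊗[ℂ] B) : (snd y).r z = y.r.lTensor A z := rfl

/-! ### Transport -/

section Transport

/-- Transport along an isomorphism of algebras. -/
def map (e : A ≃ₗ[ℂ] B) (he : ∀ a b, e (a * b) = e a * e b) (m : Multiplier A) : Multiplier B :=
  up (Mult.transport e he m.down)

variable (e : A ≃ₗ[ℂ] B) (he : ∀ a b, e (a * b) = e a * e b)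

theorem map_l (m : Multiplier A) (b : B) : (map e he m).l b = e (m.l (e.symm b)) := rfl

theorem map_r (m : Multiplier A) (b : B) : (map e he m).r b = e (m.r (e.symm b)) := rfl

theorem map_mul (m n : Multiplier A) : map e he (m * n) = map e he m * map e he n :=
  Multiplier.ext
    (LinearMap.ext fun b => by simp only [map_l, mul_l, e.symm_apply_apply])
    (LinearMap.ext fun b => by simp only [map_r, mul_r, e.symm_apply_apply])

theorem map_inj (a : A) : map e he (inj a) = inj (e a) :=
  Multiplier.ext
    (LinearMap.ext fun b => by simp only [map_l, inj_l, he, e.apply_symm_apply])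
    (LinearMap.ext fun b => by simp only [map_r, inj_r, he, e.apply_symm_apply])

end Transport

/-! ### Anti-automorphisms -/

section Anti

theorem anti_symm (e : A ≃ₗ[ℂ] A) (he : ∀ a b, e (a * b) = e b * e a) (a b : A) :
    e.symm (a * b) = e.symm b * e.symm a :=
  e.injective (by simp only [he, e.apply_symm_apply])

/-- The extension of an anti-automorphism of `A` to multipliers. -/
def anti (e : A ≃ₗ[ℂ] A) (he : ∀ a b, e (a * b) = e b * e a) (m : Multiplier A) :
    Multiplier A where
  l := e.conj m.r
  r := e.conj m.l
  l_mul a b := by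
    simp only [LinearEquiv.conj_apply_apply, anti_symm e he, m.r_mul, he, e.apply_symm_apply]
  r_mul a b := by
    simp only [LinearEquiv.conj_apply_apply, anti_symm e he, m.l_mul, he, e.apply_symm_apply]
  compat a b := e.symm.injective (by
    simp only [LinearEquiv.conj_apply_apply, anti_symm e he, m.compat, e.symm_apply_apply])

variable (e : A ≃ₗ[ℂ] A) (he : ∀ a b, e (a * b) = e b * e a)

theorem anti_l (m : Multiplier A) (a : A) : (anti e he m).l a = e (m.r (e.symm a)) := rfl

theorem anti_r (m : Multiplier A) (a : A) : (anti e he m).r a = e (m.l (e.symm a)) := rfl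

theorem anti_mul (m n : Multiplier A) : anti e he (m * n) = anti e he n * anti e he m :=
  Multiplier.ext
    (LinearMap.ext fun b => by simp only [anti_l, mul_l, mul_r, e.symm_apply_apply])
    (LinearMap.ext fun b => by simp only [anti_r, mul_l, mul_r, e.symm_apply_apply])

theorem anti_one : anti e he 1 = 1 :=
  Multiplier.ext (LinearMap.ext fun b => e.apply_symm_apply b)
    (LinearMap.ext fun b => e.apply_symm_apply b)

theorem anti_inj (a : A) : anti e he (inj a) = inj (e a) :=
  Multiplier.ext
    (LinearMap.ext fun b => by simp only [anti_l, inj_l, inj_r, he, e.apply_symm_apply])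
    (LinearMap.ext fun b => by simp only [anti_r, inj_l, inj_r, he, e.apply_symm_apply])

end Anti

end Tensor

/-! ### Legs -/

section Legs

variable {A : Type*} [NonUnitalRing A] [Module ℂ A] [IsScalarTower ℂ A A] [SMulCommClass ℂ A A]

/-- The flip of a multiplier of `A ⊗ A`. -/
def cop (X : Multiplier (A ⊗[ℂ] A)) : Multiplier (A ⊗[ℂ] A) :=
  map (TensorProduct.comm ℂ A A) comm_mul X

theorem cop_l (X : Multiplier (A ⊗[ℂ] A)) (z : A ⊗[ℂ] A) :
    (cop X).l z = TensorProduct.comm ℂ A A (X.l (TensorProduct.comm ℂ A A z)) := rfl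

theorem cop_r (X : Multiplier (A ⊗[ℂ] A)) (z : A ⊗[ℂ] A) :
    (cop X).r z = TensorProduct.comm ℂ A A (X.r (TensorProduct.comm ℂ A A z)) := rfl

theorem cop_mul (X Y : Multiplier (A ⊗[ℂ] A)) : cop (X * Y) = cop X * cop Y := map_mul _ _ _ _

@[simp] theorem comm_comm_apply (z : A ⊗[ℂ] A) :
    TensorProduct.comm ℂ A A (TensorProduct.comm ℂ A A z) = z :=
  (TensorProduct.comm ℂ A A).symm_apply_apply z

@[simp] theorem cop_cop (X : Multiplier (A ⊗[ℂ] A)) : cop (cop X) = X :=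
  Multiplier.ext (LinearMap.ext fun z => by rw [cop_l, cop_l, comm_comm_apply, comm_comm_apply])
    (LinearMap.ext fun z => by rw [cop_r, cop_r, comm_comm_apply, comm_comm_apply])

theorem cop_inj (z : A ⊗[ℂ] A) : cop (inj z) = inj (TensorProduct.comm ℂ A A z) := map_inj _ _ _

@[simp] theorem cop_tens (x y : Multiplier A) : cop (tens x y) = tens y x :=
  Multiplier.ext (TensorProduct.ext' fun _ _ => rfl) (TensorProduct.ext' fun _ _ => rfl)

@[simp] theorem cop_fst (x : Multiplier A) : cop (fst x) = snd x := cop_tens _ _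

@[simp] theorem cop_snd (x : Multiplier A) : cop (snd x) = fst x := cop_tens _ _

/-- Reassociation of multipliers. -/
def reassoc (X : Multiplier ((A ⊗[ℂ] A) ⊗[ℂ] A)) : Multiplier (A ⊗[ℂ] (A ⊗[ℂ] A)) :=
  map (TensorProduct.assoc ℂ A A A) assoc_mul X

theorem reassoc_mul (X Y : Multiplier ((A ⊗[ℂ] A) ⊗[ℂ] A)) :
    reassoc (X * Y) = reassoc X * reassoc Y := map_mul _ _ _ _

theorem reassoc_inj (t : (A ⊗[ℂ] A) ⊗[ℂ] A) :
    reassoc (inj t) = inj (TensorProduct.assoc ℂ A A A t) := map_inj _ _ _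

theorem reassoc_tens (x y z : Multiplier A) : reassoc (tens (tens x y) z) = tens x (tens y z) :=
  Multiplier.ext (TensorProduct.ext_threefold' fun _ _ _ => rfl)
    (TensorProduct.ext_threefold' fun _ _ _ => rfl)

/-- The flip of the last two legs. -/
def swap23 (X : Multiplier (A ⊗[ℂ] (A ⊗[ℂ] A))) : Multiplier (A ⊗[ℂ] (A ⊗[ℂ] A)) :=
  map ((TensorProduct.comm ℂ A A).lTensor A) swap_mul X

theorem swap23_mul (X Y : Multiplier (A ⊗[ℂ] (A ⊗[ℂ] A))) :
    swap23 (X * Y) = swap23 X * swap23 Y := map_mul _ _ _ _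

theorem swap23_tens (x : Multiplier A) (y : Multiplier (A ⊗[ℂ] A)) :
    swap23 (tens x y) = tens x (cop y) :=
  Multiplier.ext (TensorProduct.ext' fun _ _ => rfl) (TensorProduct.ext' fun _ _ => rfl)

/-- `X¹²`. -/
def l12 (X : Multiplier (A ⊗[ℂ] A)) : Multiplier (A ⊗[ℂ] (A ⊗[ℂ] A)) := reassoc (fst X)

/-- `X¹³`. -/
def l13 (X : Multiplier (A ⊗[ℂ] A)) : Multiplier (A ⊗[ℂ] (A ⊗[ℂ] A)) := swap23 (l12 X)

/-- `X²³`. -/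
def l23 (X : Multiplier (A ⊗[ℂ] A)) : Multiplier (A ⊗[ℂ] (A ⊗[ℂ] A)) := snd X

/-- `1 ⊗ 1 ⊗ b`. -/
def third (b : Multiplier A) : Multiplier (A ⊗[ℂ] (A ⊗[ℂ] A)) := snd (snd b)

/-- `1 ⊗ b ⊗ 1`. -/
def second (b : Multiplier A) : Multiplier (A ⊗[ℂ] (A ⊗[ℂ] A)) := snd (fst b)

theorem l12_mul (X Y : Multiplier (A ⊗[ℂ] A)) : l12 (X * Y) = l12 X * l12 Y := by
  rw [l12, fst_mul, reassoc_mul]; rfl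

theorem l23_mul (X Y : Multiplier (A ⊗[ℂ] A)) : l23 (X * Y) = l23 X * l23 Y := snd_mul _ _

theorem l23_add (X Y : Multiplier (A ⊗[ℂ] A)) : l23 (X + Y) = l23 X + l23 Y :=
  Multiplier.ext (LinearMap.lTensor_add _ _ _) (LinearMap.lTensor_add _ _ _)

theorem l23_zero : l23 (0 : Multiplier (A ⊗[ℂ] A)) = 0 :=
  Multiplier.ext (LinearMap.lTensor_zero A) (LinearMap.lTensor_zero A)

theorem l13_mul (X Y : Multiplier (A ⊗[ℂ] A)) : l13 (X * Y) = l13 X * l13 Y := by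
  rw [l13, l12_mul, swap23_mul]; rfl

theorem reassoc_snd (b : Multiplier A) : reassoc (snd b) = third b := by
  rw [snd, ← tens_one, reassoc_tens]; rfl

/-- The third leg commutes with the first two. -/
theorem l12_third (X : Multiplier (A ⊗[ℂ] A)) (b : Multiplier A) :
    l12 X * third b = third b * l12 X := by
  rw [l12, ← reassoc_snd, ← reassoc_mul, ← reassoc_mul, fst_snd_comm]

/-- The first leg commutes with the last two. -/
theorem fst_l23 (X : Multiplier (A ⊗[ℂ] A)) (b : Multiplier A) :
    fst b * l23 X = l23 X * fst b := fst_snd_comm _ _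

theorem l12_l (X : Multiplier (A ⊗[ℂ] A)) (t : (A ⊗[ℂ] A) ⊗[ℂ] A) :
    (l12 X).l (TensorProduct.assoc ℂ A A A t) = TensorProduct.assoc ℂ A A A (X.l.rTensor A t) := by
  rw [l12, reassoc, map_l, LinearEquiv.symm_apply_apply, fst_l]

theorem l12_fst (x : Multiplier A) : l12 (fst x) = fst x := by
  rw [l12, fst, fst, reassoc_tens, tens_one]; rfl

theorem l13_snd (x : Multiplier A) : l13 (snd x) = third x := by
  rw [l13, l12, snd, fst, reassoc_tens, swap23_tens, cop_tens]; rfl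

theorem l13_tens (x y : Multiplier A) : l13 (tens x y) = tens x (snd y) := by
  rw [l13, l12, fst, reassoc_tens, swap23_tens, cop_tens]; rfl

theorem l12_l_tmul (X : Multiplier (A ⊗[ℂ] A)) (z : A ⊗[ℂ] A) (c : A) :
    (l12 X).l (TensorProduct.assoc ℂ A A A (z ⊗ₜ c)) =
      TensorProduct.assoc ℂ A A A (X.l z ⊗ₜ c) := by
  rw [l12, reassoc, map_l, LinearEquiv.symm_apply_apply, fst_l_tmul]

theorem l12_r_tmul (X : Multiplier (A ⊗[ℂ] A)) (z : A ⊗[ℂ] A) (c : A) :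
    (l12 X).r (TensorProduct.assoc ℂ A A A (z ⊗ₜ c)) =
      TensorProduct.assoc ℂ A A A (X.r z ⊗ₜ c) := by
  rw [l12, reassoc, map_r, LinearEquiv.symm_apply_apply, fst_r_tmul]

variable (Δ : A →ₗ[ℂ] Mult (A ⊗[ℂ] A))

/-- `Δ ⊗ id`. -/
def cT (p : A ⊗[ℂ] A) : Multiplier (A ⊗[ℂ] (A ⊗[ℂ] A)) := up (comulTensorId Δ p)

/-- `id ⊗ Δ`. -/
def iT (p : A ⊗[ℂ] A) : Multiplier (A ⊗[ℂ] (A ⊗[ℂ] A)) := up (idTensorComul Δ p)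

theorem cT_add (p q : A ⊗[ℂ] A) : cT Δ (p + q) = cT Δ p + cT Δ q := by
  rw [cT, map_add]; rfl

@[simp] theorem cT_zero : cT Δ 0 = 0 := by rw [cT, map_zero]; rfl

theorem iT_add (p q : A ⊗[ℂ] A) : iT Δ (p + q) = iT Δ p + iT Δ q := by
  rw [iT, map_add]; rfl

@[simp] theorem iT_zero : iT Δ 0 = 0 := by rw [iT, map_zero]; rfl

theorem cT_tmul (a b : A) : cT Δ (a ⊗ₜ b) = l12 (up (Δ a)) * third (inj b) := by
  rw [l12, ← reassoc_snd, ← reassoc_mul, fst_mul_snd]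
  rfl

theorem iT_tmul (a b : A) : iT Δ (a ⊗ₜ b) = fst (inj a) * l23 (up (Δ b)) := by
  rw [l23, fst_mul_snd]
  rfl

end Legs

end Multiplier

end Multipliers

end WMHA

/-! ### The canonical maps, coassociativity and the idempotent E. -/

namespace WMHA

open Multiplier

namespace WeakMultiplierHopfAlgebra

variable {A : Type*} [NonUnitalRing A] [Module ℂ A] [IsScalarTower ℂ A A] [SMulCommClass ℂ A A]
  (W : WeakMultiplierHopfAlgebra A)

theorem nonDeg (W : WeakMultiplierHopfAlgebra A) : NonDeg A := ⟨W.nondegenerate_left, W.nondegenerate_right⟩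

/-- The coproduct with values in plain multipliers. -/
def D (a : A) : Multiplier (A ⊗[ℂ] A) := up (W.comul a)

/-- The canonical idempotent as a plain multiplier. -/
def e : Multiplier (A ⊗[ℂ] A) := up W.E

/-- `x ↦ T₁(x ⊗ b)`. -/
def t₁ (b : A) : A →ₗ[ℂ] A ⊗[ℂ] A := W.T₁ ∘ₗ (TensorProduct.mk ℂ A A).flip b

/-- `x ↦ T₂(c ⊗ x)`. -/
def t₂ (c : A) : A →ₗ[ℂ] A ⊗[ℂ] A := W.T₂ ∘ₗ TensorProduct.mk ℂ A A c

@[simp] theorem t₁_apply (b x : A) : W.t₁ b x = W.T₁ (x ⊗ₜ b) := rfl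

theorem D_mul (a b : A) : W.D (a * b) = W.D a * W.D b := by
  rw [D, W.comul_mul]; rfl

theorem D_add (a b : A) : W.D (a + b) = W.D a + W.D b := by
  rw [D, map_add]; rfl

theorem inj_T₁ (a b : A) : inj (W.T₁ (a ⊗ₜ b)) = W.D a * snd (inj b) :=
  congrArg up (W.T₁_spec a b)

theorem inj_T₂ (a b : A) : inj (W.T₂ (a ⊗ₜ b)) = fst (inj a) * W.D b :=
  congrArg up (W.T₂_spec a b)

theorem e_mul_e : W.e * W.e = W.e := congrArg up W.E_idem

theorem e_l_e (z : A ⊗[ℂ] A) : W.e.l (W.e.l z) = W.e.l z := by rw [← mul_l, W.e_mul_e]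

theorem e_r_e (z : A ⊗[ℂ] A) : W.e.r (W.e.r z) = W.e.r z := by rw [← mul_r, W.e_mul_e]

theorem exists_T₁ (z : A ⊗[ℂ] A) : ∃ w, W.T₁ w = W.e.l z := by
  have h : W.e.l z ∈ LinearMap.range W.T₁ := by rw [W.range_T₁]; exact ⟨z, rfl⟩
  exact h

theorem exists_T₂ (z : A ⊗[ℂ] A) : ∃ w, W.T₂ w = W.e.r z := by
  have h : W.e.r z ∈ LinearMap.range W.T₂ := by rw [W.range_T₂]; exact ⟨z, rfl⟩
  exact h

theorem e_T₁ (w : A ⊗[ℂ] A) : W.e.l (W.T₁ w) = W.T₁ w := by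
  have h : W.T₁ w ∈ LinearMap.range W.E.l := by rw [← W.range_T₁]; exact ⟨w, rfl⟩
  obtain ⟨z, hz⟩ := h
  have hz' : W.e.l z = W.T₁ w := hz
  rw [← hz', W.e_l_e]

theorem e_T₂ (w : A ⊗[ℂ] A) : W.e.r (W.T₂ w) = W.T₂ w := by
  have h : W.T₂ w ∈ LinearMap.range W.E.r := by rw [← W.range_T₂]; exact ⟨w, rfl⟩
  obtain ⟨z, hz⟩ := h
  have hz' : W.e.r z = W.T₂ w := hz
  rw [← hz', W.e_r_e]

theorem mul_induction (W : WeakMultiplierHopfAlgebra A) {P : A → Prop} (h0 : P 0) (hadd : ∀ a b, P a → P b → P (a + b))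
    (hmul : ∀ a b, P (a * b)) (a : A) : P a := by
  have ha : a ∈ Submodule.span ℂ {x : A | ∃ a b, x = a * b} := by
    rw [W.idempotent]; exact Submodule.mem_top
  -- `P` is not assumed stable under scalars, so the induction carries all multiples of `a`; a
  -- scalar is absorbed into one factor of a product.
  have : ∀ c : ℂ, P (c • a) := by
    induction ha using Submodule.span_induction with
    | mem x hx =>
      obtain ⟨a, b, rfl⟩ := hx
      intro c
      rw [← smul_mul_assoc]
      exact hmul _ _
    | zero => intro c; rwa [smul_zero]
    | add x y _ _ hx hy => intro c; rw [smul_add]; exact hadd _ _ (hx c) (hy c)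
    | smul k x _ hx => intro c; rw [smul_smul]; exact hx _
  simpa using this 1

/-- The left leg of the coproduct is all of `A`. -/
theorem full_ext {V : Type*} [AddCommGroup V] [Module ℂ V] {f g : A →ₗ[ℂ] V}
    (h : ∀ a c, f.rTensor A (W.T₁ (a ⊗ₜ c)) = g.rTensor A (W.T₁ (a ⊗ₜ c))) : f = g := by
  have hk : LinearMap.ker (f - g) = ⊤ := W.full_left _ fun a b => by
    -- Flatness identifies the kernel of (f - g) ⊗ id with ker(f - g) ⊗ A, so every T₁(a ⊗ b) has
    -- its first leg in ker(f - g).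
    have hx := Module.Flat.rTensor_exact A (LinearMap.exact_subtype_ker_map (f - g))
    rw [← LinearMap.exact_iff.1 hx, LinearMap.mem_ker, LinearMap.rTensor_sub, LinearMap.sub_apply,
      h, sub_self]
  rw [← sub_eq_zero]
  exact LinearMap.ker_eq_top.1 hk

variable [NonDeg A]

theorem e_mul_D (a : A) : W.e * W.D a = W.D a :=
  eq_of_mul_snd_inj fun b => by rw [mul_assoc, ← inj_T₁, mul_inj, e_T₁]

theorem D_mul_e (a : A) : W.D a * W.e = W.D a :=
  eq_of_fst_inj_mul fun b => by rw [← mul_assoc, ← inj_T₂, inj_mul', e_T₂]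

theorem D_l_tmul (a c d : A) :
    (W.D a).l (c ⊗ₜ d) = (LinearMap.mulRight ℂ c).rTensor A (W.T₁ (a ⊗ₜ d)) := by
  apply inj_injective
  rw [← mul_inj, inj_tmul, ← snd_mul_fst, ← mul_assoc, ← inj_T₁, inj_mul']
  rfl

theorem D_l_T₁ (a c d : A) : (W.D a).l (W.T₁ (c ⊗ₜ d)) = W.T₁ ((a * c) ⊗ₜ d) := by
  apply inj_injective
  rw [← mul_inj, inj_T₁, inj_T₁, D_mul, mul_assoc]

theorem D_l_e (a : A) (z : A ⊗[ℂ] A) : (W.D a).l (W.e.l z) = (W.D a).l z := by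
  rw [← mul_l, D_mul_e]

/-- The elements Δ(b)(1 ⊗ c) span E(A ⊗ A), not A ⊗ A; hence testing against Δ determines a
multiplier only up to the factor E. -/
theorem eq_of_mul_D {X Y : Multiplier (A ⊗[ℂ] A)} (h : ∀ b, X * W.D b = Y * W.D b) :
    X * W.e = Y * W.e :=
  ext_l fun z => by
    obtain ⟨w, hw⟩ := W.exists_T₁ z
    rw [mul_l, mul_l, ← hw]
    clear hw
    induction w with
    | zero => simp only [map_zero]
    | add x y hx hy => simp only [map_add, hx, hy]
    | tmul a b =>
      apply inj_injective
      rw [← mul_inj, ← mul_inj, inj_T₁, ← mul_assoc, ← mul_assoc, h]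

theorem eq_of_D_mul {X Y : Multiplier (A ⊗[ℂ] A)} (h : ∀ b, W.D b * X = W.D b * Y) :
    W.e * X = W.e * Y :=
  ext_r fun z => by
    obtain ⟨w, hw⟩ := W.exists_T₂ z
    rw [mul_r, mul_r, ← hw]
    clear hw
    induction w with
    | zero => simp only [map_zero]
    | add x y hx hy => simp only [map_add, hx, hy]
    | tmul a b =>
      apply inj_injective
      rw [← inj_mul', ← inj_mul', inj_T₂, mul_assoc, mul_assoc, h]

/-! ### Coassociativity -/

/-- `Δ ⊗ id`. -/
def dT (p : A ⊗[ℂ] A) : Multiplier (A ⊗[ℂ] (A ⊗[ℂ] A)) := cT W.comul p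

/-- `id ⊗ Δ`. -/
def idD (p : A ⊗[ℂ] A) : Multiplier (A ⊗[ℂ] (A ⊗[ℂ] A)) := iT W.comul p

theorem dT_add (p q : A ⊗[ℂ] A) : W.dT (p + q) = W.dT p + W.dT q := cT_add _ _ _
@[simp] theorem dT_zero : W.dT 0 = 0 := cT_zero _
theorem idD_add (p q : A ⊗[ℂ] A) : W.idD (p + q) = W.idD p + W.idD q := iT_add _ _ _
@[simp] theorem idD_zero : W.idD 0 = 0 := iT_zero _

theorem dT_tmul (a b : A) : W.dT (a ⊗ₜ b) = l12 (W.D a) * third (inj b) := cT_tmul _ _ _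

theorem idD_tmul (a b : A) : W.idD (a ⊗ₜ b) = fst (inj a) * l23 (W.D b) := iT_tmul _ _ _

theorem dT_mul (p q : A ⊗[ℂ] A) : W.dT p * W.dT q = W.dT (p * q) := by
  induction p with
  | zero => rw [dT_zero, zero_mul, zero_mul, dT_zero]
  | add x y hx hy => rw [add_mul, dT_add, dT_add, add_mul, hx, hy]
  | tmul a b =>
    induction q with
    | zero => rw [dT_zero, mul_zero, mul_zero, dT_zero]
    | add x y hx hy => rw [mul_add, dT_add, dT_add, mul_add, hx, hy]
    | tmul c d =>
      rw [Algebra.TensorProduct.tmul_mul_tmul, dT_tmul, dT_tmul, dT_tmul, D_mul, l12_mul, inj_mul,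
        third, third, third, snd_mul, snd_mul]
      simp only [mul_assoc]
      rw [← mul_assoc _ (l12 (W.D c)), ← third, ← l12_third]
      simp only [mul_assoc]

theorem fst_mul_dT (c : A) (p : A ⊗[ℂ] A) : fst (inj c) * W.dT p =
    inj (TensorProduct.assoc ℂ A A A ((W.t₂ c).rTensor A p)) := by
  induction p with
  | zero => rw [dT_zero, mul_zero, map_zero, map_zero, inj_zero]
  | add x y hx hy => rw [dT_add, mul_add, map_add, map_add, inj_add, hx, hy]
  | tmul a b =>
    rw [dT_tmul, ← l12_fst, ← mul_assoc, ← l12_mul, ← inj_T₂, l12, ← reassoc_snd, ← reassoc_mul,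
      fst_mul_snd, ← inj_tmul, reassoc_inj]
    rfl

theorem idD_mul_third (b : A) (p : A ⊗[ℂ] A) : W.idD p * third (inj b) =
    inj ((W.t₁ b).lTensor A p) := by
  induction p with
  | zero => rw [idD_zero, zero_mul, map_zero, inj_zero]
  | add x y hx hy => rw [idD_add, add_mul, map_add, inj_add, hx, hy]
  | tmul a x =>
    rw [idD_tmul, third, l23, mul_assoc, ← snd_mul, ← inj_T₁, fst_mul_snd, ← inj_tmul]
    rfl

theorem dT_T₁ (a b c : A) : fst (inj c) * W.dT (W.T₁ (a ⊗ₜ b)) =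
    W.idD (W.T₂ (c ⊗ₜ a)) * third (inj b) := congrArg up (W.coassoc a b c)

/-- Coassociativity as an equality of elements of A ⊗ A ⊗ A, with the outer legs covered by `c` and
`b`. -/
theorem assoc_t₂_T₁ (a b c : A) : TensorProduct.assoc ℂ A A A
    ((W.t₂ c).rTensor A (W.T₁ (a ⊗ₜ b))) = (W.t₁ b).lTensor A (W.T₂ (c ⊗ₜ a)) := by
  apply inj_injective
  rw [← fst_mul_dT, ← idD_mul_third, dT_T₁]

theorem l12_mul_dT (p : A ⊗[ℂ] A) : l12 W.e * W.dT p = W.dT p := by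
  induction p with
  | zero => rw [dT_zero, mul_zero]
  | add x y hx hy => rw [dT_add, mul_add, hx, hy]
  | tmul a b => rw [dT_tmul, ← mul_assoc, ← l12_mul, e_mul_D]

theorem dT_mul_l12 (p : A ⊗[ℂ] A) : W.dT p * l12 W.e = W.dT p := by
  induction p with
  | zero => rw [dT_zero, zero_mul]
  | add x y hx hy => rw [dT_add, add_mul, hx, hy]
  | tmul a b => rw [dT_tmul, mul_assoc, ← l12_third, ← mul_assoc, ← l12_mul, D_mul_e]

theorem l23_mul_idD (p : A ⊗[ℂ] A) : l23 W.e * W.idD p = W.idD p := by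
  induction p with
  | zero => rw [idD_zero, mul_zero]
  | add x y hx hy => rw [idD_add, mul_add, hx, hy]
  | tmul a b => rw [idD_tmul, ← mul_assoc, ← fst_l23, mul_assoc, ← l23_mul, e_mul_D]

theorem idD_mul_l23 (p : A ⊗[ℂ] A) : W.idD p * l23 W.e = W.idD p := by
  induction p with
  | zero => rw [idD_zero, zero_mul]
  | add x y hx hy => rw [idD_add, add_mul, hx, hy]
  | tmul a b => rw [idD_tmul, mul_assoc, ← l23_mul, D_mul_e]

theorem l12_l23_comm : l12 W.e * l23 W.e = l23 W.e * l12 W.e := congrArg up W.E_comm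

theorem mul_idD (p : A ⊗[ℂ] A) : l12 W.e * l23 W.e * W.idD p = W.idD (W.e.l p) :=
  congrArg up (W.comul_E.1 p)

theorem l12_mul_idD (p : A ⊗[ℂ] A) : l12 W.e * W.idD p = W.idD (W.e.l p) := by
  rw [← W.mul_idD, mul_assoc, l23_mul_idD]

theorem idD_mul (p : A ⊗[ℂ] A) : W.idD p * (l12 W.e * l23 W.e) = W.idD (W.e.r p) :=
  congrArg up (W.comul_E.2.1 p)

theorem idD_mul_l12 (p : A ⊗[ℂ] A) : W.idD p * l12 W.e = W.idD (W.e.r p) := by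
  rw [← W.idD_mul, l12_l23_comm, ← mul_assoc, idD_mul_l23]

theorem t₁_e_r (c : A) (p : A ⊗[ℂ] A) :
    (W.t₁ c).lTensor A (W.e.r p) = (l12 W.e).r ((W.t₁ c).lTensor A p) := by
  apply inj_injective
  rw [← idD_mul_third, ← idD_mul_l12, mul_assoc, l12_third, ← mul_assoc, idD_mul_third, inj_mul']

/-- Coassociativity trades (id ⊗ Δ)Δ(a) for (Δ ⊗ id)Δ(a), which then multiplies into (Δ ⊗ id)(p).
The axiom needs a cover of the last leg, obtained by factoring the second leg of `p` as a product `b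
* y`. -/
theorem idD_mul_dT (c a : A) (p : A ⊗[ℂ] A) :
    W.idD (W.T₂ (c ⊗ₜ a)) * W.dT p = fst (inj c) * W.dT ((W.D a).l p) := by
  induction p with
  | zero => rw [dT_zero, map_zero, dT_zero, mul_zero, mul_zero]
  | add x y hx hy => rw [dT_add, map_add, dT_add, mul_add, mul_add, hx, hy]
  | tmul x y =>
    induction y using W.mul_induction with
    | h0 => rw [TensorProduct.tmul_zero, dT_zero, map_zero, dT_zero, mul_zero, mul_zero]
    | hadd y y' hy hy' =>
      rw [TensorProduct.tmul_add, dT_add, map_add, dT_add, mul_add, mul_add, hy, hy']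
    | hmul b y =>
      have h1 : W.dT (x ⊗ₜ (b * y)) = third (inj b) * W.dT (x ⊗ₜ y) := by
        rw [dT_tmul, dT_tmul, inj_mul, third, snd_mul, snd_mul, ← third, ← third, ← mul_assoc,
          ← mul_assoc, l12_third]
      have h2 : W.T₁ (a ⊗ₜ b) * (x ⊗ₜ y) = (W.D a).l (x ⊗ₜ (b * y)) := by
        apply inj_injective
        rw [inj_mul, inj_T₁, ← mul_inj, mul_assoc, mul_inj]
        rfl
      rw [h1, ← mul_assoc, ← dT_T₁, mul_assoc, dT_mul, h2]

theorem eq_of_idD_mul {X Y : Multiplier (A ⊗[ℂ] (A ⊗[ℂ] A))}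
    (h : ∀ w z, W.idD (w ⊗ₜ z) * X = W.idD (w ⊗ₜ z) * Y) : l23 W.e * X = l23 W.e * Y := by
  have h1 : ∀ z, l23 (W.D z) * X = l23 (W.D z) * Y := fun z => eq_of_fst_inj_mul fun w => by
    rw [← mul_assoc, ← mul_assoc, ← idD_tmul, h]
  have h2 : ∀ v, l23 (inj (W.T₂ v)) * X = l23 (inj (W.T₂ v)) * Y := by
    intro v
    induction v with
    | zero => rw [map_zero, inj_zero, l23_zero, zero_mul, zero_mul]
    | add x y hx hy => rw [map_add, inj_add, l23_add, add_mul, add_mul, hx, hy]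
    | tmul y z => rw [inj_T₂, l23_mul, mul_assoc, mul_assoc, h1]
  refine eq_of_snd_inj_mul fun u => ?_
  obtain ⟨v, hv⟩ := W.exists_T₂ u
  rw [← mul_assoc, ← mul_assoc, l23, ← snd_mul, inj_mul', ← hv]
  exact h2 v

theorem l23_mul_dT_T₁ (w : A ⊗[ℂ] A) : l23 W.e * W.dT (W.T₁ w) = W.dT (W.T₁ w) := by
  induction w with
  | zero => rw [map_zero, dT_zero, mul_zero]
  | add x y hx hy => rw [map_add, dT_add, mul_add, hx, hy]
  | tmul a b =>
    refine eq_of_fst_inj_mul fun c => ?_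
    rw [← mul_assoc, fst_l23, mul_assoc, dT_T₁, ← mul_assoc, l23_mul_idD]

/-- `(Δ ⊗ id)(E p) = (1 ⊗ E)(Δ ⊗ id)(p)`. -/
theorem dT_e (p : A ⊗[ℂ] A) : W.dT (W.e.l p) = l23 W.e * W.dT p := by
  obtain ⟨w, hw⟩ := W.exists_T₁ p
  have h1 : l23 W.e * W.dT (W.e.l p) = W.dT (W.e.l p) := by rw [← hw, l23_mul_dT_T₁]
  rw [← h1]
  -- Tested against (id ⊗ Δ)(w ⊗ z), the factor E¹² of Δ ⊗ id can be moved to the left, where it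
  -- replaces w ⊗ z by (w ⊗ z)E. The latter is a sum of elements (c ⊗ 1)Δ(a), and Δ(a)E = Δ(a)
  -- absorbs the E in front of `p`.
  refine W.eq_of_idD_mul fun w z => ?_
  rw [← l12_mul_dT, ← W.l12_mul_dT p, ← mul_assoc, ← mul_assoc, idD_mul_l12]
  obtain ⟨q, hq⟩ := W.exists_T₂ (w ⊗ₜ z)
  rw [← hq]
  clear hq
  induction q with
  | zero => rw [map_zero, idD_zero, zero_mul, zero_mul]
  | add x y hx hy => rw [map_add, idD_add, add_mul, add_mul, hx, hy]
  | tmul c a => rw [idD_mul_dT, idD_mul_dT, D_l_e]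

end WeakMultiplierHopfAlgebra

end WMHA

/-! ### Source elements and the construction of S(a)b. -/

namespace WMHA

open Multiplier

namespace Multiplier

variable {A : Type*} [NonUnitalRing A] [Module ℂ A] [IsScalarTower ℂ A A] [SMulCommClass ℂ A A]

theorem l12_add (X Y : Multiplier (A ⊗[ℂ] A)) : l12 (X + Y) = l12 X + l12 Y := by
  have h : (fst (X + Y) : Multiplier ((A ⊗[ℂ] A) ⊗[ℂ] A)) = fst X + fst Y :=
    Multiplier.ext (LinearMap.rTensor_add _ _ _) (LinearMap.rTensor_add _ _ _)
  rw [l12, h]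
  exact Multiplier.ext (LinearMap.ext fun t => map_add (TensorProduct.assoc ℂ A A A) _ _)
    (LinearMap.ext fun t => map_add (TensorProduct.assoc ℂ A A A) _ _)

theorem l13_add (X Y : Multiplier (A ⊗[ℂ] A)) : l13 (X + Y) = l13 X + l13 Y := by
  rw [l13, l12_add]
  exact Multiplier.ext
    (LinearMap.ext fun t => map_add ((TensorProduct.comm ℂ A A).lTensor A) _ _)
    (LinearMap.ext fun t => map_add ((TensorProduct.comm ℂ A A).lTensor A) _ _)

theorem l13_zero : l13 (0 : Multiplier (A ⊗[ℂ] A)) = 0 := by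
  have h := l13_add (0 : Multiplier (A ⊗[ℂ] A)) 0
  rw [add_zero] at h
  exact left_eq_add.1 h

theorem l13_inj_mul_second (z : A ⊗[ℂ] A) (b : A) :
    l13 (inj z) * second (inj b) = inj (TensorProduct.leftComm ℂ A A A (b ⊗ₜ z)) := by
  induction z with
  | zero => rw [inj_zero, l13_zero, zero_mul, TensorProduct.tmul_zero, map_zero, inj_zero]
  | add x y hx hy =>
    rw [inj_add, l13_add, add_mul, hx, hy, TensorProduct.tmul_add, map_add, inj_add]
  | tmul x y =>
    rw [inj_tmul, l13_tens, second, ← fst_mul_snd, mul_assoc, ← snd_mul, snd_mul_fst, ← inj_tmul,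
      fst_mul_snd, ← inj_tmul]
    rfl

theorem third_l (y : Multiplier A) (z : A ⊗[ℂ] A) (c : A) :
    (third y).l (TensorProduct.assoc ℂ A A A (z ⊗ₜ c)) =
      TensorProduct.assoc ℂ A A A (z ⊗ₜ y.l c) := by
  induction z with
  | zero => simp only [TensorProduct.zero_tmul, map_zero]
  | add z z' hz hz' => simp only [TensorProduct.add_tmul, map_add, hz, hz']
  | tmul a b => rfl

end Multiplier

/-- `F(· ⊗ b) ⊗ id`, seen through the permutation of the legs. -/
theorem rTensor_flip_mk {A V : Type*} [AddCommGroup A] [Module ℂ A] [AddCommGroup V] [Module ℂ V]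
    (F : A ⊗[ℂ] A →ₗ[ℂ] V) (b : A) (w : A ⊗[ℂ] A) :
    (F ∘ₗ (TensorProduct.mk ℂ A A).flip b).rTensor A w =
      F.rTensor A ((TensorProduct.assoc ℂ A A A).symm
        (TensorProduct.leftComm ℂ A A A (b ⊗ₜ w))) := by
  induction w with
  | zero => simp only [TensorProduct.tmul_zero, map_zero]
  | add x y hx hy => simp only [TensorProduct.tmul_add, map_add, hx, hy]
  | tmul x y => rfl

namespace WeakMultiplierHopfAlgebra

variable {A : Type*} [NonUnitalRing A] [Module ℂ A] [IsScalarTower ℂ A A] [SMulCommClass ℂ A A]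
  (W : WeakMultiplierHopfAlgebra A)

theorem full_ext_mul {V : Type*} [AddCommGroup V] [Module ℂ V] {f g : A →ₗ[ℂ] V}
    (h : ∀ a c d, f.rTensor A (W.T₁ (a ⊗ₜ (c * d))) = g.rTensor A (W.T₁ (a ⊗ₜ (c * d)))) :
    f = g :=
  W.full_ext fun a c => by
    induction c using W.mul_induction with
    | h0 => simp only [TensorProduct.tmul_zero, map_zero]
    | hadd x y hx hy => simp only [TensorProduct.tmul_add, map_add, hx, hy]
    | hmul c d => exact h a c d

theorem counit_T₁ (a b : A) :
    TensorProduct.lid ℂ A (W.counit.rTensor A (W.T₁ (a ⊗ₜ b))) = a * b := W.counit_left a b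

/-- `b ⊗ c ↦ Δ₁₃(a)(1 ⊗ b ⊗ c)`. -/
def ins (a : A) : A ⊗[ℂ] A →ₗ[ℂ] A ⊗[ℂ] (A ⊗[ℂ] A) :=
  (TensorProduct.leftComm ℂ A A A).toLinearMap ∘ₗ (W.T₁ ∘ₗ TensorProduct.mk ℂ A A a).lTensor A

theorem ins_tmul (a b c : A) : W.ins a (b ⊗ₜ c) =
    TensorProduct.leftComm ℂ A A A (b ⊗ₜ W.T₁ (a ⊗ₜ c)) := rfl

/-- The map `G₁`. -/
def G : A ⊗[ℂ] A →ₗ[ℂ] A ⊗[ℂ] A := W.ker_T₁.choose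

theorem ker_T₁_eq : LinearMap.ker W.T₁ = LinearMap.range (LinearMap.id - W.G) :=
  W.ker_T₁.choose_spec.2

/-- The left action of the source element `ε_s(a)`, as a map of both arguments. -/
def es : A ⊗[ℂ] A →ₗ[ℂ] A := (TensorProduct.lid ℂ A).toLinearMap ∘ₗ W.counit.rTensor A ∘ₗ W.G

/-- The right action of the source element `ε_s(a)`, as a map of both arguments. -/
def er : A ⊗[ℂ] A →ₗ[ℂ] A :=
  (TensorProduct.rid ℂ A).toLinearMap ∘ₗ W.counit.lTensor A ∘ₗ W.e.r

theorem er_tmul (d a : A) : W.er (d ⊗ₜ a) =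
    TensorProduct.rid ℂ A (W.counit.lTensor A (W.e.r (d ⊗ₜ a))) := rfl

theorem counit_ins (a : A) (z : A ⊗[ℂ] A) :
    ((TensorProduct.lid ℂ A).toLinearMap ∘ₗ W.counit.rTensor A).rTensor A
      ((TensorProduct.assoc ℂ A A A).symm (W.ins a z)) = (LinearMap.mulLeft ℂ a).lTensor A z := by
  induction z with
  | zero => simp only [map_zero]
  | add x y hx hy => simp only [map_add, hx, hy]
  | tmul y d =>
    rw [ins_tmul, LinearMap.lTensor_tmul, LinearMap.mulLeft_apply, ← W.counit_T₁]
    generalize W.T₁ (a ⊗ₜ[ℂ] d) = w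
    induction w with
    | zero => simp only [TensorProduct.tmul_zero, map_zero]
    | add x y hx hy => simp only [TensorProduct.tmul_add, map_add, hx, hy]
    | tmul x z =>
      change (W.counit x • y) ⊗ₜ[ℂ] z = y ⊗ₜ[ℂ] (W.counit x • z)
      rw [TensorProduct.smul_tmul]

variable [NonDeg A]

theorem l13_D_mul (a : A) (z : A ⊗[ℂ] A) : l13 (W.D a) * l23 (inj z) = inj (W.ins a z) := by
  induction z with
  | zero => rw [inj_zero, l23_zero, mul_zero, map_zero, inj_zero]
  | add x y hx hy => rw [inj_add, l23_add, mul_add, hx, hy, map_add, inj_add]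
  | tmul b c =>
    rw [ins_tmul, ← l13_inj_mul_second, inj_T₁, l13_mul, l13_snd, mul_assoc, third, second,
      ← snd_mul, snd_mul_fst, ← inj_tmul]
    rfl

theorem G_ins (a : A) (z : A ⊗[ℂ] A) :
    W.G.rTensor A ((TensorProduct.assoc ℂ A A A).symm (W.ins a z)) =
      (TensorProduct.assoc ℂ A A A).symm (W.ins a (W.e.l z)) := by
  induction z with
  | zero => simp only [map_zero]
  | add x y hx hy => simp only [map_add, hx, hy]
  | tmul b c =>
    rw [LinearEquiv.eq_symm_apply]
    apply inj_injective
    have h := W.ker_T₁.choose_spec.1 a b c (W.ins a (b ⊗ₜ c))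
      (up_injective (W.l13_D_mul a (b ⊗ₜ c)).symm)
    refine (congrArg up h).trans ?_
    rw [← l13_D_mul, ← mul_inj, l23_mul, ← mul_assoc]
    rfl

/-- On elements Δ₁₃(a)(1 ⊗ b ⊗ c) the map G₁ amounts to inserting E in the last two legs, so
idempotency is inherited from E; fullness removes `a`. -/
theorem G_G (z : A ⊗[ℂ] A) : W.G (W.G z) = W.G z := by
  induction z with
  | zero => simp only [map_zero]
  | add x y hx hy => simp only [map_add, hx, hy]
  | tmul x b =>
    have h : (W.G ∘ₗ W.G) ∘ₗ (TensorProduct.mk ℂ A A).flip b =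
        W.G ∘ₗ (TensorProduct.mk ℂ A A).flip b := W.full_ext fun a c => by
      rw [rTensor_flip_mk, rTensor_flip_mk, ← ins_tmul, LinearMap.rTensor_comp,
        LinearMap.comp_apply, G_ins, G_ins, e_l_e]
    exact LinearMap.congr_fun h x

/-- Applying the counit to the first leg of the identity that defines G₁ gives ∑ ε_s(a₁) ⊗ a₂ = (1 ⊗
a)E, here covered on the right by b ⊗ c. -/
theorem es_T₁ (a b c : A) : (W.es ∘ₗ (TensorProduct.mk ℂ A A).flip b).rTensor A (W.T₁ (a ⊗ₜ c)) =
    (LinearMap.mulLeft ℂ a).lTensor A (W.e.l (b ⊗ₜ c)) := by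
  rw [rTensor_flip_mk, ← ins_tmul, es, ← LinearMap.comp_assoc, LinearMap.rTensor_comp,
    LinearMap.comp_apply, G_ins, counit_ins]

theorem rTensor_er (d : A) (w : A ⊗[ℂ] A) : (W.er ∘ₗ TensorProduct.mk ℂ A A d).rTensor A w =
    ((TensorProduct.lid ℂ A).toLinearMap ∘ₗ W.counit.rTensor A).lTensor A
      ((l12 W.e).r (d ⊗ₜ w)) := by
  induction w with
  | zero => simp only [TensorProduct.tmul_zero, map_zero]
  | add x y hx hy => simp only [TensorProduct.tmul_add, map_add, hx, hy]
  | tmul x y =>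
    have := l12_r_tmul W.e (d ⊗ₜ x) y
    rw [TensorProduct.assoc_tmul] at this
    rw [this, LinearMap.rTensor_tmul, LinearMap.comp_apply, TensorProduct.mk_apply, er_tmul]
    generalize W.e.r (d ⊗ₜ[ℂ] x) = z
    induction z with
    | zero => simp only [TensorProduct.zero_tmul, map_zero]
    | add x y hx hy => simp only [TensorProduct.add_tmul, map_add, hx, hy]
    | tmul p q =>
      change (W.counit q • p) ⊗ₜ[ℂ] y = p ⊗ₜ[ℂ] (W.counit q • y)
      rw [TensorProduct.smul_tmul]

/-- The counit on the middle leg of (id ⊗ Δ)(pE) = (id ⊗ Δ)(p)E¹² gives again ∑ ε_s(a₁) ⊗ a₂ = (1 ⊗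
a)E, now covered by `d` on the left and `c` on the right. -/
theorem er_T₁ (a c d : A) : (W.er ∘ₗ TensorProduct.mk ℂ A A d).rTensor A (W.T₁ (a ⊗ₜ c)) =
    (LinearMap.mulRight ℂ c).lTensor A (W.e.r (d ⊗ₜ a)) := by
  let ε₁ : A ⊗[ℂ] A →ₗ[ℂ] A := (TensorProduct.lid ℂ A).toLinearMap ∘ₗ W.counit.rTensor A
  have h2 : ε₁ ∘ₗ W.t₁ c = LinearMap.mulRight ℂ c := LinearMap.ext fun x => W.counit_T₁ x c
  have h3 := W.t₁_e_r c (d ⊗ₜ a)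
  rw [LinearMap.lTensor_tmul, t₁_apply] at h3
  rw [rTensor_er, ← h3, ← h2]
  exact (LinearMap.lTensor_comp_apply A ε₁ (W.t₁ c) _).symm

/-- By `es_T₁` and `er_T₁` this is, up to fullness, the compatibility of the two actions of the
multiplier E. It is what makes ε_s(a) a multiplier. -/
theorem er_mul (d a b : A) : W.er (d ⊗ₜ a) * b = d * W.es (a ⊗ₜ b) := by
  have h : LinearMap.mulRight ℂ b ∘ₗ W.er ∘ₗ TensorProduct.mk ℂ A A d =
      LinearMap.mulLeft ℂ d ∘ₗ W.es ∘ₗ (TensorProduct.mk ℂ A A).flip b := W.full_ext fun a c => by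
    rw [LinearMap.rTensor_comp, LinearMap.comp_apply, er_T₁, LinearMap.rTensor_comp,
      LinearMap.comp_apply, es_T₁]
    have h := W.e.compat (d ⊗ₜ a) (b ⊗ₜ c)
    rw [mul_tmul, tmul_mul] at h
    rw [← LinearMap.comp_apply, LinearMap.rTensor_comp_lTensor, h,
      ← LinearMap.comp_apply (LinearMap.rTensor _ _), LinearMap.rTensor_comp_lTensor]
  exact LinearMap.congr_fun h a

/-- The source element `ε_s(a)`, a multiplier of `A`. -/
def src (a : A) : Multiplier A :=
  of (W.es ∘ₗ TensorProduct.mk ℂ A A a) (W.er ∘ₗ (TensorProduct.mk ℂ A A).flip a)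
    fun d b => W.er_mul d a b

theorem src_l (a b : A) : (W.src a).l b = W.es (a ⊗ₜ b) := rfl

theorem src_r (a d : A) : (W.src a).r d = W.er (d ⊗ₜ a) := rfl

/-- `x ↦ (1 ⊗ ε_s(x)) z`. -/
def sndSrc (z : A ⊗[ℂ] A) : A →ₗ[ℂ] A ⊗[ℂ] A :=
  (LinearMap.lTensorHom A).flip z ∘ₗ TensorProduct.curry W.es

theorem sndSrc_apply (z : A ⊗[ℂ] A) (x : A) : W.sndSrc z x = (snd (W.src x)).l z := rfl

theorem sndSrc_T₁ (z : A ⊗[ℂ] A) (a c : A) :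
    TensorProduct.assoc ℂ A A A ((W.sndSrc z).rTensor A (W.T₁ (a ⊗ₜ c))) =
      (third (inj a)).l ((l23 W.e).l (TensorProduct.assoc ℂ A A A (z ⊗ₜ c))) := by
  induction z with
  | zero =>
    have h : W.sndSrc 0 = 0 := LinearMap.ext fun x => by rw [sndSrc_apply, map_zero]; rfl
    rw [h, LinearMap.rTensor_zero, TensorProduct.zero_tmul]; simp only [map_zero]; rfl
  | add x y hx hy =>
    have h : W.sndSrc (x + y) = W.sndSrc x + W.sndSrc y :=
      LinearMap.ext fun t => by rw [sndSrc_apply, map_add]; rfl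
    rw [h, LinearMap.rTensor_add, TensorProduct.add_tmul]
    simp only [map_add, LinearMap.add_apply, hx, hy]
  | tmul b' b =>
    have h : W.sndSrc (b' ⊗ₜ b) = TensorProduct.mk ℂ A A b' ∘ₗ
      W.es ∘ₗ (TensorProduct.mk ℂ A A).flip b := rfl
    rw [h, LinearMap.rTensor_comp, LinearMap.comp_apply, es_T₁, TensorProduct.assoc_tmul, l23,
      snd_l_tmul, third, snd_l_tmul, snd_l, inj]
    generalize (LinearMap.mulLeft ℂ a).lTensor A (W.e.l (b ⊗ₜ[ℂ] c)) = y
    induction y with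
    | zero => simp only [TensorProduct.tmul_zero, map_zero]
    | add x y hx hy => simp only [TensorProduct.tmul_add, map_add, hx, hy]
    | tmul x y => rfl

/-- The elements ε_s(a) are slices of E, so the claim is a slice of the commutation of E¹² with E²³.
-/
theorem e_mul_snd_src (a : A) : W.e * snd (W.src a) = snd (W.src a) * W.e := ext_l fun z => by
  have h : W.e.l ∘ₗ W.sndSrc z = W.sndSrc (W.e.l z) := W.full_ext fun a c => by
    apply (TensorProduct.assoc ℂ A A A).injective
    rw [LinearMap.rTensor_comp, LinearMap.comp_apply, ← l12_l, sndSrc_T₁, sndSrc_T₁, ← l12_l_tmul]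
    simp only [← mul_l]
    rw [← l12_l23_comm, ← mul_assoc, ← mul_assoc, l12_third]
  exact LinearMap.congr_fun h a

/-- `y ↦ Δ(y) z`. -/
def Dl (z : A ⊗[ℂ] A) : A →ₗ[ℂ] A ⊗[ℂ] A where
  toFun y := (W.D y).l z
  map_add' x y := by rw [D_add]; rfl
  map_smul' c x := by rw [D, map_smul]; rfl

theorem Dl_apply (z : A ⊗[ℂ] A) (y : A) : W.Dl z y = (W.D y).l z := rfl

theorem dT_l (p z : A ⊗[ℂ] A) (d : A) : (W.dT p).l (TensorProduct.assoc ℂ A A A (z ⊗ₜ d)) =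
    TensorProduct.assoc ℂ A A A ((W.Dl z).rTensor A ((snd (inj d)).r p)) := by
  induction p with
  | zero => rw [dT_zero]; simp only [map_zero]; rfl
  | add x y hx hy => rw [dT_add]; simp only [map_add, ← hx, ← hy]; rfl
  | tmul x y => rw [dT_tmul, mul_l, third_l, l12_l_tmul]; rfl

theorem dT_snd_l (a : A) (p : A ⊗[ℂ] A) :
    W.dT ((snd (inj a)).l p) = third (inj a) * W.dT p := by
  induction p with
  | zero => rw [map_zero, dT_zero, mul_zero]
  | add x y hx hy => rw [map_add, dT_add, dT_add, mul_add, hx, hy]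
  | tmul x y =>
    rw [snd_l_tmul, dT_tmul, dT_tmul, ← mul_assoc, ← l12_third, mul_assoc, third, third, third,
      ← snd_mul, ← snd_mul, inj_l, inj_mul]

/-- Apply Δ ⊗ id to ∑ ε_s(a₁) ⊗ a₂ = (1 ⊗ a)E: by `dT_e` the idempotent becomes E²³, and `sndSrc_T₁`
recognises ∑ 1 ⊗ ε_s(a₁) ⊗ a₂ in the result. -/
theorem D_src_l (a b : A) : W.D ((W.src a).l b) = snd (W.src a) * W.D b := ext_l fun z => by
  have h : W.Dl z ∘ₗ W.es ∘ₗ (TensorProduct.mk ℂ A A).flip b = W.sndSrc ((W.D b).l z) :=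
    W.full_ext_mul fun a c d => by
      apply (TensorProduct.assoc ℂ A A A).injective
      have h1 : W.e.l (b ⊗ₜ (c * d)) = (snd (inj d)).r (W.e.l (b ⊗ₜ c)) := by
        rw [← l_r]; rfl
      have h2 : (LinearMap.mulLeft ℂ a).lTensor A (W.e.l (b ⊗ₜ (c * d))) =
          (snd (inj d)).r ((snd (inj a)).l (W.e.l (b ⊗ₜ c))) := by
        rw [← l_r, ← h1]; rfl
      rw [LinearMap.rTensor_comp, LinearMap.comp_apply, es_T₁, sndSrc_T₁, h2, ← dT_l, dT_snd_l,
        dT_e, mul_l, mul_l, dT_tmul, mul_l, third_l, l12_l_tmul]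
      rfl
  exact LinearMap.congr_fun h a

theorem D_src_r (a d : A) : W.D ((W.src a).r d) = W.D d * snd (W.src a) := by
  have h := W.eq_of_mul_D (X := W.D ((W.src a).r d)) (Y := W.D d * snd (W.src a)) fun b => by
    rw [mul_assoc, ← D_src_l, ← D_mul, ← D_mul, (W.src a).compat]
  rw [D_mul_e, mul_assoc, ← e_mul_snd_src, ← mul_assoc, D_mul_e] at h
  exact h

/-- Fullness reduces this to (ε ⊗ id)(Δ(a)z) = (ε ⊗ id)((1 ⊗ a)Ez), and on Ez, a value of T₁, it is
the counit law. -/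
theorem counit_es (a c : A) : W.counit (W.es (a ⊗ₜ c)) = W.counit (a * c) := by
  have h0 : ∀ (a : A) (z : A ⊗[ℂ] A), W.counit.rTensor A ((W.D a).l z) =
      W.counit.rTensor A ((LinearMap.mulLeft ℂ a).lTensor A (W.e.l z)) := by
    intro a z
    obtain ⟨w, hw⟩ := W.exists_T₁ z
    rw [← D_l_e, ← hw]
    clear hw
    apply (TensorProduct.lid ℂ A).injective
    induction w with
    | zero => simp only [map_zero]
    | add x y hx hy => simp only [map_add, hx, hy]
    | tmul x y =>
      rw [D_l_T₁, counit_T₁, mul_assoc, ← W.counit_T₁ x y]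
      generalize W.T₁ (x ⊗ₜ[ℂ] y) = w
      induction w with
      | zero => simp only [map_zero, mul_zero]
      | add x y hx hy => simp only [map_add, mul_add, hx, hy]
      | tmul x y =>
        change a * (W.counit x • y) = W.counit x • (a * y)
        rw [mul_smul_comm]
  have h : W.counit ∘ₗ W.es ∘ₗ (TensorProduct.mk ℂ A A).flip c =
      W.counit ∘ₗ LinearMap.mulRight ℂ c := W.full_ext fun a d => by
    rw [LinearMap.rTensor_comp, LinearMap.comp_apply, es_T₁, LinearMap.rTensor_comp,
      LinearMap.comp_apply, ← D_l_tmul, h0]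
  exact LinearMap.congr_fun h a

/-- Because dε_s(a) = (id ⊗ ε)((d ⊗ a)E), a left factor of `a` enters only through its effect under
ε, where `counit_es` applies. -/
theorem src_mul (x c : A) : W.src (x * c) = W.src ((W.src x).l c) := ext_r fun d => by
  have h1 : W.e.r (d ⊗ₜ (x * c)) = (snd (inj x)).l (W.e.r (d ⊗ₜ c)) := by rw [l_r]; rfl
  have h2 : W.e.r (d ⊗ₜ (W.src x).l c) = (snd (W.src x)).l (W.e.r (d ⊗ₜ c)) := by
    rw [l_r]; rfl
  rw [src_r, src_r, er_tmul, er_tmul, h1, h2, snd_l, snd_l, ← LinearMap.comp_apply (W.counit.lTensor A),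
    ← LinearMap.lTensor_comp, ← LinearMap.comp_apply (W.counit.lTensor A), ← LinearMap.lTensor_comp]
  congr 3
  exact LinearMap.ext fun c => (W.counit_es x c).symm

theorem es_mul (x c b : A) : W.es ((x * c) ⊗ₜ b) = W.es (W.es (x ⊗ₜ c) ⊗ₜ b) := by
  rw [← src_l, src_mul]; rfl

/-- The kernel of T₁ is the range of 1 - G₁, which the idempotent G₁ kills; `es` factors through G₁.
This makes S well defined. -/
theorem es_eq_of_T₁ {w w' : A ⊗[ℂ] A} (h : W.T₁ w = W.T₁ w') : W.es w = W.es w' := by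
  have h1 : w - w' ∈ LinearMap.range (LinearMap.id - W.G) := by
    rw [← ker_T₁_eq, LinearMap.mem_ker, map_sub, h, sub_self]
  obtain ⟨z, hz⟩ := h1
  rw [← sub_eq_zero, ← map_sub, ← hz, es, LinearMap.comp_apply, LinearMap.comp_apply,
    LinearMap.sub_apply, map_sub, LinearMap.id_apply, G_G, sub_self, map_zero, map_zero]

theorem exists_section (W : WeakMultiplierHopfAlgebra A) :
    ∃ P : A ⊗[ℂ] A →ₗ[ℂ] A ⊗[ℂ] A, ∀ z, W.T₁ (P z) = W.e.l z := by
  obtain ⟨g, hg⟩ := LinearMap.exists_rightInverse_of_surjective W.T₁.rangeRestrict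
    (LinearMap.range_rangeRestrict _)
  refine ⟨g ∘ₗ LinearMap.codRestrict (LinearMap.range W.T₁) W.e.l fun z => W.exists_T₁ z,
    fun z => ?_⟩
  exact congrArg Subtype.val (LinearMap.congr_fun hg ⟨W.e.l z, W.exists_T₁ z⟩)

/-- A section of `T₁`. -/
def P : A ⊗[ℂ] A →ₗ[ℂ] A ⊗[ℂ] A := W.exists_section.choose

theorem T₁_P (z : A ⊗[ℂ] A) : W.T₁ (W.P z) = W.e.l z := W.exists_section.choose_spec z

/-- `a ⊗ b ↦ S(a) b`. -/
def s : A ⊗[ℂ] A →ₗ[ℂ] A := W.es ∘ₗ W.P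

theorem s_eq {w z : A ⊗[ℂ] A} (h : W.T₁ w = W.e.l z) : W.s z = W.es w :=
  W.es_eq_of_T₁ (by rw [T₁_P, h])

theorem s_T₁ (w : A ⊗[ℂ] A) : W.s (W.T₁ w) = W.es w := W.s_eq (W.e_T₁ w).symm

theorem s_e (z : A ⊗[ℂ] A) : W.s (W.e.l z) = W.s z := W.s_eq (by rw [T₁_P, e_l_e])

theorem T₁_snd_r (c : A) (w : A ⊗[ℂ] A) :
    W.T₁ ((snd (inj c)).r w) = (snd (inj c)).r (W.T₁ w) := by
  induction w with
  | zero => simp only [map_zero]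
  | add x y hx hy => simp only [map_add, hx, hy]
  | tmul x y =>
    apply inj_injective
    rw [snd_r_tmul, inj_T₁, inj_r, inj_mul, snd_mul, ← mul_assoc, ← inj_T₁, inj_mul']

theorem T₁_fst_l (a : A) (w : A ⊗[ℂ] A) :
    W.T₁ ((fst (inj a)).l w) = (W.D a).l (W.T₁ w) := by
  induction w with
  | zero => simp only [map_zero]
  | add x y hx hy => simp only [map_add, hx, hy]
  | tmul x y => rw [fst_l_tmul, D_l_T₁]; rfl

theorem es_snd_r (c : A) (w : A ⊗[ℂ] A) : W.es ((snd (inj c)).r w) = W.es w * c := by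
  induction w with
  | zero => simp only [map_zero, zero_mul]
  | add x y hx hy => simp only [map_add, hx, hy, add_mul]
  | tmul x y => rw [snd_r_tmul, ← src_l, inj_r, (W.src x).l_mul]; rfl

theorem s_snd_r (c : A) (z : A ⊗[ℂ] A) : W.s ((snd (inj c)).r z) = W.s z * c := by
  rw [s, LinearMap.comp_apply, LinearMap.comp_apply, ← es_snd_r]
  exact W.es_eq_of_T₁ (by rw [T₁_snd_r, T₁_P, T₁_P, l_r])

/-- In Sweedler form S(b)ε_s(x)c = ∑ S(x₁b)x₂c. Since `s` ignores E, it suffices to look at values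
of T₁, where both sides are source elements and agree by `es_mul`. -/
theorem s_snd_src (x : A) (z : A ⊗[ℂ] A) :
    W.s ((snd (W.src x)).l z) = W.s ((W.D x).l z) := by
  rw [← s_e, ← mul_l, e_mul_snd_src, mul_l, ← D_l_e, ← T₁_P, ← T₁_fst_l, s_T₁]
  generalize W.P z = w
  induction w with
  | zero => simp only [map_zero]
  | add x y hx hy => simp only [map_add, hx, hy]
  | tmul p q =>
    have h : (snd (W.src x)).l (W.T₁ (p ⊗ₜ q)) = W.T₁ ((W.src x).l p ⊗ₜ q) := by
      apply inj_injective
      rw [← mul_inj, inj_T₁, ← mul_assoc, ← D_src_l, inj_T₁]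
    rw [h, s_T₁, fst_l_tmul, inj_l, es_mul]
    rfl

/-- `S(b) (S(a) z) = S(ab) z`. -/
theorem s_tmul_s (b : A) (z : A ⊗[ℂ] A) :
    W.s (b ⊗ₜ W.s z) = W.s ((fst (inj b)).r z) := by
  have h : ∀ w, W.s (b ⊗ₜ W.es w) = W.s ((fst (inj b)).r (W.T₁ w)) := by
    intro w
    induction w with
    | zero => simp only [map_zero, TensorProduct.tmul_zero]
    | add x y hx hy => simp only [map_add, TensorProduct.tmul_add, hx, hy]
    | tmul p q =>
      have := W.s_snd_src p (b ⊗ₜ q)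
      rw [D_l_tmul] at this
      exact this
  rw [← W.s_e z, ← T₁_P, s_T₁, h, T₁_P, ← l_r, s_e]

/-- By `es_T₁` the first leg of (1 ⊗ a)E(b ⊗ c) lies in the range of `es`. The quotient map by that
range thus annihilates the first leg of every T₁(a ⊗ c) = E T₁(a ⊗ c), and fullness makes the
quotient zero. -/
theorem es_surjective : Function.Surjective W.es := by
  rw [← LinearMap.range_eq_top]
  have h : (LinearMap.range W.es).mkQ = 0 := W.full_ext fun a c => by
    rw [LinearMap.rTensor_zero, LinearMap.zero_apply, ← e_T₁]
    generalize W.T₁ (a ⊗ₜ[ℂ] c) = z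
    induction z with
    | zero => simp only [map_zero]
    | add x y hx hy => simp only [map_add, hx, hy, add_zero]
    | tmul b c =>
      refine lTensor_separating (fun a : A => LinearMap.mulLeft ℂ a)
        (fun b hb => NonDeg.right b hb) _ fun a => ?_
      rw [← LinearMap.comp_apply, LinearMap.lTensor_comp_rTensor, ← LinearMap.rTensor_comp_lTensor,
        LinearMap.comp_apply, ← es_T₁, ← LinearMap.comp_apply, ← LinearMap.rTensor_comp,
        ← LinearMap.comp_assoc, LinearMap.range_mkQ_comp, LinearMap.zero_comp,
        LinearMap.rTensor_zero, LinearMap.zero_apply]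
  rw [← Submodule.ker_mkQ (LinearMap.range W.es), h, LinearMap.ker_zero]

end WeakMultiplierHopfAlgebra

end WMHA

/-! ### Regularity: the antipode is a bijective anti-homomorphism. -/

namespace WMHA

open Multiplier

variable {A : Type*} [NonUnitalRing A] [Module ℂ A] [IsScalarTower ℂ A A] [SMulCommClass ℂ A A]

namespace WeakMultiplierHopfAlgebra

variable (W W' : WeakMultiplierHopfAlgebra A)

/-- `W'` carries the opposite coproduct of `W`. -/
def IsOpposite (W W' : WeakMultiplierHopfAlgebra A) : Prop := ∀ a, W'.D a = cop (W.D a)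

variable {W W'}

theorem IsOpposite.symm (h : W.IsOpposite W') : W'.IsOpposite W := fun a => by
  rw [h, cop_cop]

variable [NonDeg A]

theorem IsOpposite.e_eq (h : W.IsOpposite W') : W'.e = cop W.e := by
  have h1 := W'.eq_of_D_mul (X := cop W.e) (Y := 1) fun b => by
    rw [h, ← cop_mul, D_mul_e, mul_one]
  have h2 := W.eq_of_mul_D (X := cop W'.e) (Y := 1) fun b => by
    rw [h.symm, ← cop_mul, e_mul_D, one_mul]
  rw [mul_one] at h1
  rw [one_mul] at h2
  have h3 := congrArg cop h2
  rw [cop_mul, cop_cop] at h3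
  rw [← h1, h3]

theorem IsOpposite.D_mul_fst (h : W.IsOpposite W') (a b : A) :
    W.D a * fst (inj b) = inj (TensorProduct.comm ℂ A A (W'.T₁ (a ⊗ₜ b))) := by
  rw [← cop_inj, inj_T₁, cop_mul, cop_snd, h.symm]

theorem IsOpposite.snd_mul_D (h : W.IsOpposite W') (a b : A) :
    snd (inj a) * W.D b = inj (TensorProduct.comm ℂ A A (W'.T₂ (a ⊗ₜ b))) := by
  rw [← cop_inj, inj_T₂, cop_mul, cop_fst, h.symm]

/-- Seen through (1 ⊗ a)Δ(b)(1 ⊗ c), the right counit law of Δ^cop says that its counit satisfies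
the left counit law of Δ, and fullness gives uniqueness. -/
theorem IsOpposite.counit_eq (h : W.IsOpposite W') : W'.counit = W.counit := by
  refine W.full_ext fun b c => (TensorProduct.lid ℂ A).injective ?_
  rw [W.counit_T₁]
  refine eq_of_mul_left fun a => ?_
  have h1 : (snd (inj a)).l (W.T₁ (b ⊗ₜ c)) =
      (snd (inj c)).r (TensorProduct.comm ℂ A A (W'.T₂ (a ⊗ₜ b))) := by
    apply inj_injective
    rw [← mul_inj, inj_T₁, ← inj_mul', ← h.snd_mul_D, mul_assoc]
  have h2 : ∀ w : A ⊗[ℂ] A, TensorProduct.lid ℂ A (W'.counit.rTensor A ((snd (inj a)).l w)) =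
      a * TensorProduct.lid ℂ A (W'.counit.rTensor A w) := by
    intro w
    induction w with
    | zero => simp only [map_zero, mul_zero]
    | add x y hx hy => simp only [map_add, mul_add, hx, hy]
    | tmul x y =>
      change W'.counit x • (a * y) = a * (W'.counit x • y)
      rw [mul_smul_comm]
  have h3 : ∀ w : A ⊗[ℂ] A, TensorProduct.lid ℂ A (W'.counit.rTensor A
      ((snd (inj c)).r (TensorProduct.comm ℂ A A w))) =
      TensorProduct.rid ℂ A (W'.counit.lTensor A w) * c := by
    intro w
    induction w with
    | zero => simp only [map_zero, zero_mul]
    | add x y hx hy => simp only [map_add, add_mul, hx, hy]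
    | tmul x y =>
      change W'.counit y • (x * c) = (W'.counit y • x) * c
      rw [smul_mul_assoc]
  rw [← h2, h1, h3, W'.counit_right, mul_assoc]

theorem IsOpposite.src_mul (h : W.IsOpposite W') (x c : A) :
    W'.src (x * c) = W'.src ((W.src x).l c) := ext_r fun d => by
  have h1 : W'.e.r (d ⊗ₜ (x * c)) = (snd (inj x)).l (W'.e.r (d ⊗ₜ c)) := by rw [l_r]; rfl
  have h2 : W'.e.r (d ⊗ₜ (W.src x).l c) = (snd (W.src x)).l (W'.e.r (d ⊗ₜ c)) := by
    rw [l_r]; rfl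
  rw [src_r, src_r, er_tmul, er_tmul, h1, h2, snd_l, snd_l, h.counit_eq,
    ← LinearMap.comp_apply (W.counit.lTensor A), ← LinearMap.lTensor_comp,
    ← LinearMap.comp_apply (W.counit.lTensor A), ← LinearMap.lTensor_comp]
  congr 3
  exact LinearMap.ext fun c => (W.counit_es x c).symm

theorem IsOpposite.s_fst_src (h : W.IsOpposite W') (x : A) (z : A ⊗[ℂ] A) :
    W'.s ((fst (W.src x)).l z) = W'.s ((W'.D x).l z) := by
  have hc : W'.e * fst (W.src x) = fst (W.src x) * W'.e := by
    rw [h.e_eq, ← cop_snd, ← cop_mul, e_mul_snd_src, cop_mul]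
  rw [← s_e, ← mul_l, hc, mul_l, ← D_l_e, ← T₁_P, ← T₁_fst_l, s_T₁]
  generalize W'.P z = w
  induction w with
  | zero => simp only [map_zero]
  | add x y hx hy => simp only [map_add, hx, hy]
  | tmul p q =>
    have h' : (fst (W.src x)).l (W'.T₁ (p ⊗ₜ q)) = W'.T₁ ((W.src x).l p ⊗ₜ q) := by
      apply inj_injective
      rw [← mul_inj, inj_T₁, inj_T₁, ← mul_assoc, h, h, D_src_l, cop_mul, cop_snd]
    rw [h', s_T₁, fst_l_tmul, inj_l, ← src_l, ← src_l, h.src_mul]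

/-- For w = a ⊗ b this is S'(S(a)b)z = S'(b)az. On w = T₁(p ⊗ q) the left side involves ε_s(p)q, and
`s_fst_src` trades ε_s(p) for Δ^cop(p). -/
theorem IsOpposite.s_s (h : W.IsOpposite W') (w : A ⊗[ℂ] A) (z : A) :
    W'.s (W.s w ⊗ₜ z) = W'.s (TensorProduct.comm ℂ A A ((fst (inj z)).r w)) := by
  have h1 : ∀ w, W'.s (W.es w ⊗ₜ z) =
      W'.s (TensorProduct.comm ℂ A A ((fst (inj z)).r (W.T₁ w))) := by
    intro w
    induction w with
    | zero => simp only [map_zero, TensorProduct.zero_tmul]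
    | add x y hx hy => simp only [map_add, TensorProduct.add_tmul, hx, hy]
    | tmul p q =>
      have h2 := h.s_fst_src p (q ⊗ₜ z)
      rw [h, cop_l, TensorProduct.comm_tmul, D_l_tmul] at h2
      exact h2
  rw [← W.s_e w, ← W.T₁_P w, s_T₁, h1, T₁_P, ← l_r]
  generalize (fst (inj z)).r w = v
  rw [← comm_comm_apply v, ← cop_l, ← h.e_eq, s_e, comm_comm_apply]

theorem s_surjective : Function.Surjective W.s := fun a => by
  obtain ⟨w, rfl⟩ := W.es_surjective a
  exact ⟨W.T₁ w, W.s_T₁ w⟩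

/-- S' takes values in A, not only in M(A): S'(b)a lies in A because `a` is a value of `s` for Δ^cop
and S' reverses products. Then S'(S(a)b) = S'(b)a lies in A, and the elements S(a)b span A. -/
theorem IsOpposite.exists_s_eq_mul (h : W.IsOpposite W') :
    ∃ S' : A →ₗ[ℂ] A, ∀ c z, W'.s (c ⊗ₜ z) = S' c * z := by
  have h1 : ∀ a b, ∃ x, ∀ z, W'.s (b ⊗ₜ (a * z)) = x * z := by
    intro a b
    obtain ⟨g, rfl⟩ := W'.s_surjective a
    refine ⟨W'.s ((fst (inj b)).r g), fun z => ?_⟩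
    rw [← s_snd_r, s_tmul_s, ← s_snd_r, ← mul_r, ← mul_r, fst_snd_comm]
  have h2 : ∀ w, ∃ x, ∀ z, W'.s (W.s w ⊗ₜ z) = x * z := by
    intro w
    induction w with
    | zero => exact ⟨0, fun z => by rw [map_zero, TensorProduct.zero_tmul, map_zero, zero_mul]⟩
    | add x y hx hy =>
      obtain ⟨p, hp⟩ := hx
      obtain ⟨q, hq⟩ := hy
      exact ⟨p + q, fun z => by rw [map_add, TensorProduct.add_tmul, map_add, hp, hq, add_mul]⟩
    | tmul a b =>
      obtain ⟨x, hx⟩ := h1 a b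
      exact ⟨x, fun z => by rw [h.s_s, ← hx]; rfl⟩
  have h3 : ∀ c, ∃ x, ∀ z, W'.s (c ⊗ₜ z) = x * z := fun c => by
    obtain ⟨w, rfl⟩ := W.s_surjective c
    exact h2 w
  choose f hf using h3
  refine ⟨⟨⟨f, fun x y => eq_of_mul_right fun z => ?_⟩, fun k x => eq_of_mul_right fun z => ?_⟩, hf⟩
  · rw [← hf, TensorProduct.add_tmul, map_add, hf, hf, add_mul]
  · rw [← hf, ← TensorProduct.smul_tmul', map_smul, hf, RingHom.id_apply, smul_mul_assoc]

/-- Compare S'(S(a)b) = S'(b)a with S'(S(a)b) = S'(b)S'(S(a)). Every element of A is some S'(b), so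
non-degeneracy concludes. -/
theorem IsOpposite.leftInverse (h : W.IsOpposite W') {S S' : A →ₗ[ℂ] A}
    (hS : ∀ c z, W.s (c ⊗ₜ z) = S c * z) (hS' : ∀ c z, W'.s (c ⊗ₜ z) = S' c * z) (a : A) :
    S' (S a) = a := by
  have h1 : ∀ a b, S' (S a * b) = S' b * a := fun a b => eq_of_mul_right fun z => by
    rw [← hS, ← hS', h.s_s, mul_assoc, ← hS']
    rfl
  have hm : ∀ a b, S' (a * b) = S' b * S' a := fun a b => eq_of_mul_right fun z => by
    rw [mul_assoc, ← hS', ← hS', ← hS', W'.s_tmul_s]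
    rfl
  refine eq_of_mul_left fun c => ?_
  have h2 : ∀ w, ∃ b, S' b = W'.s w := by
    intro w
    induction w with
    | zero => exact ⟨0, by simp only [map_zero]⟩
    | add x y hx hy =>
      obtain ⟨p, hp⟩ := hx
      obtain ⟨q, hq⟩ := hy
      exact ⟨p + q, by rw [map_add, map_add, hp, hq]⟩
    | tmul b a => exact ⟨S a * b, by rw [h1, hS']⟩
  obtain ⟨w, rfl⟩ := W'.s_surjective c
  obtain ⟨b, hb⟩ := h2 w
  rw [← hb, ← hm, h1]

end WeakMultiplierHopfAlgebra

/-- A regular weak multiplier Hopf algebra with the opposite one and its antipode. -/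
structure RegularPair (A : Type*) [NonUnitalRing A] [Module ℂ A] [IsScalarTower ℂ A A]
    [SMulCommClass ℂ A A] [NonDeg A] where
  W : WeakMultiplierHopfAlgebra A
  W' : WeakMultiplierHopfAlgebra A
  opp : W.IsOpposite W'
  S : A ≃ₗ[ℂ] A
  s_tmul : ∀ a b, W.s (a ⊗ₜ b) = S a * b
  s'_tmul : ∀ a b, W'.s (a ⊗ₜ b) = S.symm a * b

open WeakMultiplierHopfAlgebra

theorem WeakMultiplierHopfAlgebra.IsOpposite.exists_regularPair [NonDeg A]
    {W W' : WeakMultiplierHopfAlgebra A} (h : W.IsOpposite W') :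
    ∃ Q : RegularPair A, Q.W = W ∧ Q.W' = W' := by
  obtain ⟨S', hS'⟩ := h.exists_s_eq_mul
  obtain ⟨S, hS⟩ := h.symm.exists_s_eq_mul
  exact ⟨⟨W, W', h, LinearEquiv.ofLinearMap S S'
    (LinearMap.ext fun a => h.symm.leftInverse hS' hS a)
    (LinearMap.ext fun a => h.leftInverse hS hS' a), hS, hS'⟩, rfl, rfl⟩

namespace RegularPair

variable [NonDeg A] (Q : RegularPair A)

/-- The pair with both coproducts exchanged. -/
def symm : RegularPair A := ⟨Q.W', Q.W, Q.opp.symm, Q.S.symm, Q.s'_tmul, Q.s_tmul⟩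

theorem S_mul (a b : A) : Q.S (a * b) = Q.S b * Q.S a := eq_of_mul_right fun z => by
  rw [mul_assoc, ← s_tmul, ← s_tmul, ← s_tmul, s_tmul_s]
  rfl

/-- `x ↦ Δ(x)(c ⊗ 1)`. -/
def covR (c : A) : A →ₗ[ℂ] A ⊗[ℂ] A := (TensorProduct.comm ℂ A A).toLinearMap ∘ₗ Q.W'.t₁ c

/-- `x ↦ (1 ⊗ c)Δ(x)`. -/
def covL (c : A) : A →ₗ[ℂ] A ⊗[ℂ] A := (TensorProduct.comm ℂ A A).toLinearMap ∘ₗ Q.W'.t₂ c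

theorem inj_covR (c x : A) : inj (Q.covR c x) = Q.W.D x * fst (inj c) :=
  (Q.opp.D_mul_fst x c).symm

theorem inj_covL (c x : A) : inj (Q.covL c x) = snd (inj c) * Q.W.D x :=
  (Q.opp.snd_mul_D c x).symm

theorem snd_r_covR (a c d : A) : (snd (inj d)).r (Q.covR c a) = (Q.W.D a).l (c ⊗ₜ d) := by
  apply inj_injective
  rw [← inj_mul', inj_covR, mul_assoc, fst_mul_snd, ← inj_tmul, mul_inj]

/-- The value of `m(S ⊗ id)` on `Δ(g)(γ ⊗ 1)` is `S(γ) ε_s(g)`. -/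
theorem s_covR (γ g : A) : Q.W.s (Q.covR γ g) = (Q.W.src g).r (Q.S γ) :=
  eq_of_mul_right fun z => by
    rw [← s_snd_r, snd_r_covR, ← s_snd_src, snd_l_tmul, s_tmul, (Q.W.src g).compat]

theorem covR_T₁ (γ α c : A) : (Q.W.t₁ c).lTensor A (Q.covR γ α) =
    TensorProduct.assoc ℂ A A A ((Q.covR γ).rTensor A (Q.W.T₁ (α ⊗ₜ c))) := by
  apply inj_injective
  refine eq_of_fst_inj_mul fun d => ?_
  have h1 : ∀ x, (fst (inj d)).l (Q.covR γ x) = (fst (inj γ)).r (Q.W.T₂ (d ⊗ₜ x)) := by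
    intro x
    apply inj_injective
    rw [← mul_inj, inj_covR, ← inj_mul', inj_T₂, mul_assoc]
  have h2 : ∀ w : A ⊗[ℂ] A, (fst (inj d)).l ((Q.W.t₁ c).lTensor A w) =
      (Q.W.t₁ c).lTensor A ((fst (inj d)).l w) := by
    intro w
    rw [fst_l, fst_l, ← LinearMap.comp_apply, LinearMap.rTensor_comp_lTensor,
      ← LinearMap.comp_apply, LinearMap.lTensor_comp_rTensor]
  have h3 : ∀ w : A ⊗[ℂ] A, (fst (inj γ)).r ((Q.W.t₁ c).lTensor A w) =
      (Q.W.t₁ c).lTensor A ((fst (inj γ)).r w) := by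
    intro w
    rw [fst_r, fst_r, ← LinearMap.comp_apply, LinearMap.rTensor_comp_lTensor,
      ← LinearMap.comp_apply, LinearMap.lTensor_comp_rTensor]
  have h4 : ∀ w : A ⊗[ℂ] A, (fst (inj d)).l
      (TensorProduct.assoc ℂ A A A ((Q.covR γ).rTensor A w)) =
      (fst (inj γ)).r (TensorProduct.assoc ℂ A A A ((Q.W.t₂ d).rTensor A w)) := by
    intro w
    induction w with
    | zero => simp only [map_zero]
    | add x y hx hy => simp only [map_add, hx, hy]
    | tmul x y =>
      rw [← l12_fst, ← l12_fst, LinearMap.rTensor_tmul, LinearMap.rTensor_tmul, l12_l_tmul,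
        l12_r_tmul, h1]
      rfl
  rw [mul_inj, mul_inj, h2, h1, h4, assoc_t₂_T₁, h3]

theorem snd_r_T₂_S (c : A) (w : A ⊗[ℂ] A) :
    (snd (inj c)).r (Q.W.T₂ (Q.S.toLinearMap.rTensor A w)) =
      Q.W.s.rTensor A ((TensorProduct.assoc ℂ A A A).symm ((Q.W.t₁ c).lTensor A w)) := by
  induction w with
  | zero => simp only [map_zero]
  | add x y hx hy => simp only [map_add, hx, hy]
  | tmul k m =>
    have h : (snd (inj c)).r (Q.W.T₂ (Q.S k ⊗ₜ m)) = (fst (inj (Q.S k))).l (Q.W.T₁ (m ⊗ₜ c)) := by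
      apply inj_injective
      rw [← inj_mul', inj_T₂, ← mul_inj, inj_T₁, mul_assoc]
    refine h.trans ?_
    rw [LinearMap.lTensor_tmul, t₁_apply]
    generalize Q.W.T₁ (m ⊗ₜ[ℂ] c) = v
    induction v with
    | zero => simp only [map_zero, TensorProduct.tmul_zero]
    | add x y hx hy => simp only [map_add, TensorProduct.tmul_add, hx, hy]
    | tmul x y =>
      rw [TensorProduct.assoc_symm_tmul, LinearMap.rTensor_tmul, s_tmul]
      rfl

/-- In Sweedler form S(γ)S(α₁)α₂ ⊗ α₃ = S(γ)ε_s(α₁) ⊗ α₂ = (S(γ) ⊗ α)E: coassociativity, then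
`s_covR`, then `er_T₁`. -/
theorem T₂_S_covR (γ α : A) :
    Q.W.T₂ (Q.S.toLinearMap.rTensor A (Q.covR γ α)) = Q.W.e.r (Q.S γ ⊗ₜ α) := by
  apply inj_injective
  refine eq_of_mul_snd_inj fun c => ?_
  have h : Q.W.s ∘ₗ Q.covR γ = Q.W.er ∘ₗ TensorProduct.mk ℂ A A (Q.S γ) :=
    LinearMap.ext fun g => Q.s_covR γ g
  rw [inj_mul', inj_mul', snd_r_T₂_S, covR_T₁, LinearEquiv.symm_apply_apply,
    ← LinearMap.comp_apply, ← LinearMap.rTensor_comp, h, er_T₁]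
  rfl

/-! ### The antipode reverses the coproduct -/

/-- `S ⊗ S`. -/
def SS : (A ⊗[ℂ] A) ≃ₗ[ℂ] (A ⊗[ℂ] A) := TensorProduct.congr Q.S Q.S

theorem SS_tmul (a b : A) : Q.SS (a ⊗ₜ b) = Q.S a ⊗ₜ Q.S b := rfl

theorem SS_mul (x y : A ⊗[ℂ] A) : Q.SS (x * y) = Q.SS y * Q.SS x := by
  induction x with
  | zero => rw [zero_mul, map_zero, mul_zero]
  | add x x' hx hx' => rw [add_mul, map_add, map_add, mul_add, hx, hx']
  | tmul a b =>
    induction y with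
    | zero => rw [mul_zero, map_zero, zero_mul]
    | add y y' hy hy' => rw [mul_add, map_add, map_add, add_mul, hy, hy']
    | tmul c d =>
      rw [Algebra.TensorProduct.tmul_mul_tmul, SS_tmul, SS_tmul, SS_tmul,
        Algebra.TensorProduct.tmul_mul_tmul, S_mul, S_mul]

/-- The extension of `S` to multipliers of `A`. -/
def aS (m : Multiplier A) : Multiplier A := anti Q.S Q.S_mul m

/-- The extension of `S ⊗ S` to multipliers of `A ⊗ A`. -/
def aSS (m : Multiplier (A ⊗[ℂ] A)) : Multiplier (A ⊗[ℂ] A) := anti Q.SS Q.SS_mul m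

theorem aSS_mul (m n : Multiplier (A ⊗[ℂ] A)) : Q.aSS (m * n) = Q.aSS n * Q.aSS m :=
  anti_mul _ _ _ _

theorem aSS_inj (z : A ⊗[ℂ] A) : Q.aSS (inj z) = inj (Q.SS z) := anti_inj _ _ _

theorem aSS_r_SS (m : Multiplier (A ⊗[ℂ] A)) (z : A ⊗[ℂ] A) :
    (Q.aSS m).r (Q.SS z) = Q.SS (m.l z) := by
  rw [aSS, anti_r, LinearEquiv.symm_apply_apply]

theorem aSS_l_SS (m : Multiplier (A ⊗[ℂ] A)) (z : A ⊗[ℂ] A) :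
    (Q.aSS m).l (Q.SS z) = Q.SS (m.r z) := by
  rw [aSS, anti_l, LinearEquiv.symm_apply_apply]

theorem aSS_tens (x y : Multiplier A) : Q.aSS (tens x y) = tens (Q.aS x) (Q.aS y) :=
  Multiplier.ext (TensorProduct.ext' fun _ _ => rfl) (TensorProduct.ext' fun _ _ => rfl)

theorem aS_one : Q.aS 1 = 1 := anti_one _ _

theorem aSS_snd (x : Multiplier A) : Q.aSS (snd x) = snd (Q.aS x) := by
  rw [snd, aSS_tens, aS_one]; rfl

theorem aS_inj (x : A) : Q.aS (inj x) = inj (Q.S x) := anti_inj _ _ _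

theorem aSS_cop (X : Multiplier (A ⊗[ℂ] A)) : Q.aSS (cop X) = cop (Q.aSS X) := by
  have h : ∀ z, Q.SS (TensorProduct.comm ℂ A A z) = TensorProduct.comm ℂ A A (Q.SS z) := by
    intro z
    induction z with
    | zero => simp only [map_zero]
    | add x y hx hy => simp only [map_add, hx, hy]
    | tmul x y => rfl
  refine ext_l fun z => ?_
  obtain ⟨z, rfl⟩ := Q.SS.surjective z
  rw [aSS_l_SS, cop_l, cop_r, h, ← h z, aSS_l_SS]

theorem aSS_symm_aSS (X : Multiplier (A ⊗[ℂ] A)) : Q.aSS (Q.symm.aSS X) = X :=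
  Multiplier.ext (LinearMap.ext fun z => by
      obtain ⟨z, rfl⟩ := Q.SS.surjective z
      rw [aSS_l_SS]
      exact (Q.SS.apply_symm_apply _).trans (congrArg X.l rfl))
    (LinearMap.ext fun z => by
      obtain ⟨z, rfl⟩ := Q.SS.surjective z
      rw [aSS_r_SS]
      exact (Q.SS.apply_symm_apply _).trans (congrArg X.r rfl))

/-- `x ⊗ y ↦ (S(x) ⊗ 1) Δ(y) ζ`. -/
def lam (ζ : A ⊗[ℂ] A) : A ⊗[ℂ] A →ₗ[ℂ] A ⊗[ℂ] A :=
  TensorProduct.lift (LinearMap.mk₂ ℂ (fun x y => (fst (inj (Q.S x))).l (Q.W.Dl ζ y))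
    (fun x x' y => by rw [map_add, inj_add, fst_l, fst_l, fst_l, ← LinearMap.add_apply,
      ← LinearMap.rTensor_add]; rfl)
    (fun c x y => by
      rw [map_smul, fst_l, fst_l, ← LinearMap.smul_apply, ← LinearMap.rTensor_smul]
      congr 2
      exact LinearMap.ext fun z => smul_mul_assoc c (Q.S x) z)
    (fun x y y' => by rw [map_add, map_add])
    (fun c x y => by rw [map_smul, map_smul]))

theorem lam_tmul (ζ : A ⊗[ℂ] A) (x y : A) :
    Q.lam ζ (x ⊗ₜ y) = (fst (inj (Q.S x))).l ((Q.W.D y).l ζ) := rfl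

/-- Multiplied by S(c), the map becomes `s` on the first two legs of (id ⊗ Δ)(z)(c ⊗ ζ). There E is
moved out as E¹², and `s` ignores it. -/
theorem lam_e (ζ z : A ⊗[ℂ] A) : Q.lam ζ (Q.W.e.l z) = Q.lam ζ z := by
  have h : ∀ c z, (fst (inj (Q.S c))).l (Q.lam ζ z) = Q.W.s.rTensor A
      ((TensorProduct.assoc ℂ A A A).symm ((Q.W.idD z).l (c ⊗ₜ ζ))) := by
    intro c z
    induction z with
    | zero => rw [idD_zero]; exact ((map_zero _).trans (map_zero _).symm)
    | add x y hx hy =>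
      rw [idD_add, map_add, map_add, hx, hy, ← map_add, ← map_add]; rfl
    | tmul x y =>
      rw [idD_tmul, mul_l, l23, snd_l_tmul, fst_l_tmul, lam_tmul, inj_l]
      generalize (Q.W.D y).l ζ = v
      induction v with
      | zero => simp only [map_zero, TensorProduct.tmul_zero]
      | add x y hx hy => simp only [map_add, TensorProduct.tmul_add, hx, hy]
      | tmul p q =>
        rw [TensorProduct.assoc_symm_tmul, LinearMap.rTensor_tmul, s_tmul, S_mul, mul_assoc]
        rfl
  apply inj_injective
  refine eq_of_fst_inj_mul fun c => ?_
  obtain ⟨c, rfl⟩ := Q.S.surjective c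
  rw [mul_inj, mul_inj, h, h, ← l12_mul_idD, mul_l]
  generalize (Q.W.idD z).l (c ⊗ₜ[ℂ] ζ) = t
  obtain ⟨t, rfl⟩ := (TensorProduct.assoc ℂ A A A).surjective t
  have hs : Q.W.s ∘ₗ Q.W.e.l = Q.W.s := LinearMap.ext Q.W.s_e
  rw [l12_l, LinearEquiv.symm_apply_apply, LinearEquiv.symm_apply_apply, ← LinearMap.comp_apply,
    ← LinearMap.rTensor_comp, hs]

/-- `x ⊗ y ⊗ z ↦ (S(y) ⊗ S(x)) Δ(z) ζ`. -/
def revMul (ζ : A ⊗[ℂ] A) : A ⊗[ℂ] (A ⊗[ℂ] A) →ₗ[ℂ] A ⊗[ℂ] A :=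
  TensorProduct.lift (LinearMap.mk₂ ℂ (fun x z => (snd (inj (Q.S x))).l (Q.lam ζ z))
    (fun x x' y => by rw [map_add, inj_add, snd_l, snd_l, snd_l, ← LinearMap.add_apply,
      ← LinearMap.lTensor_add]; rfl)
    (fun c x y => by
      rw [map_smul, snd_l, snd_l, ← LinearMap.smul_apply, ← LinearMap.lTensor_smul]
      congr 2
      exact LinearMap.ext fun z => smul_mul_assoc c (Q.S x) z)
    (fun x y y' => by rw [map_add, map_add])
    (fun c x y => by rw [map_smul, map_smul]))

theorem revMul_tmul (ζ z : A ⊗[ℂ] A) (x : A) :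
    Q.revMul ζ (x ⊗ₜ z) = (snd (inj (Q.S x))).l (Q.lam ζ z) := rfl

theorem revMul_l23_e (ζ : A ⊗[ℂ] A) (t : A ⊗[ℂ] (A ⊗[ℂ] A)) :
    Q.revMul ζ ((l23 Q.W.e).l t) = Q.revMul ζ t := by
  induction t with
  | zero => simp only [map_zero]
  | add x y hx hy => simp only [map_add, hx, hy]
  | tmul x z => rw [l23, snd_l_tmul, revMul_tmul, lam_e, revMul_tmul]

theorem revMul_assoc (ζ w : A ⊗[ℂ] A) (h : A) :
    Q.revMul ζ (TensorProduct.assoc ℂ A A A (w ⊗ₜ h)) =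
      Q.SS (TensorProduct.comm ℂ A A w) * (Q.W.D h).l ζ := by
  induction w with
  | zero => simp only [map_zero, TensorProduct.zero_tmul, zero_mul]
  | add x y hx hy => simp only [map_add, TensorProduct.add_tmul, add_mul, hx, hy]
  | tmul x y =>
    rw [TensorProduct.assoc_tmul, revMul_tmul, lam_tmul, TensorProduct.comm_tmul, SS_tmul,
      ← mul_l, snd_mul_fst, ← inj_tmul]
    rfl

/-- `x ⊗ y ↦ (S ⊗ S)(Δ^cop(x)) Δ(y) ζ`. -/
def bet (ζ : A ⊗[ℂ] A) : A ⊗[ℂ] A →ₗ[ℂ] A ⊗[ℂ] A :=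
  TensorProduct.lift (LinearMap.mk₂ ℂ (fun x y => (Q.aSS (cop (Q.W.D x))).l (Q.W.Dl ζ y))
    (fun x x' y => by
      rw [D_add]
      simp only [aSS, anti_l, cop_r]
      rw [← map_add, ← map_add]
      rfl)
    (fun c x y => by
      have h : Q.W.D (c • x) = up (c • Q.W.comul x) := by rw [D, map_smul]
      have h' : ∀ t, (up (c • Q.W.comul x)).r t = c • (Q.W.D x).r t := fun _ => rfl
      rw [h]
      simp only [aSS, anti_l, cop_r]
      rw [h', map_smul, map_smul])
    (fun x y y' => by rw [map_add, map_add])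
    (fun c x y => by rw [map_smul, map_smul]))

theorem bet_tmul (ζ : A ⊗[ℂ] A) (x y : A) :
    Q.bet ζ (x ⊗ₜ y) = (Q.aSS (cop (Q.W.D x))).l ((Q.W.D y).l ζ) := rfl

theorem mul_bet (ζ : A ⊗[ℂ] A) (γ δ x y : A) :
    (Q.S γ ⊗ₜ Q.S δ) * Q.bet ζ (x ⊗ₜ y) =
      Q.revMul ζ (TensorProduct.assoc ℂ A A A ((Q.W.D x).l (δ ⊗ₜ γ) ⊗ₜ y)) := by
  rw [bet_tmul, ← Multiplier.compat, ← SS_tmul, aSS_r_SS, cop_l, TensorProduct.comm_tmul,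
    revMul_assoc]

theorem eq_of_S_tmul_mul {x y : A ⊗[ℂ] A}
    (h : ∀ γ δ, (Q.S γ ⊗ₜ Q.S δ) * x = (Q.S γ ⊗ₜ Q.S δ) * y) : x = y :=
  eq_of_mul_left fun c => by
    induction c with
    | zero => rw [zero_mul, zero_mul]
    | add p q hp hq => rw [add_mul, add_mul, hp, hq]
    | tmul a b =>
      obtain ⟨a, rfl⟩ := Q.S.surjective a
      obtain ⟨b, rfl⟩ := Q.S.surjective b
      exact h a b

/-- Covered by S(γ) ⊗ S(δ), the map becomes `revMul` of (Δ ⊗ id)(z); there `dT_e` turns E into E²³,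
which `revMul` ignores because of `lam_e`. -/
theorem bet_e (ζ z : A ⊗[ℂ] A) : Q.bet ζ (Q.W.e.l z) = Q.bet ζ z := by
  have h : ∀ γ δ y z, (Q.S γ ⊗ₜ Q.S δ) * Q.bet ζ ((snd (inj y)).r z) =
      Q.revMul ζ ((Q.W.dT z).l (TensorProduct.assoc ℂ A A A ((δ ⊗ₜ γ) ⊗ₜ y))) := by
    intro γ δ y z
    induction z with
    | zero => rw [dT_zero, map_zero, map_zero, mul_zero]; exact (map_zero _).symm
    | add a b ha hb => rw [dT_add, map_add, map_add, mul_add, ha, hb, ← map_add]; rfl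
    | tmul a b => rw [snd_r_tmul, mul_bet, dT_tmul, mul_l, third_l, l12_l_tmul]; rfl
  induction z with
  | zero => simp only [map_zero]
  | add x y hx hy => simp only [map_add, hx, hy]
  | tmul a b =>
    induction b using Q.W.mul_induction with
    | h0 => rw [TensorProduct.tmul_zero, map_zero]
    | hadd x y hx hy => rw [TensorProduct.tmul_add, map_add, map_add, map_add, hx, hy]
    | hmul x y =>
      refine Q.eq_of_S_tmul_mul fun γ δ => ?_
      have h1 : a ⊗ₜ (x * y) = (snd (inj y)).r (a ⊗ₜ[ℂ] x) := rfl
      rw [h1, l_r, h, h, dT_e, mul_l, revMul_l23_e]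

theorem revMul_snd (ζ : A ⊗[ℂ] A) (γ q : A) (w : A ⊗[ℂ] A) :
    Q.revMul ζ ((second (inj γ)).r ((Q.W.t₁ q).lTensor A w)) =
      (Q.S γ ⊗ₜ Q.W.s w) * (Q.W.D q).l ζ := by
  induction w with
  | zero => simp only [map_zero, TensorProduct.tmul_zero, zero_mul]
  | add x y hx hy => simp only [map_add, TensorProduct.tmul_add, add_mul, hx, hy]
  | tmul k m =>
    have h1 : (fst (inj γ)).r (Q.W.T₁ (m ⊗ₜ q)) = (snd (inj q)).r (Q.covR γ m) := by
      apply inj_injective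
      rw [← inj_mul', ← inj_mul', inj_T₁, inj_covR, mul_assoc, mul_assoc, fst_snd_comm]
    have h2 : ∀ w, Q.lam ζ ((snd (inj q)).r w) =
        Q.W.T₂ (Q.S.toLinearMap.rTensor A w) * (Q.W.D q).l ζ := by
      intro w
      induction w with
      | zero => simp only [map_zero, zero_mul]
      | add x y hx hy => simp only [map_add, add_mul, hx, hy]
      | tmul x y =>
        rw [snd_r_tmul, lam_tmul, LinearMap.rTensor_tmul, inj_r, D_mul, mul_l, ← mul_l (fst _)]
        exact (congrArg (fun m => Multiplier.l m ((Q.W.D q).l ζ)) (Q.W.inj_T₂ (Q.S x) y)).symm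
    rw [LinearMap.lTensor_tmul, t₁_apply, second, snd_r_tmul, h1, revMul_tmul, h2, T₂_S_covR,
      Multiplier.compat, ← mul_l, e_mul_D, s_tmul, Multiplier.l_mul, snd_l_tmul]
    rfl

/-- The convolution of (S ⊗ S)Δ^cop with Δ: the inner pair S(p₂)p₃ collapses by `T₂_S_covR`, the
outer one by `s_covR`, leaving 1 ⊗ ε_s(p). -/
theorem bet_T₁ (ζ : A ⊗[ℂ] A) (p q : A) :
    Q.bet ζ (Q.W.T₁ (p ⊗ₜ q)) = (snd (Q.W.src p)).l ((Q.W.D q).l ζ) := by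
  refine Q.eq_of_S_tmul_mul fun γ δ => ?_
  have h : ∀ w, (Q.S γ ⊗ₜ Q.S δ) * Q.bet ζ w = Q.revMul ζ ((second (inj γ)).r
      (TensorProduct.assoc ℂ A A A ((Q.covR δ).rTensor A w))) := by
    intro w
    induction w with
    | zero => simp only [map_zero, mul_zero]
    | add x y hx hy => simp only [map_add, mul_add, hx, hy]
    | tmul x y =>
      have h1 : ∀ v : A ⊗[ℂ] A, (second (inj γ)).r (TensorProduct.assoc ℂ A A A (v ⊗ₜ y)) =
          TensorProduct.assoc ℂ A A A ((snd (inj γ)).r v ⊗ₜ y) := by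
        intro v
        induction v with
        | zero => simp only [map_zero, TensorProduct.zero_tmul]
        | add a b ha hb => simp only [map_add, TensorProduct.add_tmul, ha, hb]
        | tmul a b => rfl
      rw [mul_bet, LinearMap.rTensor_tmul, h1, snd_r_covR]
  rw [h, ← covR_T₁, revMul_snd, s_covR, ← (snd (Q.W.src p)).compat]
  rfl

/-- By `bet_T₁` and `D_src_l`, `bet` agrees with Δ∘es on T₁(w), hence with Δ∘s everywhere, because
`bet` ignores E. -/
theorem aSS_cop_D_mul_e (a : A) : Q.aSS (cop (Q.W.D a)) * Q.W.e = Q.W.D (Q.S a) := by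
  refine Eq.trans (Q.W.eq_of_mul_D fun b => ext_l fun ζ => ?_) (Q.W.D_mul_e _)
  have h : ∀ z, Q.bet ζ z = (Q.W.D (Q.W.s z)).l ζ := by
    have h1 : ∀ w, Q.bet ζ (Q.W.T₁ w) = (Q.W.D (Q.W.es w)).l ζ := by
      intro w
      induction w with
      | zero => rw [map_zero, map_zero, map_zero, ← Dl_apply, map_zero]
      | add x y hx hy => rw [map_add, map_add, map_add, D_add, hx, hy]; rfl
      | tmul p q => rw [bet_T₁, ← src_l, D_src_l]; rfl
    intro z
    rw [← bet_e, ← T₁_P, h1]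
    rfl
  rw [mul_l, ← bet_tmul, h, s_tmul, D_mul]

theorem symm_W : Q.symm.W = Q.W' := rfl
theorem symm_S (a : A) : Q.symm.S a = Q.S.symm a := rfl

theorem aSS_cop_e_mul_D (a : A) : Q.aSS (cop Q.W.e) * Q.W.D (Q.S a) = Q.aSS (cop (Q.W.D a)) := by
  have h := congrArg Q.aSS (Q.symm.aSS_cop_D_mul_e (Q.S a))
  rw [aSS_mul, aSS_symm_aSS, symm_W, symm_S, LinearEquiv.symm_apply_apply, Q.opp, Q.opp, cop_cop,
    Q.opp.e_eq] at h
  exact h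

theorem D_S (a : A) : Q.W.D (Q.S a) = Q.aSS (cop (Q.W.D a)) := by
  rw [← aSS_cop_D_mul_e, ← aSS_cop_e_mul_D, mul_assoc, D_mul_e]

theorem aSS_cop_e : Q.aSS (cop Q.W.e) = Q.W.e := by
  have h : ∀ Q : RegularPair A, Q.aSS (cop Q.W.e) * Q.W.e = Q.W.e := by
    intro Q
    have h1 := Q.W.eq_of_mul_D (X := Q.aSS (cop Q.W.e)) (Y := 1) fun b => by
      obtain ⟨b, rfl⟩ := Q.S.surjective b
      rw [one_mul, aSS_cop_e_mul_D, D_S]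
    rwa [one_mul] at h1
  -- The opposite pair gives E^cop absorbed by (S⁻¹ ⊗ S⁻¹)(E) on the other side; S ⊗ S carries this
  -- back to the missing absorption.
  have h2 := congrArg Q.aSS (h Q.symm)
  rw [aSS_mul, aSS_symm_aSS, symm_W, Q.opp.e_eq, cop_cop, h Q] at h2
  exact h2.symm

theorem aSS_e : Q.aSS Q.W.e = cop Q.W.e := by
  rw [← cop_cop (Q.aSS Q.W.e), ← aSS_cop, aSS_cop_e]

end RegularPair

end WMHA

/-! ### Existence and uniqueness of the antipode. -/

namespace WMHA

open Multiplier WeakMultiplierHopfAlgebra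

variable {A : Type*} [NonUnitalRing A] [Module ℂ A] [IsScalarTower ℂ A A] [SMulCommClass ℂ A A]

namespace RegularPair

variable [NonDeg A] (Q : RegularPair A)

/-- `a ⊗ b ↦ ∑ a₁ ⊗ S(a₂) b`. -/
def P₁ : A ⊗[ℂ] A →ₗ[ℂ] A ⊗[ℂ] A :=
  Q.S.toLinearMap.lTensor A ∘ₗ (TensorProduct.comm ℂ A A).toLinearMap ∘ₗ Q.W'.T₂ ∘ₗ
    (TensorProduct.comm ℂ A A).toLinearMap ∘ₗ Q.S.symm.toLinearMap.lTensor A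

/-- `a ⊗ b ↦ ∑ a S(b₁) ⊗ b₂`. -/
def P₂ : A ⊗[ℂ] A →ₗ[ℂ] A ⊗[ℂ] A :=
  Q.S.toLinearMap.rTensor A ∘ₗ (TensorProduct.comm ℂ A A).toLinearMap ∘ₗ Q.W'.T₁ ∘ₗ
    (TensorProduct.comm ℂ A A).toLinearMap ∘ₗ Q.S.symm.toLinearMap.rTensor A

theorem P₁_tmul (a b : A) :
    Q.P₁ (a ⊗ₜ b) = Q.S.toLinearMap.lTensor A (Q.covL (Q.S.symm b) a) := rfl

theorem P₂_tmul (a b : A) :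
    Q.P₂ (a ⊗ₜ b) = Q.S.toLinearMap.rTensor A (Q.covR (Q.S.symm a) b) := rfl

theorem fst_l_P₁ (a b c : A) : (fst (inj c)).l (Q.P₁ (a ⊗ₜ b)) =
    (LinearMap.mulRight ℂ b ∘ₗ Q.S.toLinearMap).lTensor A (Q.W.T₂ (c ⊗ₜ a)) := by
  have h1 : (fst (inj c)).l (Q.covL (Q.S.symm b) a) =
      (snd (inj (Q.S.symm b))).l (Q.W.T₂ (c ⊗ₜ a)) := by
    apply inj_injective
    rw [← mul_inj, ← mul_inj, inj_covL, inj_T₂, ← mul_assoc, ← mul_assoc, fst_snd_comm]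
  have h2 : Q.S.toLinearMap ∘ₗ (inj (Q.S.symm b)).l = LinearMap.mulRight ℂ b ∘ₗ Q.S.toLinearMap :=
    LinearMap.ext fun x => (Q.S_mul _ _).trans (by rw [LinearEquiv.apply_symm_apply]; rfl)
  rw [P₁_tmul, fst_l, ← LinearMap.comp_apply, LinearMap.rTensor_comp_lTensor,
    ← LinearMap.lTensor_comp_rTensor, LinearMap.comp_apply, ← fst_l, h1, snd_l,
    ← LinearMap.comp_apply, ← LinearMap.lTensor_comp, h2]

theorem snd_r_P₂ (a b c : A) : (snd (inj c)).r (Q.P₂ (a ⊗ₜ b)) =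
    (LinearMap.mulLeft ℂ a ∘ₗ Q.S.toLinearMap).rTensor A (Q.W.T₁ (b ⊗ₜ c)) := by
  have h1 : (snd (inj c)).r (Q.covR (Q.S.symm a) b) =
      (fst (inj (Q.S.symm a))).r (Q.W.T₁ (b ⊗ₜ c)) := by
    apply inj_injective
    rw [← inj_mul', ← inj_mul', inj_covR, inj_T₁, mul_assoc, mul_assoc, fst_snd_comm]
  have h2 : Q.S.toLinearMap ∘ₗ (inj (Q.S.symm a)).r = LinearMap.mulLeft ℂ a ∘ₗ Q.S.toLinearMap :=
    LinearMap.ext fun x => (Q.S_mul _ _).trans (by rw [LinearEquiv.apply_symm_apply]; rfl)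
  rw [P₂_tmul, snd_r, ← LinearMap.comp_apply, LinearMap.lTensor_comp_rTensor,
    ← LinearMap.rTensor_comp_lTensor, LinearMap.comp_apply, ← snd_r, h1, fst_r,
    ← LinearMap.comp_apply, ← LinearMap.rTensor_comp, h2]

theorem T₂_P₂ (p : A ⊗[ℂ] A) : Q.W.T₂ (Q.P₂ p) = Q.W.e.r p := by
  induction p with
  | zero => simp only [map_zero]
  | add x y hx hy => simp only [map_add, hx, hy]
  | tmul a b => rw [P₂_tmul, T₂_S_covR, LinearEquiv.apply_symm_apply]

theorem SS_comm_T₂ (w : A ⊗[ℂ] A) : Q.SS (TensorProduct.comm ℂ A A (Q.W.T₂ w)) =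
    Q.W.T₁ (Q.SS (TensorProduct.comm ℂ A A w)) := by
  induction w with
  | zero => simp only [map_zero]
  | add x y hx hy => simp only [map_add, hx, hy]
  | tmul x y =>
    apply inj_injective
    rw [← aSS_inj, ← cop_inj, inj_T₂, cop_mul, aSS_mul, ← D_S, cop_fst, aSS_snd, aS_inj,
      TensorProduct.comm_tmul, SS_tmul, inj_T₁]

/-- The image of `T₂_S_covR` under the flip followed by S ⊗ S, which exchanges T₂ with T₁ and fixes
E up to the flip. -/
theorem T₁_P₁ (p : A ⊗[ℂ] A) : Q.W.T₁ (Q.P₁ p) = Q.W.e.l p := by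
  induction p with
  | zero => simp only [map_zero]
  | add x y hx hy => simp only [map_add, hx, hy]
  | tmul a b =>
    have h := congrArg (fun z => Q.SS (TensorProduct.comm ℂ A A z))
      (Q.T₂_S_covR (Q.S.symm (Q.S.symm b)) (Q.S.symm a))
    have h1 : Q.SS (TensorProduct.comm ℂ A A (Q.S.toLinearMap.rTensor A
        (Q.covR (Q.S.symm (Q.S.symm b)) (Q.S.symm a)))) = Q.P₁ (a ⊗ₜ b) := by
      have h2 : ∀ w : A ⊗[ℂ] A, Q.SS (TensorProduct.comm ℂ A A (Q.S.toLinearMap.rTensor A w)) =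
          Q.S.toLinearMap.lTensor A (Q.SS (TensorProduct.comm ℂ A A w)) := by
        intro w
        induction w with
        | zero => simp only [map_zero]
        | add x y hx hy => simp only [map_add, hx, hy]
        | tmul x y => rfl
      rw [h2, P₁_tmul]
      congr 1
      apply inj_injective
      rw [← aSS_inj, ← cop_inj, inj_covR, cop_mul, aSS_mul, ← D_S, cop_fst, aSS_snd, aS_inj,
        LinearEquiv.apply_symm_apply, LinearEquiv.apply_symm_apply, inj_covL]
    have h3 : Q.SS (TensorProduct.comm ℂ A A
        (Q.W.e.r (Q.S (Q.S.symm (Q.S.symm b)) ⊗ₜ Q.S.symm a))) = Q.W.e.l (a ⊗ₜ b) := by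
      have h4 : Q.S (Q.S.symm (Q.S.symm b)) ⊗ₜ[ℂ] Q.S.symm a =
          TensorProduct.comm ℂ A A (Q.S.symm a ⊗ₜ[ℂ] Q.S.symm b) := by
        rw [LinearEquiv.apply_symm_apply]; rfl
      rw [h4, ← cop_r, ← aSS_l_SS, aSS_cop_e, SS_tmul, LinearEquiv.apply_symm_apply,
        LinearEquiv.apply_symm_apply]
    rw [← h1, ← SS_comm_T₂, h, h3]

theorem lid_counit_T₁ (W : WeakMultiplierHopfAlgebra A) (p : A ⊗[ℂ] A) :
    TensorProduct.lid ℂ A (W.counit.rTensor A (W.T₁ p)) = LinearMap.mul' ℂ A p := by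
  induction p with
  | zero => simp only [map_zero]
  | add x y hx hy => simp only [map_add, hx, hy]
  | tmul x y => rw [W.counit_T₁, LinearMap.mul'_apply]

theorem rid_counit_T₂ (W : WeakMultiplierHopfAlgebra A) (p : A ⊗[ℂ] A) :
    TensorProduct.rid ℂ A (W.counit.lTensor A (W.T₂ p)) = LinearMap.mul' ℂ A p := by
  induction p with
  | zero => simp only [map_zero]
  | add x y hx hy => simp only [map_add, hx, hy]
  | tmul x y => rw [W.counit_right, LinearMap.mul'_apply]

theorem applyMul_tmul (Z : A →ₗ[ℂ] Mult A) (a b : A) : applyMul Z (a ⊗ₜ b) = (up (Z a)).l b := rfl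

theorem applyMul_incl_S (z : A ⊗[ℂ] A) : applyMul (incl ∘ₗ Q.S.toLinearMap) z = Q.W.s z := by
  induction z with
  | zero => simp only [map_zero]
  | add x y hx hy => simp only [map_add, hx, hy]
  | tmul x y => rw [s_tmul]; rfl

theorem isAntipode_incl_S : Q.W.IsAntipode (incl ∘ₗ Q.S.toLinearMap) := by
  refine ⟨Q.P₁, Q.P₂, fun a b c => Q.fst_l_P₁ a b c, fun a b c => Q.snd_r_P₂ a b c, Q.T₁_P₁,
    Q.T₂_P₂, fun a b => ?_, fun a b => ?_⟩
  · rw [← lid_counit_T₁ Q.W, T₁_P₁, e_T₁, counit_T₁]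
  · rw [T₁_P₁, applyMul_incl_S, s_e, s_tmul]
    rfl

/-- The condition on P₂ forces ∑ Z(p₁)p₂q = ε_s(p)q, by multiplying out P₂ and using the counit law
for T₂. Then Z(a)b = ∑ Z(a₁)a₂Z(a₃)b is determined, since T₁P₁ = E. -/
theorem eq_incl_S_of_isAntipode {Z : A →ₗ[ℂ] Mult A} (h : Q.W.IsAntipode Z) :
    Z = incl ∘ₗ Q.S.toLinearMap := by
  obtain ⟨P₁, P₂, -, h2, h3, h4, -, h6⟩ := h
  have key : ∀ w, applyMul Z (Q.W.T₁ w) = Q.W.es w := by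
    intro w
    induction w with
    | zero => simp only [map_zero]
    | add x y hx hy => simp only [map_add, hx, hy]
    | tmul p q =>
      refine eq_of_mul_left fun d => ?_
      have h5 := congrArg (LinearMap.mul' ℂ A) (h2 d p q)
      have h7 : ∀ w : A ⊗[ℂ] A, LinearMap.mul' ℂ A ((LinearMap.mulRight ℂ q).lTensor A w) =
          LinearMap.mul' ℂ A w * q := by
        intro w
        induction w with
        | zero => simp only [map_zero, zero_mul]
        | add x y hx hy => simp only [map_add, add_mul, hx, hy]
        | tmul x y =>
          rw [LinearMap.lTensor_tmul, LinearMap.mul'_apply, LinearMap.mul'_apply, mul_assoc]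
          rfl
      have h8 : ∀ w : A ⊗[ℂ] A, LinearMap.mul' ℂ A ((mulOnLeft Z d).rTensor A w) =
          d * applyMul Z w := by
        intro w
        induction w with
        | zero => simp only [map_zero, mul_zero]
        | add x y hx hy => simp only [map_add, mul_add, hx, hy]
        | tmul x y =>
          rw [LinearMap.rTensor_tmul, LinearMap.mul'_apply, applyMul_tmul, ← Multiplier.compat]
          rfl
      rw [h7, h8, ← rid_counit_T₂ Q.W, h4] at h5
      rw [← h5, ← er_mul]
      rfl
  refine LinearMap.ext fun a => up_injective (ext_l fun b => ?_)
  have h9 := h6 a b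
  rw [h3] at h9
  have h11 : (up (Z a)).l b = applyMul Z (Q.W.e.l (a ⊗ₜ b)) := h9.symm
  rw [h11, ← T₁_P, key]
  exact Q.s_tmul a b

theorem isAntipode_iff (Z : A →ₗ[ℂ] Mult A) :
    Q.W.IsAntipode Z ↔ Z = incl ∘ₗ Q.S.toLinearMap :=
  ⟨Q.eq_incl_S_of_isAntipode, fun h => by rw [h]; exact Q.isAntipode_incl_S⟩

end RegularPair

end WMHA

/-! ### Quasitriangular structures and the Drinfeld element. -/

namespace WMHA

open Multiplier WeakMultiplierHopfAlgebra

variable {A : Type*} [NonUnitalRing A] [Module ℂ A] [IsScalarTower ℂ A A] [SMulCommClass ℂ A A]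

namespace Multiplier

/-- A multiplier with bijective left and right actions is invertible. -/
theorem isUnit_of_bijective (m : Multiplier A) (hl : Function.Bijective m.l)
    (hr : Function.Bijective m.r) : IsUnit m := by
  let el := LinearEquiv.ofBijective m.l hl
  let er := LinearEquiv.ofBijective m.r hr
  have hel : ∀ x, m.l (el.symm x) = x := fun x => el.apply_symm_apply x
  have her : ∀ x, m.r (er.symm x) = x := fun x => er.apply_symm_apply x
  let n : Multiplier A := ⟨el.symm.toLinearMap, er.symm.toLinearMap,
    fun a b => hl.1 (by
      change m.l (el.symm _) = m.l (el.symm a * b)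
      rw [m.l_mul, hel, hel]),
    fun a b => hr.1 (by
      change m.r (er.symm _) = m.r (a * er.symm b)
      rw [m.r_mul, her, her]),
    fun a b => by
      change er.symm a * b = a * el.symm b
      conv_lhs => rw [← hel b]
      rw [← m.compat, her]⟩
  exact ⟨⟨m, n, Multiplier.ext (LinearMap.ext hel) (LinearMap.ext fun x => er.symm_apply_apply x),
    Multiplier.ext (LinearMap.ext fun x => el.symm_apply_apply x) (LinearMap.ext her)⟩, rfl⟩

theorem l13_l (X : Multiplier (A ⊗[ℂ] A)) (g : A) (z : A ⊗[ℂ] A) :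
    (l13 X).l (TensorProduct.leftComm ℂ A A A (g ⊗ₜ z)) =
      TensorProduct.leftComm ℂ A A A (g ⊗ₜ X.l z) := by
  have h : ∀ z : A ⊗[ℂ] A, TensorProduct.leftComm ℂ A A A (g ⊗ₜ z) =
      (TensorProduct.comm ℂ A A).lTensor A (TensorProduct.assoc ℂ A A A (z ⊗ₜ g)) := by
    intro z
    induction z with
    | zero => simp only [map_zero, TensorProduct.zero_tmul, TensorProduct.tmul_zero]
    | add x y hx hy => simp only [map_add, TensorProduct.add_tmul, TensorProduct.tmul_add, hx, hy]
    | tmul x y => rfl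
  rw [h, l13, swap23, map_l, LinearEquiv.symm_apply_apply, l12_l_tmul, h]

variable [NonDeg A]

theorem eq_of_mul_fst_inj {B : Type*} [NonUnitalRing B] [Module ℂ B] [IsScalarTower ℂ B B]
    [SMulCommClass ℂ B B] [NonDeg B] {X Y : Multiplier (A ⊗[ℂ] B)}
    (h : ∀ a, X * fst (inj a) = Y * fst (inj a)) : X = Y :=
  ext_r fun z => sub_eq_zero.1 (rTensor_separating (fun b : A => LinearMap.mulRight ℂ b)
    (fun b hb => NonDeg.left b hb) _ fun b => by
      have := congrArg (fun m => Multiplier.r m z) (h b)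
      rw [map_sub, sub_eq_zero]
      exact this)

theorem l12_inj_mul_third (z : A ⊗[ℂ] A) (c : A) :
    l12 (inj z) * third (inj c) = inj (TensorProduct.assoc ℂ A A A (z ⊗ₜ c)) := by
  rw [l12, ← reassoc_snd, ← reassoc_mul, fst_mul_snd, ← inj_tmul, reassoc_inj]

theorem fst_inj_mul_l23_inj (a : A) (z : A ⊗[ℂ] A) :
    fst (inj a) * l23 (inj z) = inj (a ⊗ₜ[ℂ] z) := by
  rw [l23, fst_mul_snd, ← inj_tmul]

theorem eq_of_mul_l12_inj {X Y : Multiplier (A ⊗[ℂ] (A ⊗[ℂ] A))}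
    (h : ∀ z, X * l12 (inj z) = Y * l12 (inj z)) : X = Y :=
  eq_of_mul_inj fun t => by
    obtain ⟨t, rfl⟩ := (TensorProduct.assoc ℂ A A A).surjective t
    induction t with
    | zero => rw [map_zero, inj_zero, mul_zero, mul_zero]
    | add x y hx hy => rw [map_add, inj_add, mul_add, mul_add, hx, hy]
    | tmul z c => rw [← l12_inj_mul_third, ← mul_assoc, ← mul_assoc, h]

theorem eq_of_mul_third_inj {X Y : Multiplier (A ⊗[ℂ] (A ⊗[ℂ] A))}
    (h : ∀ c, X * third (inj c) = Y * third (inj c)) : X = Y :=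
  eq_of_mul_l12_inj fun z => eq_of_mul_inj fun t => by
    obtain ⟨t, rfl⟩ := (TensorProduct.assoc ℂ A A A).surjective t
    induction t with
    | zero => rw [map_zero, inj_zero, mul_zero, mul_zero]
    | add x y hx hy => rw [map_add, inj_add, mul_add, mul_add, hx, hy]
    | tmul w c =>
      rw [← l12_inj_mul_third, ← mul_assoc, mul_assoc X, ← l12_mul, mul_assoc, l12_third,
        ← mul_assoc, h, mul_assoc, ← l12_third, l12_mul]
      simp only [mul_assoc]

theorem l12_zero : l12 (0 : Multiplier (A ⊗[ℂ] A)) = 0 := by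
  have h := l12_add (0 : Multiplier (A ⊗[ℂ] A)) 0
  rw [add_zero] at h
  exact left_eq_add.1 h

end Multiplier

namespace WeakMultiplierHopfAlgebra

variable [NonDeg A] (W : WeakMultiplierHopfAlgebra A)

theorem eq_of_mul_dT {X Y : Multiplier (A ⊗[ℂ] (A ⊗[ℂ] A))}
    (h : ∀ p, X * W.dT p = Y * W.dT p) : X * l12 W.e = Y * l12 W.e := by
  have h1 : ∀ a, X * l12 (W.D a) = Y * l12 (W.D a) := fun a => eq_of_mul_third_inj fun b => by
    rw [mul_assoc, mul_assoc, ← dT_tmul, h]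
  refine eq_of_mul_l12_inj fun z => ?_
  obtain ⟨w, hw⟩ := W.exists_T₁ z
  rw [mul_assoc, mul_assoc, ← l12_mul, mul_inj, ← hw]
  clear hw
  induction w with
  | zero => rw [map_zero, inj_zero, l12_zero, mul_zero, mul_zero]
  | add x y hx hy => rw [map_add, inj_add, l12_add, mul_add, mul_add, hx, hy]
  | tmul x y => rw [inj_T₁, l12_mul, ← mul_assoc, ← mul_assoc, h1]

theorem eq_of_mul_idD {X Y : Multiplier (A ⊗[ℂ] (A ⊗[ℂ] A))}
    (h : ∀ p, X * W.idD p = Y * W.idD p) : X * l23 W.e = Y * l23 W.e := by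
  have h1 : ∀ b, X * l23 (W.D b) = Y * l23 (W.D b) := fun b => eq_of_mul_fst_inj fun a => by
    rw [mul_assoc, mul_assoc, ← fst_l23, ← idD_tmul, h]
  refine eq_of_mul_snd_inj fun z => ?_
  obtain ⟨w, hw⟩ := W.exists_T₁ z
  rw [mul_assoc, mul_assoc, ← l23, ← l23_mul, mul_inj, ← hw]
  clear hw
  induction w with
  | zero => rw [map_zero, inj_zero, l23_zero, mul_zero, mul_zero]
  | add x y hx hy => rw [map_add, inj_add, l23_add, mul_add, mul_add, hx, hy]
  | tmul x y => rw [inj_T₁, l23_mul, ← mul_assoc, ← mul_assoc, h1]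

theorem idD_mul_idD (p q : A ⊗[ℂ] A) : W.idD p * W.idD q = W.idD (p * q) := by
  induction p with
  | zero => rw [idD_zero, zero_mul, zero_mul, idD_zero]
  | add x y hx hy => rw [add_mul, idD_add, idD_add, add_mul, hx, hy]
  | tmul a b =>
    induction q with
    | zero => rw [idD_zero, mul_zero, mul_zero, idD_zero]
    | add x y hx hy => rw [mul_add, idD_add, idD_add, mul_add, hx, hy]
    | tmul c d =>
      rw [Algebra.TensorProduct.tmul_mul_tmul, idD_tmul, idD_tmul, idD_tmul, D_mul, l23_mul,
        inj_mul, fst_mul, mul_assoc, ← mul_assoc (l23 _), ← fst_l23]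
      simp only [mul_assoc]

theorem idD_fst_l (a : A) (p : A ⊗[ℂ] A) :
    W.idD ((fst (inj a)).l p) = fst (inj a) * W.idD p := by
  induction p with
  | zero => rw [map_zero, idD_zero, mul_zero]
  | add x y hx hy => rw [map_add, idD_add, idD_add, mul_add, hx, hy]
  | tmul x y => rw [fst_l_tmul, idD_tmul, idD_tmul, ← mul_assoc, ← fst_mul, inj_l, inj_mul]

theorem dT_fst_l (a : A) (p : A ⊗[ℂ] A) :
    W.dT ((fst (inj a)).l p) = l12 (W.D a) * W.dT p := by
  induction p with
  | zero => rw [map_zero, dT_zero, mul_zero]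
  | add x y hx hy => rw [map_add, dT_add, dT_add, mul_add, hx, hy]
  | tmul x y => rw [fst_l_tmul, dT_tmul, dT_tmul, ← mul_assoc, ← l12_mul, inj_l, D_mul]

theorem idD_mul_inj (p z : A ⊗[ℂ] A) : W.idD p * l23 (inj z) = inj ((W.Dl z).lTensor A p) := by
  induction p with
  | zero => rw [idD_zero, zero_mul, map_zero, inj_zero]
  | add x y hx hy => rw [idD_add, add_mul, map_add, inj_add, hx, hy]
  | tmul a b =>
    rw [idD_tmul, mul_assoc, ← l23_mul, mul_inj, fst_inj_mul_l23_inj]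
    rfl

theorem dT_mul_inj (p z : A ⊗[ℂ] A) : W.dT p * l12 (inj z) =
    inj (TensorProduct.assoc ℂ A A A ((W.Dl z).rTensor A p)) := by
  induction p with
  | zero => rw [dT_zero, zero_mul, map_zero, map_zero, inj_zero]
  | add x y hx hy => rw [dT_add, add_mul, map_add, map_add, inj_add, hx, hy]
  | tmul a b =>
    rw [dT_tmul, mul_assoc, ← l12_third, ← mul_assoc, ← l12_mul, mul_inj, l12_inj_mul_third]
    rfl

end WeakMultiplierHopfAlgebra

/-- A quasitriangular weak multiplier Hopf algebra with covered `R`, together with the antipode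
and the inverse of `R`. -/
structure QuasitriangularData (A : Type*) [NonUnitalRing A] [Module ℂ A] [IsScalarTower ℂ A A]
    [SMulCommClass ℂ A A] [NonDeg A] extends RegularPair A where
  R : Multiplier (A ⊗[ℂ] A)
  Rb : Multiplier (A ⊗[ℂ] A)
  R_mul_Rb : R * Rb = cop W.e
  Rb_mul_R : Rb * R = W.e
  R_mul_e : R * W.e = R
  Rb_mul_cop_e : Rb * cop W.e = Rb
  dT_R : ∀ p, l13 R * l23 R * W.dT p = W.dT (R.l p)
  R_mul_l12_e : l13 R * l23 R * l12 W.e = l13 R * l23 R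
  idD_R : ∀ p, l13 R * l12 R * W.idD p = W.idD (R.l p)
  R_mul_l23_e : l13 R * l12 R * l23 W.e = l13 R * l12 R
  intertwine : ∀ a, cop (W.D a) * R = R * W.D a
  /-- `a ↦ R(a ⊗ 1)` -/
  cov₁ : A →ₗ[ℂ] A ⊗[ℂ] A
  /-- `a ↦ R(1 ⊗ a)` -/
  cov₂ : A →ₗ[ℂ] A ⊗[ℂ] A
  inj_cov₁ : ∀ a, inj (cov₁ a) = R * fst (inj a)
  inj_cov₂ : ∀ a, inj (cov₂ a) = R * snd (inj a)

namespace QuasitriangularData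

variable [NonDeg A] (K : QuasitriangularData A)

theorem cop_e_mul_R : cop K.W.e * K.R = K.R := by
  rw [← R_mul_Rb, mul_assoc, Rb_mul_R, R_mul_e]

theorem e_mul_Rb : K.W.e * K.Rb = K.Rb := by
  rw [← Rb_mul_R, mul_assoc, R_mul_Rb, Rb_mul_cop_e]

theorem cop_e_fst_src (a : A) :
    cop K.W.e * fst (K.W.src a) = fst (K.W.src a) * cop K.W.e := by
  rw [← cop_snd, ← cop_mul, e_mul_snd_src, cop_mul]

/-- `(ε_s(a) ⊗ 1) R = R (1 ⊗ ε_s(a))`. -/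
theorem fst_src_mul_R (a : A) : fst (K.W.src a) * K.R = K.R * snd (K.W.src a) := by
  have h := K.W'.eq_of_D_mul (X := fst (K.W.src a) * K.R) (Y := K.R * snd (K.W.src a)) fun d => by
    rw [← mul_assoc, ← mul_assoc, K.opp, ← cop_snd, ← cop_mul, ← D_src_r, intertwine, intertwine,
      D_src_r, mul_assoc]
  rw [K.opp.e_eq, ← mul_assoc, ← mul_assoc, cop_e_fst_src, mul_assoc, cop_e_mul_R] at h
  exact h

theorem snd_r_cov₁ (x y : A) : (snd (inj y)).r (K.cov₁ x) = K.R.l (x ⊗ₜ y) := by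
  apply inj_injective
  rw [← inj_mul', inj_cov₁, mul_assoc, fst_mul_snd, ← inj_tmul, mul_inj]

theorem fst_r_cov₂ (x y : A) : (fst (inj x)).r (K.cov₂ y) = K.R.l (x ⊗ₜ y) := by
  apply inj_injective
  rw [← inj_mul', inj_cov₂, mul_assoc, snd_mul_fst, ← inj_tmul, mul_inj]

theorem cov₁_mul (a b : A) : K.cov₁ (a * b) = (fst (inj b)).r (K.cov₁ a) := by
  apply inj_injective
  rw [← inj_mul', inj_cov₁, inj_cov₁, inj_mul, fst_mul, mul_assoc]

/-- `x ⊗ y ↦ S(y) x`. -/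
def phi : A ⊗[ℂ] A →ₗ[ℂ] A := K.W.s ∘ₗ (TensorProduct.comm ℂ A A).toLinearMap

theorem phi_apply (z : A ⊗[ℂ] A) : K.phi z = K.W.s (TensorProduct.comm ℂ A A z) := rfl

theorem phi_tmul (x y : A) : K.phi (x ⊗ₜ y) = K.S y * x := K.s_tmul y x

theorem phi_snd_r (y : A) (z : A ⊗[ℂ] A) : K.phi ((snd (inj y)).r z) = K.S y * K.phi z := by
  induction z with
  | zero => simp only [map_zero, mul_zero]
  | add p q hp hq => simp only [map_add, mul_add, hp, hq]
  | tmul p q => rw [snd_r_tmul, phi_tmul, phi_tmul, inj_r, K.S_mul, mul_assoc]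

theorem phi_fst_r (y : A) (z : A ⊗[ℂ] A) : K.phi ((fst (inj y)).r z) = K.phi z * y := by
  induction z with
  | zero => simp only [map_zero, zero_mul]
  | add p q hp hq => simp only [map_add, add_mul, hp, hq]
  | tmul p q => rw [fst_r_tmul, phi_tmul, phi_tmul, inj_r, mul_assoc]

/-- `b ↦ ∑ S(R₂) R₁ b`, the left action of the Drinfeld element. -/
def drl : A →ₗ[ℂ] A := K.phi ∘ₗ K.cov₁

theorem drl_apply (b : A) : K.drl b = K.phi (K.cov₁ b) := rfl

theorem drl_mul (a b : A) : K.drl (a * b) = K.drl a * b := by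
  rw [drl_apply, cov₁_mul, phi_fst_r]; rfl

theorem phi_R (x y : A) : K.phi (K.R.l (x ⊗ₜ y)) = K.S y * K.drl x := by
  rw [← snd_r_cov₁, phi_snd_r]; rfl

/-- Evaluate `phi` on RE(cb ⊗ d), with E(c ⊗ d) = T₁(w). For w = p ⊗ q the intertwining relation
gives Δ^cop(p)R(b ⊗ q), which `s_snd_src` turns into (ε_s(p) ⊗ 1)R(b ⊗ q) = R(b ⊗ ε_s(p)q). The
result is S(S(c)d)ub = S(d)S²(c)ub, against S(d)u(cb). -/
theorem drl_S_S_mul (c b : A) : K.drl (c * b) = K.S (K.S c) * K.drl b := by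
  have h : ∀ w, K.phi (K.R.l ((fst (inj b)).r (K.W.T₁ w))) = K.S (K.W.es w) * K.drl b := by
    intro w
    induction w with
    | zero => simp only [map_zero, zero_mul]
    | add p q hp hq => simp only [map_add, add_mul, hp, hq]
    | tmul p q =>
      have h1 : (fst (inj b)).r (K.W.T₁ (p ⊗ₜ q)) = (K.W.D p).l (b ⊗ₜ q) :=
        (K.W.D_l_tmul p b q).symm
      rw [h1, ← mul_l, ← intertwine, mul_l, phi_apply, cop_l, comm_comm_apply, ← s_snd_src,
        ← src_l, ← phi_R, ← snd_l_tmul, ← mul_l, ← fst_src_mul_R, mul_l]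
      rw [phi_apply, ← cop_snd, cop_l, comm_comm_apply]
  refine eq_of_mul_left fun d => ?_
  obtain ⟨d, rfl⟩ := K.S.surjective d
  have h2 := h (K.W.P (c ⊗ₜ d))
  have h3 : K.W.es (K.W.P (c ⊗ₜ d)) = K.S c * d := K.s_tmul c d
  have h4 : (fst (inj b)).r (c ⊗ₜ[ℂ] d) = (c * b) ⊗ₜ d := rfl
  rw [T₁_P, ← l_r, ← mul_l, R_mul_e, h4, phi_R, h3, K.S_mul, mul_assoc] at h2
  exact h2

/-- The Drinfeld element `u`. -/
def u : Multiplier A := of K.drl (K.drl ∘ₗ K.S.symm.toLinearMap ∘ₗ K.S.symm.toLinearMap)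
  fun a b => by
    change K.drl (K.S.symm (K.S.symm a)) * b = _
    rw [← drl_mul, drl_S_S_mul, LinearEquiv.apply_symm_apply, LinearEquiv.apply_symm_apply]

theorem u_l (a : A) : K.u.l a = K.drl a := rfl

theorem u_r (a : A) : K.u.r a = K.drl (K.S.symm (K.S.symm a)) := rfl

theorem u_r_S_S (a : A) : K.u.r (K.S (K.S a)) = K.u.l a := by
  rw [u_r, LinearEquiv.symm_apply_apply, LinearEquiv.symm_apply_apply, u_l]

theorem phi_cop_e (z : A ⊗[ℂ] A) : K.phi ((cop K.W.e).l z) = K.phi z := by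
  rw [phi_apply, cop_l, comm_comm_apply, s_e, phi_apply]

/-- `phi` ignores E^cop = R R̄, so each S(y)x is a value of `phi` on R(A ⊗ A), and there `phi` takes
values S(y)ux = u(S⁻¹(y)x). -/
theorem drl_surjective : Function.Surjective K.drl := by
  have h1 : ∀ z, K.phi (K.R.l z) ∈ LinearMap.range K.drl := by
    intro z
    induction z with
    | zero => simp only [map_zero]; exact Submodule.zero_mem _
    | add p q hp hq => simp only [map_add]; exact Submodule.add_mem _ hp hq
    | tmul x y =>
      rw [phi_R]
      refine ⟨K.S.symm y * x, ?_⟩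
      rw [drl_S_S_mul, LinearEquiv.apply_symm_apply]
  intro a
  change a ∈ LinearMap.range K.drl
  induction a using K.W.mul_induction with
  | h0 => exact Submodule.zero_mem _
  | hadd a b ha hb => exact Submodule.add_mem _ ha hb
  | hmul a b =>
    obtain ⟨a, rfl⟩ := K.S.surjective a
    rw [← phi_tmul, ← phi_cop_e, ← R_mul_Rb, mul_l]
    exact h1 _

theorem isUnit_u : IsUnit K.u := by
  have hr : Function.Surjective K.u.r := fun a => by
    obtain ⟨b, rfl⟩ := K.drl_surjective a
    exact ⟨K.S (K.S b), K.u_r_S_S b⟩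
  -- Injectivity of the left action follows from surjectivity of the right one: (au)b = a(ub).
  have hl : Function.Injective K.u.l := by
    refine (injective_iff_map_eq_zero _).2 fun b hb => NonDeg.right b fun a => ?_
    obtain ⟨a, rfl⟩ := hr a
    rw [K.u.compat, hb, mul_zero]
  refine isUnit_of_bijective _ ⟨hl, K.drl_surjective⟩ ⟨fun a b h => ?_, hr⟩
  rw [u_r, u_r] at h
  exact K.S.symm.injective (K.S.symm.injective (hl h))

/-- The element `v = S(u)`. -/
def v : Multiplier A := K.aS K.u

theorem isUnit_v : IsUnit K.v := by
  obtain ⟨w, hw⟩ := K.isUnit_u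
  refine ⟨⟨K.aS w, K.aS (w⁻¹ : (Multiplier A)ˣ), ?_, ?_⟩, ?_⟩
  · rw [RegularPair.aS, RegularPair.aS, ← anti_mul, Units.inv_mul, anti_one]
  · rw [RegularPair.aS, RegularPair.aS, ← anti_mul, Units.mul_inv, anti_one]
  · rw [v, ← hw]

theorem aS_mul (m n : Multiplier A) : K.aS (m * n) = K.aS n * K.aS m := anti_mul _ _ _ _

theorem inj_S_S_mul_u (c : A) : inj (K.S (K.S c)) * K.u = K.u * inj c := by
  rw [inj_mul', mul_inj, u_r_S_S]

/-- `S²(m) u = u m` for all multipliers `m`. -/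
theorem aS_aS_mul_u (m : Multiplier A) : K.aS (K.aS m) * K.u = K.u * m :=
  eq_of_mul_inj fun a => by
    rw [mul_assoc, mul_assoc, mul_inj m, ← inj_S_S_mul_u, ← inj_S_S_mul_u, ← mul_assoc, mul_inj]
    congr 2
    rw [RegularPair.aS, anti_l, LinearEquiv.symm_apply_apply, RegularPair.aS, anti_r,
      LinearEquiv.symm_apply_apply]

/-- S²(m)u = um at m = u, with u cancelled. -/
theorem aS_v : K.aS K.v = K.u := K.isUnit_u.mul_right_cancel (K.aS_aS_mul_u K.u)

theorem v_mul_aS_aS (m : Multiplier A) : K.v * K.aS (K.aS m) = m * K.v := by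
  have h : ∀ m, K.v * K.aS (K.aS (K.aS m)) = K.aS m * K.v := fun m => by
    have := congrArg K.aS (K.aS_aS_mul_u m)
    rwa [aS_mul, aS_mul] at this
  obtain ⟨m', rfl⟩ : ∃ m', K.aS m' = m := ⟨K.symm.aS m, Multiplier.ext
    (LinearMap.ext fun x => (K.S.apply_symm_apply _).trans
      (congrArg m.l (K.S.apply_symm_apply x)))
    (LinearMap.ext fun x => (K.S.apply_symm_apply _).trans
      (congrArg m.r (K.S.apply_symm_apply x)))⟩
  rw [h]

theorem u_mul_v : K.u * K.v = K.v * K.u := by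
  rw [← aS_aS_mul_u, aS_v]; rfl

theorem u_mul_v_central (m : Multiplier A) : K.u * K.v * m = m * (K.u * K.v) := by
  have h : ∀ m, K.u * K.v * K.aS (K.aS m) = K.aS (K.aS m) * (K.u * K.v) := fun m => by
    rw [mul_assoc, v_mul_aS_aS, ← mul_assoc, ← aS_aS_mul_u, mul_assoc]
  obtain ⟨w, hw⟩ := K.isUnit_u
  -- Only multipliers S²(m) are seen directly to commute with uv, and conjugation by u recovers m
  -- from S²(m).
  have h4 : m = w⁻¹ * K.aS (K.aS m) * w := by
    rw [mul_assoc, hw, aS_aS_mul_u, ← hw, ← mul_assoc, Units.inv_mul, one_mul]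
  have h5 : Commute (K.u * K.v) (w : Multiplier A) := by
    rw [hw, Commute, SemiconjBy, mul_assoc, ← u_mul_v]
  rw [h4]
  exact ((h5.units_inv_right.mul_right (h m)).mul_right h5).eq

end QuasitriangularData

end WMHA

/-! ### The opposite quasitriangular structure and the coproduct of R. -/

namespace WMHA

open Multiplier WeakMultiplierHopfAlgebra

variable {A : Type*} [NonUnitalRing A] [Module ℂ A] [IsScalarTower ℂ A A] [SMulCommClass ℂ A A]

/-! ### Reversal of three legs -/

/-- `x ⊗ y ⊗ z ↦ z ⊗ y ⊗ x`. -/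
def rev₃ : A ⊗[ℂ] (A ⊗[ℂ] A) ≃ₗ[ℂ] A ⊗[ℂ] (A ⊗[ℂ] A) :=
  TensorProduct.comm ℂ A (A ⊗[ℂ] A) ≪≫ₗ
    (TensorProduct.congr (TensorProduct.comm ℂ A A) (LinearEquiv.refl ℂ A)) ≪≫ₗ
      TensorProduct.assoc ℂ A A A

theorem rev₃_tmul' (a : A) (w : A ⊗[ℂ] A) : rev₃ (a ⊗ₜ w) =
    TensorProduct.assoc ℂ A A A (TensorProduct.comm ℂ A A w ⊗ₜ a) := rfl

theorem rev₃_assoc (w : A ⊗[ℂ] A) (a : A) : rev₃ (TensorProduct.assoc ℂ A A A (w ⊗ₜ a)) =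
    a ⊗ₜ TensorProduct.comm ℂ A A w := by
  induction w with
  | zero => simp only [map_zero, TensorProduct.zero_tmul, TensorProduct.tmul_zero]
  | add x y hx hy => simp only [map_add, TensorProduct.add_tmul, TensorProduct.tmul_add, hx, hy]
  | tmul x y => rfl

theorem rev₃_leftComm (g : A) (w : A ⊗[ℂ] A) : rev₃ (TensorProduct.leftComm ℂ A A A (g ⊗ₜ w)) =
    TensorProduct.leftComm ℂ A A A (g ⊗ₜ TensorProduct.comm ℂ A A w) := by
  induction w with
  | zero => simp only [map_zero, TensorProduct.tmul_zero]
  | add x y hx hy => simp only [map_add, TensorProduct.tmul_add, hx, hy]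
  | tmul x y => rfl

theorem rev₃_mul (s t : A ⊗[ℂ] (A ⊗[ℂ] A)) : rev₃ (s * t) = rev₃ s * rev₃ t := by
  induction s with
  | zero => rw [zero_mul, map_zero, zero_mul]
  | add x y hx hy => rw [add_mul, map_add, map_add, add_mul, hx, hy]
  | tmul a z =>
    induction t with
    | zero => rw [mul_zero, map_zero, mul_zero]
    | add x y hx hy => rw [mul_add, map_add, map_add, mul_add, hx, hy]
    | tmul b w =>
      rw [Algebra.TensorProduct.tmul_mul_tmul, rev₃_tmul', rev₃_tmul', rev₃_tmul', comm_mul,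
        ← assoc_mul, Algebra.TensorProduct.tmul_mul_tmul]

namespace Multiplier

/-- The reversal of the three legs of a multiplier. -/
def rev (X : Multiplier (A ⊗[ℂ] (A ⊗[ℂ] A))) : Multiplier (A ⊗[ℂ] (A ⊗[ℂ] A)) :=
  map rev₃ rev₃_mul X

theorem rev_mul (X Y : Multiplier (A ⊗[ℂ] (A ⊗[ℂ] A))) : rev (X * Y) = rev X * rev Y :=
  map_mul _ _ _ _

theorem rev_l_rev₃ (X : Multiplier (A ⊗[ℂ] (A ⊗[ℂ] A))) (t : A ⊗[ℂ] (A ⊗[ℂ] A)) :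
    (rev X).l (rev₃ t) = rev₃ (X.l t) := by
  rw [rev, map_l, LinearEquiv.symm_apply_apply]

variable [NonDeg A]

theorem rev_ext {X Y : Multiplier (A ⊗[ℂ] (A ⊗[ℂ] A))} (h : ∀ t, Y.l (rev₃ t) = rev₃ (X.l t)) :
    rev X = Y := ext_l fun t => by
  obtain ⟨t, rfl⟩ := rev₃.surjective t
  rw [rev_l_rev₃, h]

theorem rev_l12 (X : Multiplier (A ⊗[ℂ] A)) : rev (l12 X) = l23 (cop X) := rev_ext fun t => by
  obtain ⟨t, rfl⟩ := (TensorProduct.assoc ℂ A A A).surjective t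
  induction t with
  | zero => simp only [map_zero]
  | add x y hx hy => simp only [map_add, hx, hy]
  | tmul z c => rw [rev₃_assoc, l12_l_tmul, rev₃_assoc, l23, snd_l_tmul, cop_l, comm_comm_apply]

theorem rev_l23 (X : Multiplier (A ⊗[ℂ] A)) : rev (l23 X) = l12 (cop X) := rev_ext fun t => by
  induction t with
  | zero => simp only [map_zero]
  | add x y hx hy => simp only [map_add, hx, hy]
  | tmul z c => rw [rev₃_tmul', l12_l_tmul, l23, snd_l_tmul, rev₃_tmul', cop_l, comm_comm_apply]

theorem rev_l13 (X : Multiplier (A ⊗[ℂ] A)) : rev (l13 X) = l13 (cop X) := rev_ext fun t => by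
  obtain ⟨t, rfl⟩ := (TensorProduct.leftComm ℂ A A A).surjective t
  induction t with
  | zero => simp only [map_zero]
  | add x y hx hy => simp only [map_add, hx, hy]
  | tmul g z => rw [rev₃_leftComm, l13_l, l13_l, rev₃_leftComm, cop_l, comm_comm_apply]

theorem rev_fst (x : Multiplier A) : rev (fst x) = third x := rev_ext fun t => by
  induction t with
  | zero => simp only [map_zero]
  | add x y hx hy => simp only [map_add, hx, hy]
  | tmul z c => rw [rev₃_tmul', fst_l_tmul, rev₃_tmul', third_l]

theorem rev_zero : rev (0 : Multiplier (A ⊗[ℂ] (A ⊗[ℂ] A))) = 0 :=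
  rev_ext fun _ => (map_zero rev₃).symm

theorem rev_add (X Y : Multiplier (A ⊗[ℂ] (A ⊗[ℂ] A))) : rev (X + Y) = rev X + rev Y :=
  rev_ext fun t => by
    change (rev X).l _ + (rev Y).l _ = rev₃ (X.l t + Y.l t)
    rw [rev_l_rev₃, rev_l_rev₃, map_add]

theorem rev_rev (X : Multiplier (A ⊗[ℂ] (A ⊗[ℂ] A))) : rev (rev X) = X := rev_ext fun t => by
  have h : ∀ t : A ⊗[ℂ] (A ⊗[ℂ] A), rev₃ (rev₃ t) = t := by
    intro t
    induction t with
    | zero => simp only [map_zero]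
    | add x y hx hy => simp only [map_add, hx, hy]
    | tmul z c => rw [rev₃_tmul', rev₃_assoc, comm_comm_apply]
  rw [← h (X.l (rev₃ t)), ← rev_l_rev₃, h]

end Multiplier

variable [NonDeg A]

theorem WeakMultiplierHopfAlgebra.IsOpposite.rev_idD {W W' : WeakMultiplierHopfAlgebra A}
    (h : W.IsOpposite W') (p : A ⊗[ℂ] A) :
    rev (W.idD p) = W'.dT (TensorProduct.comm ℂ A A p) := by
  induction p with
  | zero => rw [idD_zero, map_zero, dT_zero, rev_zero]
  | add x y hx hy => rw [idD_add, map_add, dT_add, rev_add, hx, hy]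
  | tmul a b =>
    rw [idD_tmul, rev_mul, rev_fst, rev_l23, ← h, ← l12_third, TensorProduct.comm_tmul, dT_tmul]

theorem WeakMultiplierHopfAlgebra.IsOpposite.rev_dT {W W' : WeakMultiplierHopfAlgebra A}
    (h : W.IsOpposite W') (p : A ⊗[ℂ] A) :
    rev (W.dT p) = W'.idD (TensorProduct.comm ℂ A A p) := by
  rw [← rev_rev (W'.idD _), h.symm.rev_idD, comm_comm_apply]

namespace QuasitriangularData

variable (K : QuasitriangularData A)

/-- The quasitriangular structure `τ(R)` for the opposite coproduct. -/
def opposite : QuasitriangularData A where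
  toRegularPair := K.toRegularPair.symm
  R := cop K.R
  Rb := cop K.Rb
  R_mul_Rb := by
    change _ = cop K.W'.e
    rw [K.opp.e_eq, ← cop_mul, R_mul_Rb]
  Rb_mul_R := by
    change _ = K.W'.e
    rw [K.opp.e_eq, ← cop_mul, Rb_mul_R]
  R_mul_e := by
    change _ * K.W'.e = _
    rw [K.opp.e_eq, ← cop_mul, R_mul_e]
  Rb_mul_cop_e := by
    change _ * cop K.W'.e = _
    rw [K.opp.e_eq, ← cop_mul, Rb_mul_cop_e]
  dT_R p := by
    change _ * K.W'.dT p = K.W'.dT _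
    have h := congrArg rev (K.idD_R (TensorProduct.comm ℂ A A p))
    rw [rev_mul, rev_mul, rev_l13, rev_l12, K.opp.rev_idD, K.opp.rev_idD, comm_comm_apply] at h
    exact h
  R_mul_l12_e := by
    change _ * l12 K.W'.e = _
    have h := congrArg rev K.R_mul_l23_e
    rw [rev_mul, rev_mul, rev_l13, rev_l12, rev_l23] at h
    rw [K.opp.e_eq]
    exact h
  idD_R p := by
    change _ * K.W'.idD p = K.W'.idD _
    have h := congrArg rev (K.dT_R (TensorProduct.comm ℂ A A p))
    rw [rev_mul, rev_mul, rev_l13, rev_l23, K.opp.rev_dT, K.opp.rev_dT, comm_comm_apply] at h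
    exact h
  R_mul_l23_e := by
    change _ * l23 K.W'.e = _
    have h := congrArg rev K.R_mul_l12_e
    rw [rev_mul, rev_mul, rev_l13, rev_l23, rev_l12] at h
    rw [K.opp.e_eq]
    exact h
  intertwine a := by
    change cop (K.W'.D a) * _ = _ * K.W'.D a
    rw [K.opp, ← cop_mul, ← cop_mul, ← intertwine]
  cov₁ := (TensorProduct.comm ℂ A A).toLinearMap ∘ₗ K.cov₂
  cov₂ := (TensorProduct.comm ℂ A A).toLinearMap ∘ₗ K.cov₁
  inj_cov₁ a := by
    have h := congrArg cop (K.inj_cov₂ a)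
    rw [cop_inj, cop_mul, cop_snd] at h
    exact h
  inj_cov₂ a := by
    have h := congrArg cop (K.inj_cov₁ a)
    rw [cop_inj, cop_mul, cop_fst] at h
    exact h

/-! ### `(S ⊗ id)(R)` is the inverse of `R` -/

/-- `(Δ ⊗ id)(R(1 ⊗ a)) = R¹³R²³(1 ⊗ 1 ⊗ a)`. -/
theorem dT_cov₂ (a : A) : K.W.dT (K.cov₂ a) = l13 K.R * l23 K.R * third (inj a) := by
  have h := K.W.eq_of_mul_dT (X := K.W.dT (K.cov₂ a)) (Y := l13 K.R * l23 K.R * third (inj a))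
    fun p => by
      have h1 : K.cov₂ a * p = K.R.l ((snd (inj a)).l p) := by
        apply inj_injective
        rw [inj_mul, inj_cov₂, ← mul_l, ← mul_inj]
      rw [dT_mul, h1, ← dT_R, dT_snd_l, ← mul_assoc]
  rw [dT_mul_l12, mul_assoc, ← l12_third, ← mul_assoc, R_mul_l12_e] at h
  exact h

theorem dT_cov₁ (a : A) : K.W.dT (K.cov₁ a) = l13 K.R * l23 K.R * l12 (K.W.D a) := by
  have h := K.W.eq_of_mul_dT (X := K.W.dT (K.cov₁ a)) (Y := l13 K.R * l23 K.R * l12 (K.W.D a))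
    fun p => by
      have h1 : K.cov₁ a * p = K.R.l ((fst (inj a)).l p) := by
        apply inj_injective
        rw [inj_mul, inj_cov₁, ← mul_l, ← mul_inj]
      rw [dT_mul, h1, ← dT_R, dT_fst_l, ← mul_assoc]
  rw [dT_mul_l12, mul_assoc _ _ (l12 K.W.e), ← l12_mul, D_mul_e] at h
  exact h

theorem idD_cov₁ (a : A) : K.W.idD (K.cov₁ a) = l13 K.R * l12 K.R * fst (inj a) := by
  have h := K.W.eq_of_mul_idD (X := K.W.idD (K.cov₁ a)) (Y := l13 K.R * l12 K.R * fst (inj a))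
    fun p => by
      have h1 : K.cov₁ a * p = K.R.l ((fst (inj a)).l p) := by
        apply inj_injective
        rw [inj_mul, inj_cov₁, ← mul_l, ← mul_inj]
      rw [idD_mul_idD, h1, ← idD_R, idD_fst_l, ← mul_assoc]
  rw [idD_mul_l23, mul_assoc _ _ (l23 K.W.e), fst_l23, ← mul_assoc, R_mul_l23_e] at h
  exact h

/-- `y ⊗ a ↦ R¹³(1 ⊗ y ⊗ a)`. -/
def ins : A ⊗[ℂ] A →ₗ[ℂ] A ⊗[ℂ] (A ⊗[ℂ] A) :=
  (TensorProduct.leftComm ℂ A A A).toLinearMap ∘ₗ K.cov₂.lTensor A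

theorem ins_tmul (y a : A) : K.ins (y ⊗ₜ a) = TensorProduct.leftComm ℂ A A A (y ⊗ₜ K.cov₂ a) := rfl

theorem l13_R_mul (z : A ⊗[ℂ] A) : l13 K.R * l23 (inj z) = inj (K.ins z) := by
  induction z with
  | zero => rw [inj_zero, l23_zero, mul_zero, map_zero, inj_zero]
  | add x y hx hy => rw [inj_add, l23_add, mul_add, map_add, inj_add, hx, hy]
  | tmul y a =>
    rw [ins_tmul, ← l13_inj_mul_second, inj_cov₂, l13_mul, l13_snd, mul_assoc, third, second,
      ← snd_mul, snd_mul_fst, ← inj_tmul]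
    rfl

/-- `(Δ ⊗ id)(R(1 ⊗ a))` covered in the second leg. -/
theorem T₁_cov₂ (y a : A) : TensorProduct.assoc ℂ A A A ((K.W.t₁ y).rTensor A (K.cov₂ a)) =
    K.ins (K.R.l (y ⊗ₜ a)) := by
  apply inj_injective
  have h : ∀ p, inj (TensorProduct.assoc ℂ A A A ((K.W.t₁ y).rTensor A p)) =
      K.W.dT p * second (inj y) := by
    intro p
    induction p with
    | zero => rw [dT_zero, zero_mul, map_zero, map_zero, inj_zero]
    | add x y hx hy => rw [dT_add, add_mul, map_add, map_add, inj_add, hx, hy]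
    | tmul a b =>
      have h1 : third (inj b) * second (inj y) = second (inj y) * third (inj b) := by
        rw [third, second, ← snd_mul, ← snd_mul, fst_snd_comm]
      have h2 : second (inj y) = l12 (snd (inj y)) := by
        rw [l12, snd, fst, reassoc_tens]; rfl
      rw [dT_tmul, mul_assoc, h1, h2, ← mul_assoc, ← l12_mul, ← inj_T₁, l12_inj_mul_third]
      rfl
  rw [h, dT_cov₂, ← l13_R_mul, ← mul_inj, l23_mul, mul_assoc, mul_assoc, third, second, ← snd_mul,
    snd_mul_fst, ← inj_tmul, ← mul_assoc, ← mul_assoc]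
  rfl

/-- `a ↦ (ε ⊗ id)(R(1 ⊗ a))` is the identity. -/
theorem counit_cov₂ (a : A) :
    TensorProduct.lid ℂ A (K.W.counit.rTensor A (K.cov₂ a)) = a := by
  let ξ : A →ₗ[ℂ] A := (TensorProduct.lid ℂ A).toLinearMap ∘ₗ K.W.counit.rTensor A ∘ₗ K.cov₂
  let ε₁ : A ⊗[ℂ] A →ₗ[ℂ] A := (TensorProduct.lid ℂ A).toLinearMap ∘ₗ K.W.counit.rTensor A
  have h1 : ∀ z, ε₁.rTensor A ((TensorProduct.assoc ℂ A A A).symm (K.ins z)) = ξ.lTensor A z := by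
    intro z
    induction z with
    | zero => simp only [map_zero]
    | add x y hx hy => simp only [map_add, hx, hy]
    | tmul y a =>
      have h2 : ξ a = ε₁ (K.cov₂ a) := rfl
      rw [ins_tmul, LinearMap.lTensor_tmul, h2]
      generalize K.cov₂ a = w
      induction w with
      | zero => simp only [map_zero, TensorProduct.tmul_zero]
      | add x y hx hy => simp only [map_add, TensorProduct.tmul_add, hx, hy]
      | tmul x z =>
        change (K.W.counit x • y) ⊗ₜ[ℂ] z = y ⊗ₜ[ℂ] (K.W.counit x • z)
        rw [TensorProduct.smul_tmul]
  -- The counit applied to the first leg of (Δ ⊗ id)(R) = R¹³R²³.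
  have h3 : ∀ z, ξ.lTensor A (K.R.l z) = K.R.l z := by
    intro z
    induction z with
    | zero => simp only [map_zero]
    | add x y hx hy => simp only [map_add, hx, hy]
    | tmul y a =>
      have h4 : ε₁ ∘ₗ K.W.t₁ y = LinearMap.mulRight ℂ y :=
        LinearMap.ext fun x => K.W.counit_T₁ x y
      rw [← h1, ← T₁_cov₂, LinearEquiv.symm_apply_apply, ← LinearMap.comp_apply,
        ← LinearMap.rTensor_comp, h4, ← fst_r_cov₂]
      rfl
  -- As R R̄ = E^cop, ξ also fixes the second leg of E^cop z, that is, the first leg of all values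
  -- of T₁.
  have h5 : ξ = LinearMap.id := K.W.full_ext fun a c => by
    rw [← e_T₁, LinearMap.rTensor_id, LinearMap.id_apply]
    generalize K.W.T₁ (a ⊗ₜ[ℂ] c) = z
    apply (TensorProduct.comm ℂ A A).injective
    have h6 : ∀ w : A ⊗[ℂ] A, TensorProduct.comm ℂ A A (ξ.rTensor A w) =
        ξ.lTensor A (TensorProduct.comm ℂ A A w) := by
      intro w
      induction w with
      | zero => simp only [map_zero]
      | add x y hx hy => simp only [map_add, hx, hy]
      | tmul x y => rfl
    rw [h6, ← comm_comm_apply z, ← cop_l, ← R_mul_Rb, mul_l, h3]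
  exact LinearMap.congr_fun h5 a

/-- The intertwining relation in the last two legs of (id ⊗ Δ)(E) = E¹²E²³; the factors E²³ and E³²
are then absorbed by R²³. -/
theorem l23_R_mul_l12_e : l23 K.R * l12 K.W.e = l13 K.W.e * l23 K.R := by
  have hs : ∀ X, swap23 (l23 X) = (l23 (cop X) : Multiplier (A ⊗[ℂ] (A ⊗[ℂ] A))) := fun X => by
    rw [l23, snd, swap23_tens]; rfl
  have h1 : ∀ p, swap23 (K.W.idD p) * l23 K.R = l23 K.R * K.W.idD p := by
    intro p
    induction p with
    | zero =>
      have h : swap23 (0 : Multiplier (A ⊗[ℂ] (A ⊗[ℂ] A))) = 0 := Multiplier.ext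
        (LinearMap.ext fun t => map_zero ((TensorProduct.comm ℂ A A).lTensor A))
        (LinearMap.ext fun t => map_zero ((TensorProduct.comm ℂ A A).lTensor A))
      rw [idD_zero, mul_zero, h, zero_mul]
    | add x y hx hy =>
      have h : ∀ X Y : Multiplier (A ⊗[ℂ] (A ⊗[ℂ] A)), swap23 (X + Y) = swap23 X + swap23 Y :=
        fun X Y => Multiplier.ext
          (LinearMap.ext fun t => map_add ((TensorProduct.comm ℂ A A).lTensor A) _ _)
          (LinearMap.ext fun t => map_add ((TensorProduct.comm ℂ A A).lTensor A) _ _)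
      rw [idD_add, h, add_mul, mul_add, hx, hy]
    | tmul a b =>
      have h : swap23 (fst (inj a) : Multiplier (A ⊗[ℂ] (A ⊗[ℂ] A))) = fst (inj a) := by
        rw [fst, ← tens_one, swap23_tens, cop_tens]
      rw [idD_tmul, swap23_mul, h, hs, mul_assoc, ← l23_mul, intertwine, l23_mul, ← mul_assoc,
        ← mul_assoc, fst_l23]
  have h2 := K.W.eq_of_mul_idD (X := swap23 (l12 K.W.e * l23 K.W.e) * l23 K.R)
    (Y := l23 K.R * (l12 K.W.e * l23 K.W.e)) fun p => by
      rw [mul_assoc, ← h1, ← mul_assoc, ← swap23_mul, mul_idD, h1, mul_assoc, mul_idD]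
  rw [swap23_mul, hs, ← l13, mul_assoc (l13 _), ← l23_mul, cop_e_mul_R, mul_assoc (l13 _),
    ← l23_mul, R_mul_e, mul_assoc, mul_assoc, ← l23_mul, e_mul_e, l12_l23_comm, ← mul_assoc,
    ← l23_mul, R_mul_e] at h2
  exact h2.symm

end QuasitriangularData

end WMHA

/-! ### The antipode applied to R. -/

namespace WMHA

open Multiplier WeakMultiplierHopfAlgebra

variable {A : Type*} [NonUnitalRing A] [Module ℂ A] [IsScalarTower ℂ A A] [SMulCommClass ℂ A A]
  [NonDeg A]

theorem Multiplier.eq_of_second_inj_l {s t : A ⊗[ℂ] (A ⊗[ℂ] A)}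
    (h : ∀ x, (second (inj x)).l s = (second (inj x)).l t) : s = t :=
  sub_eq_zero.1 (lTensor_separating (fun x : A => (fst (inj x) : Multiplier (A ⊗[ℂ] A)).l)
    (fun b hb => rTensor_separating (fun b : A => LinearMap.mulLeft ℂ b)
      (fun b hb => NonDeg.right b hb) b hb) _ fun x => by
    rw [map_sub, sub_eq_zero]
    exact h x)

namespace QuasitriangularData

variable (K : QuasitriangularData A)

/-- `y ⊗ a ↦ (S ⊗ id)(R(1 ⊗ a)) (y ⊗ 1)`. -/
def J : A ⊗[ℂ] A →ₗ[ℂ] A ⊗[ℂ] A :=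
  K.W.s.rTensor A ∘ₗ (TensorProduct.assoc ℂ A A A).symm.toLinearMap ∘ₗ K.ins

theorem J_apply (z : A ⊗[ℂ] A) :
    K.J z = K.W.s.rTensor A ((TensorProduct.assoc ℂ A A A).symm (K.ins z)) := rfl

theorem J_tmul (y a : A) :
    K.J (y ⊗ₜ a) = (fst (inj y)).r (K.S.toLinearMap.rTensor A (K.cov₂ a)) := by
  rw [J_apply, ins_tmul]
  generalize K.cov₂ a = w
  induction w with
  | zero => simp only [map_zero, TensorProduct.tmul_zero]
  | add x y hx hy => simp only [map_add, TensorProduct.tmul_add, hx, hy]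
  | tmul g h =>
    rw [TensorProduct.leftComm_tmul, TensorProduct.assoc_symm_tmul, LinearMap.rTensor_tmul,
      K.s_tmul]
    rfl

/-- In Sweedler form ∑ ε_s(R₁)y ⊗ R₂a = E(y ⊗ a). Writing ε_s as a slice of E, this is the counit on
the middle leg of E¹²R²³ covered by `d` and `y`; `l23_R_mul_l12_e` moves E into legs 1 and 3, and
`counit_cov₂` removes R. -/
theorem rTensor_es_cov₂ (y a : A) :
    (K.W.es ∘ₗ (TensorProduct.mk ℂ A A).flip y).rTensor A (K.cov₂ a) = K.W.e.l (y ⊗ₜ a) := by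
  let ε₁ : A ⊗[ℂ] A →ₗ[ℂ] A := (TensorProduct.lid ℂ A).toLinearMap ∘ₗ K.W.counit.rTensor A
  apply inj_injective
  refine eq_of_fst_inj_mul fun d => ?_
  rw [mul_inj, mul_inj]
  have h0 : l23 (snd (inj a)) = third (inj a) := rfl
  have h1 : (fst (inj y)).r ((l12 K.W.e).r (d ⊗ₜ K.cov₂ a)) =
      (fst (inj d)).l ((l13 K.W.e).l (y ⊗ₜ K.cov₂ a)) := by
    apply inj_injective
    rw [← inj_mul', ← inj_mul', ← mul_inj, ← mul_inj, ← fst_inj_mul_l23_inj,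
      ← fst_inj_mul_l23_inj, fst_l23 _ (inj y), inj_cov₂, l23_mul, mul_assoc (fst (inj d)),
      mul_assoc (l23 K.R), h0, ← l12_third, ← mul_assoc (l23 K.R),
      l23_R_mul_l12_e]
    simp only [mul_assoc]
  have h2 : ∀ t, ε₁.lTensor A ((fst (inj y)).r t) = (fst (inj y)).r (ε₁.lTensor A t) := by
    intro t
    rw [fst_r, fst_r, ← LinearMap.comp_apply, LinearMap.lTensor_comp_rTensor,
      ← LinearMap.rTensor_comp_lTensor, LinearMap.comp_apply]
  have h3 : ∀ t, ε₁.lTensor A ((fst (inj d)).l t) = (fst (inj d)).l (ε₁.lTensor A t) := by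
    intro t
    rw [fst_l, fst_l, ← LinearMap.comp_apply, LinearMap.lTensor_comp_rTensor,
      ← LinearMap.rTensor_comp_lTensor, LinearMap.comp_apply]
  have h4 : ∀ w : A ⊗[ℂ] A, ε₁.lTensor A ((l13 K.W.e).l (y ⊗ₜ w)) =
      K.W.e.l (y ⊗ₜ TensorProduct.lid ℂ A (K.W.counit.rTensor A w)) := by
    intro w
    induction w with
    | zero => simp only [map_zero, TensorProduct.tmul_zero]
    | add x y hx hy => simp only [map_add, TensorProduct.tmul_add, hx, hy]
    | tmul g h =>
      have h5 := K.W.e.l13_l g (y ⊗ₜ h)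
      rw [TensorProduct.leftComm_tmul] at h5
      have h6 : ∀ z : A ⊗[ℂ] A, ε₁.lTensor A (TensorProduct.leftComm ℂ A A A (g ⊗ₜ z)) =
          K.W.counit g • z := by
        intro z
        induction z with
        | zero => simp only [map_zero, TensorProduct.tmul_zero, smul_zero]
        | add x y hx hy => simp only [map_add, TensorProduct.tmul_add, smul_add, hx, hy]
        | tmul p q => exact TensorProduct.tmul_smul _ _ _
      rw [h5, h6, LinearMap.rTensor_tmul, TensorProduct.lid_tmul, TensorProduct.tmul_smul,
        map_smul]
  have h5 : ∀ w : A ⊗[ℂ] A, (fst (inj y)).r ((K.W.er ∘ₗ TensorProduct.mk ℂ A A d).rTensor A w) =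
      (fst (inj d)).l ((K.W.es ∘ₗ (TensorProduct.mk ℂ A A).flip y).rTensor A w) := by
    intro w
    induction w with
    | zero => simp only [map_zero]
    | add x y hx hy => simp only [map_add, hx, hy]
    | tmul g h =>
      rw [LinearMap.rTensor_tmul, LinearMap.rTensor_tmul, fst_r_tmul, fst_l_tmul]
      exact congrArg (fun x => x ⊗ₜ[ℂ] h) (K.W.er_mul d g y)
  have h6 := congrArg (ε₁.lTensor A) h1
  rw [h2, h3, h4, counit_cov₂, ← rTensor_er, h5] at h6
  exact congrArg inj h6

/-- The product (S ⊗ id)(R)R is S multiplied against the first two legs of R¹³R²³ = (Δ ⊗ id)(R), so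
it is (ε_s ⊗ id)(R), which is E by `rTensor_es_cov₂`. -/
theorem J_R (z : A ⊗[ℂ] A) : K.J (K.R.l z) = K.W.e.l z := by
  induction z with
  | zero => simp only [map_zero]
  | add x y hx hy => simp only [map_add, hx, hy]
  | tmul y a =>
    have h : K.W.s ∘ₗ K.W.t₁ y = K.W.es ∘ₗ (TensorProduct.mk ℂ A A).flip y :=
      LinearMap.ext fun x => K.W.s_T₁ (x ⊗ₜ y)
    rw [J_apply, ← T₁_cov₂, LinearEquiv.symm_apply_apply, ← LinearMap.comp_apply,
      ← LinearMap.rTensor_comp, h, rTensor_es_cov₂]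

/-- `x ↦ (ε_s(x) ⊗ 1) w`. -/
def fstSrc (w : A ⊗[ℂ] A) : A →ₗ[ℂ] A ⊗[ℂ] A :=
  (LinearMap.rTensorHom A).flip w ∘ₗ TensorProduct.curry K.W.es

theorem fstSrc_apply (w : A ⊗[ℂ] A) (x : A) : K.fstSrc w x = (fst (K.W.src x)).l w := rfl

theorem fstSrc_cov₂ (a : A) :
    K.fstSrc (K.cov₂ a) = K.cov₂ ∘ₗ K.W.es ∘ₗ (TensorProduct.mk ℂ A A).flip a :=
  LinearMap.ext fun x => by
    apply inj_injective
    rw [fstSrc_apply, ← mul_inj, inj_cov₂, ← mul_assoc, fst_src_mul_R, mul_assoc, ← snd_mul,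
      mul_inj, ← inj_cov₂]
    rfl

/-- `(E ⊗ 1) R¹³ = R¹³ E³²`. -/
theorem ins_cop_e (z : A ⊗[ℂ] A) : K.ins ((cop K.W.e).l z) = (l12 K.W.e).l (K.ins z) := by
  induction z with
  | zero => simp only [map_zero]
  | add x y hx hy => simp only [map_add, hx, hy]
  | tmul y a =>
    -- Covering the second leg by `x` allows `es_T₁` to rewrite (1 ⊗ x)E(g ⊗ y) with source elements
    -- in the first leg, and these pass through R by `fst_src_mul_R`.
    refine eq_of_second_inj_l fun x => ?_
    have h1 : ∀ w, (second (inj x)).l ((l12 K.W.e).l (TensorProduct.leftComm ℂ A A A (y ⊗ₜ w))) =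
        TensorProduct.leftComm ℂ A A A (TensorProduct.comm ℂ _ _
          ((K.fstSrc w).rTensor A (K.W.T₁ (x ⊗ₜ y)))) := by
      intro w
      induction w with
      | zero =>
        have h : K.fstSrc 0 = 0 := LinearMap.ext fun x => by rw [fstSrc_apply, map_zero]; rfl
        rw [h, LinearMap.rTensor_zero, TensorProduct.tmul_zero, LinearMap.zero_apply]
        simp only [map_zero]
      | add p q hp hq =>
        have h : K.fstSrc (p + q) = K.fstSrc p + K.fstSrc q :=
          LinearMap.ext fun t => by rw [fstSrc_apply, map_add]; rfl
        rw [h, LinearMap.rTensor_add, TensorProduct.tmul_add]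
        simp only [map_add, LinearMap.add_apply, hp, hq]
      | tmul g h =>
        have h2 : TensorProduct.leftComm ℂ A A A (y ⊗ₜ (g ⊗ₜ h)) =
          TensorProduct.assoc ℂ A A A ((g ⊗ₜ y) ⊗ₜ h) := rfl
        have h3 : ∀ v : A ⊗[ℂ] A, (second (inj x)).l (TensorProduct.assoc ℂ A A A (v ⊗ₜ h)) =
            TensorProduct.assoc ℂ A A A ((snd (inj x)).l v ⊗ₜ h) := by
          intro v
          induction v with
          | zero => simp only [map_zero, TensorProduct.zero_tmul]
          | add p q hp hq => simp only [map_add, TensorProduct.add_tmul, hp, hq]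
          | tmul p q => rfl
        have h4 : (snd (inj x)).l (K.W.e.l (g ⊗ₜ y)) = _ := (K.W.es_T₁ x g y).symm
        rw [h2, l12_l_tmul, h3, h4]
        generalize K.W.T₁ (x ⊗ₜ[ℂ] y) = v
        induction v with
        | zero => simp only [map_zero, TensorProduct.zero_tmul]
        | add p q hp hq => simp only [map_add, TensorProduct.add_tmul, hp, hq]
        | tmul p q => rfl
    have h2 : ∀ u : A ⊗[ℂ] A, TensorProduct.leftComm ℂ A A A (TensorProduct.comm ℂ _ _
        (K.cov₂.rTensor A ((LinearMap.mulLeft ℂ x).lTensor A u))) =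
        (second (inj x)).l (K.ins (TensorProduct.comm ℂ A A u)) := by
      intro u
      induction u with
      | zero => simp only [map_zero]
      | add p q hp hq => simp only [map_add, hp, hq]
      | tmul p q =>
        rw [TensorProduct.comm_tmul, ins_tmul, LinearMap.lTensor_tmul, LinearMap.rTensor_tmul,
          TensorProduct.comm_tmul]
        generalize K.cov₂ p = w
        induction w with
        | zero => simp only [map_zero, TensorProduct.tmul_zero]
        | add p q hp hq => simp only [map_add, TensorProduct.tmul_add, hp, hq]
        | tmul p q => rfl
    rw [ins_tmul, h1, fstSrc_cov₂, LinearMap.rTensor_comp, LinearMap.comp_apply, es_T₁, h2, cop_l,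
      TensorProduct.comm_tmul]

theorem J_cop_e (z : A ⊗[ℂ] A) : K.J ((cop K.W.e).l z) = K.J z := by
  rw [J_apply, J_apply, ins_cop_e]
  generalize K.ins z = t
  obtain ⟨t, rfl⟩ := (TensorProduct.assoc ℂ A A A).surjective t
  have hs : K.W.s ∘ₗ K.W.e.l = K.W.s := LinearMap.ext K.W.s_e
  rw [l12_l, LinearEquiv.symm_apply_apply, LinearEquiv.symm_apply_apply, ← LinearMap.comp_apply,
    ← LinearMap.rTensor_comp, hs]

theorem J_eq (z : A ⊗[ℂ] A) : K.J z = K.Rb.l z := by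
  rw [← J_cop_e, ← R_mul_Rb, mul_l, J_R, ← mul_l, e_mul_Rb]

/-- `(S ⊗ id)(R)` is the inverse of `R`. -/
theorem inj_S_cov₂ (a : A) :
    inj (K.S.toLinearMap.rTensor A (K.cov₂ a)) = K.Rb * snd (inj a) :=
  eq_of_mul_fst_inj fun y => by
    rw [inj_mul', ← J_tmul, J_eq, mul_assoc, snd_mul_fst, ← inj_tmul, mul_inj]

/-- `(id ⊗ S⁻¹)(R)` is the inverse of `R`. -/
theorem inj_S_symm_cov₁ (a : A) :
    inj (K.S.symm.toLinearMap.lTensor A (K.cov₁ a)) = K.Rb * fst (inj a) := by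
  have h := congrArg cop (K.opposite.inj_S_cov₂ a)
  have h1 : ∀ w : A ⊗[ℂ] A, TensorProduct.comm ℂ A A
      (K.S.symm.toLinearMap.rTensor A (TensorProduct.comm ℂ A A w)) =
      K.S.symm.toLinearMap.lTensor A w := by
    intro w
    induction w with
    | zero => simp only [map_zero]
    | add x y hx hy => simp only [map_add, hx, hy]
    | tmul x y => rfl
  rw [cop_inj, cop_mul, cop_snd] at h
  rw [← h1]
  refine h.trans ?_
  exact congrArg (fun m => m * fst (inj a)) (cop_cop K.Rb)

/-- Both (S ⊗ id)(R) and (id ⊗ S⁻¹)(R) equal R̄; apply id ⊗ S to their equality. -/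
theorem aSS_R : K.aSS K.R = K.R := by
  refine eq_of_snd_inj_mul fun a => ?_
  obtain ⟨a, rfl⟩ := K.S.surjective a
  refine eq_of_mul_fst_inj fun y => ?_
  have h1 : (fst (inj y)).r (K.S.toLinearMap.rTensor A (K.cov₂ a)) =
      (snd (inj a)).r (K.S.symm.toLinearMap.lTensor A (K.cov₁ y)) := by
    apply inj_injective
    rw [← inj_mul', ← inj_mul', inj_S_cov₂, inj_S_symm_cov₁, mul_assoc, mul_assoc, fst_snd_comm]
  have h2 : ∀ w, K.S.toLinearMap.lTensor A ((snd (inj a)).r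
      (K.S.symm.toLinearMap.lTensor A w)) = (snd (inj (K.S a))).l w := by
    intro w
    induction w with
    | zero => simp only [map_zero]
    | add x y hx hy => simp only [map_add, hx, hy]
    | tmul x y =>
      have h : K.S (K.S.symm y * a) = K.S a * y := by
        rw [K.S_mul, LinearEquiv.apply_symm_apply]
      exact congrArg (fun t => x ⊗ₜ[ℂ] t) h
  have h3 : ∀ w, K.S.toLinearMap.lTensor A ((fst (inj y)).r (K.S.toLinearMap.rTensor A w)) =
      (fst (inj y)).r (K.SS w) := by
    intro w
    induction w with
    | zero => simp only [map_zero]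
    | add x y hx hy => simp only [map_add, hx, hy]
    | tmul x y => rfl
  have h4 := congrArg (K.S.toLinearMap.lTensor A) h1
  rw [h2, h3] at h4
  have h5 := congrArg inj h4
  rw [← mul_inj, ← inj_mul', inj_cov₁, ← K.aSS_inj, inj_cov₂, K.aSS_mul, K.aSS_snd, K.aS_inj] at h5
  rw [h5, mul_assoc]

theorem aSS_cop_e : K.aSS (cop K.W.e) = K.W.e := K.toRegularPair.aSS_cop_e

theorem aSS_e : K.aSS K.W.e = cop K.W.e := K.toRegularPair.aSS_e

theorem aSS_Rb : K.aSS K.Rb = K.Rb := by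
  have h1 : K.aSS K.Rb * K.R = K.W.e := by
    have h := congrArg K.aSS K.R_mul_Rb
    rwa [K.aSS_mul, aSS_R, aSS_cop_e] at h
  have h2 : K.aSS K.Rb * cop K.W.e = K.aSS K.Rb := by
    rw [← aSS_e, ← K.aSS_mul, e_mul_Rb]
  rw [← h2, ← R_mul_Rb, ← mul_assoc, h1, e_mul_Rb]

end QuasitriangularData

end WMHA

/-! ### The coproducts of u and v, and the grouplike element. -/

namespace WMHA

open Multiplier WeakMultiplierHopfAlgebra

variable {A : Type*} [NonUnitalRing A] [Module ℂ A] [IsScalarTower ℂ A A] [SMulCommClass ℂ A A]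
  [NonDeg A]

/-- The invertible multiplier `x ⊗ x`. -/
def tensUnit (x : (Multiplier A)ˣ) : (Multiplier (A ⊗[ℂ] A))ˣ where
  val := tens x x
  inv := tens ↑x⁻¹ ↑x⁻¹
  val_inv := by rw [tens_mul, Units.mul_inv, tens_one]
  inv_val := by rw [tens_mul, Units.inv_mul, tens_one]

namespace QuasitriangularData

variable (K : QuasitriangularData A)

/-! ### The coproduct of the Drinfeld element -/

theorem R_l_SS (z : A ⊗[ℂ] A) : K.R.l (K.SS z) = K.SS (K.R.r z) := by
  conv_lhs => rw [← aSS_R]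
  exact K.aSS_l_SS K.R z

theorem R_r_SS (z : A ⊗[ℂ] A) : K.R.r (K.SS z) = K.SS (K.R.l z) := by
  conv_lhs => rw [← aSS_R]
  exact K.aSS_r_SS K.R z

theorem map_drl_S_S (z : A ⊗[ℂ] A) :
    TensorProduct.map K.drl (K.S.toLinearMap ∘ₗ K.S.toLinearMap) z =
      (fst K.u).r (K.SS (K.SS z)) := by
  induction z with
  | zero => simp only [map_zero]
  | add x y hx hy => simp only [map_add, hx, hy]
  | tmul x y =>
    exact congrArg (fun t => t ⊗ₜ[ℂ] K.S (K.S y)) (K.u_r_S_S x).symm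

/-- Invariance of R under S² ⊗ S², combined with uS⁻²(a) = au in the first leg. -/
theorem map_drl_S_S_cov₁ (x : A) :
    TensorProduct.map K.drl (K.S.toLinearMap ∘ₗ K.S.toLinearMap) (K.cov₁ x) =
      K.cov₁ (K.drl x) := by
  apply inj_injective
  refine eq_of_mul_snd_inj fun c => ?_
  obtain ⟨c, rfl⟩ := K.S.surjective c
  obtain ⟨c, rfl⟩ := K.S.surjective c
  have h : ∀ z, (snd (inj (K.S (K.S c)))).r
      (TensorProduct.map K.drl (K.S.toLinearMap ∘ₗ K.S.toLinearMap) z) =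
      TensorProduct.map K.drl (K.S.toLinearMap ∘ₗ K.S.toLinearMap) ((snd (inj c)).r z) := by
    intro z
    induction z with
    | zero => simp only [map_zero]
    | add x y hx hy => simp only [map_add, hx, hy]
    | tmul x y =>
      have h1 : K.S (K.S y) * K.S (K.S c) = K.S (K.S (y * c)) := by rw [K.S_mul, K.S_mul]
      exact congrArg (fun t => K.drl x ⊗ₜ[ℂ] t) h1
  rw [inj_mul', inj_mul', h, snd_r_cov₁, snd_r_cov₁, map_drl_S_S, ← R_r_SS, ← R_l_SS, ← l_r,
    ← map_drl_S_S]
  rfl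

theorem map_drl_S_cov₁ (x : A) :
    TensorProduct.map K.drl K.S.toLinearMap (K.cov₁ x) =
      K.S.symm.toLinearMap.lTensor A (K.cov₁ (K.drl x)) := by
  have h : ∀ z, TensorProduct.map K.drl K.S.toLinearMap z = K.S.symm.toLinearMap.lTensor A
      (TensorProduct.map K.drl (K.S.toLinearMap ∘ₗ K.S.toLinearMap) z) := by
    intro z
    induction z with
    | zero => simp only [map_zero]
    | add x y hx hy => simp only [map_add, hx, hy]
    | tmul x y =>
      exact congrArg (fun t => K.drl x ⊗ₜ[ℂ] t) (K.S.symm_apply_apply (K.S y)).symm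
  rw [h, map_drl_S_S_cov₁]

/-- `w ⊗ h ↦ Δ(S(h)) w`. -/
def DS : A ⊗[ℂ] (A ⊗[ℂ] A) →ₗ[ℂ] A ⊗[ℂ] A :=
  TensorProduct.lift (LinearMap.mk₂ ℂ (fun w h => K.W.Dl w (K.S h))
    (fun w w' h => map_add (K.W.D (K.S h)).l w w')
    (fun c w h => map_smul (K.W.D (K.S h)).l c w)
    (fun w h h' => by rw [map_add, map_add])
    (fun c w h => by rw [map_smul, map_smul])) ∘ₗ (TensorProduct.assoc ℂ A A A).symm.toLinearMap

theorem DS_assoc (w : A ⊗[ℂ] A) (h : A) :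
    K.DS (TensorProduct.assoc ℂ A A A (w ⊗ₜ h)) = (K.W.D (K.S h)).l w := by
  rw [DS, LinearMap.comp_apply, LinearEquiv.coe_coe, LinearEquiv.symm_apply_apply,
    TensorProduct.lift.tmul]
  rfl

theorem DS_tmul (p q h : A) : K.DS (p ⊗ₜ (q ⊗ₜ h)) = (K.W.D (K.S h)).l (p ⊗ₜ q) :=
  K.DS_assoc (p ⊗ₜ q) h

/-- `g ⊗ p ⊗ q ↦ S(q) g ⊗ S(p) y`. -/
def revS (y : A) : A ⊗[ℂ] (A ⊗[ℂ] A) →ₗ[ℂ] A ⊗[ℂ] A :=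
  (TensorProduct.comm ℂ A A).toLinearMap ∘ₗ
    TensorProduct.map (LinearMap.mulRight ℂ y ∘ₗ K.S.toLinearMap) K.phi ∘ₗ
      (TensorProduct.leftComm ℂ A A A).toLinearMap

theorem revS_tmul (y g : A) (w : A ⊗[ℂ] A) :
    K.revS y (g ⊗ₜ w) = K.SS (TensorProduct.comm ℂ A A w) * (g ⊗ₜ y) := by
  induction w with
  | zero => simp only [map_zero, TensorProduct.tmul_zero, zero_mul]
  | add a b ha hb => simp only [map_add, TensorProduct.tmul_add, add_mul, ha, hb]
  | tmul p q =>
    rw [TensorProduct.comm_tmul, K.SS_tmul, Algebra.TensorProduct.tmul_mul_tmul, ← phi_tmul]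
    rfl

theorem revS_leftComm (y k : A) (z : A ⊗[ℂ] A) :
    K.revS y (TensorProduct.leftComm ℂ A A A (k ⊗ₜ z)) = K.phi z ⊗ₜ (K.S k * y) := by
  have h : TensorProduct.leftComm ℂ A A A (TensorProduct.leftComm ℂ A A A (k ⊗ₜ z)) = k ⊗ₜ z :=
    (TensorProduct.leftComm ℂ A A A).symm_apply_apply _
  rw [revS, LinearMap.comp_apply, LinearMap.comp_apply, LinearEquiv.coe_coe, LinearEquiv.coe_coe,
    h]
  rfl

/-- In Sweedler form ∑ Δ(S(R₂))(R₁x ⊗ y) = R̄(ux ⊗ y). Since ΔS = (S ⊗ S)Δ^cop and (id ⊗ Δ)(R) =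
R¹³R¹², one copy of R is contracted to u; `map_drl_S_cov₁` turns the other into (id ⊗ S⁻¹)(R) = R̄.
-/
theorem DS_leftComm_cov₁ (x y : A) :
    K.DS (TensorProduct.leftComm ℂ A A A (y ⊗ₜ K.cov₁ x)) = K.Rb.l (K.drl x ⊗ₜ y) := by
  refine K.eq_of_S_tmul_mul fun γ δ => ?_
  have h1 : ∀ z, (K.S γ ⊗ₜ K.S δ) * K.DS (TensorProduct.leftComm ℂ A A A (y ⊗ₜ z)) =
      K.revS y ((K.W.Dl (δ ⊗ₜ γ)).lTensor A z) := by
    intro z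
    induction z with
    | zero => simp only [map_zero, TensorProduct.tmul_zero, mul_zero]
    | add a b ha hb => simp only [map_add, TensorProduct.tmul_add, mul_add, ha, hb]
    | tmul g h =>
      rw [TensorProduct.leftComm_tmul, DS_tmul, ← Multiplier.compat, ← K.SS_tmul, K.D_S,
        K.aSS_r_SS, cop_l, TensorProduct.comm_tmul, LinearMap.lTensor_tmul, revS_tmul]
      rfl
  have h2 : (K.W.Dl (δ ⊗ₜ γ)).lTensor A (K.cov₁ x) =
      (l13 K.R).l (TensorProduct.assoc ℂ A A A ((snd (inj δ)).r (K.cov₁ x) ⊗ₜ γ)) := by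
    apply inj_injective
    rw [← idD_mul_inj, idD_cov₁, mul_assoc, fst_inj_mul_l23_inj, ← TensorProduct.assoc_tmul,
      mul_assoc, mul_inj, l12_l_tmul, mul_inj, snd_r_cov₁]
  have h3 : ∀ w, K.revS y ((l13 K.R).l
      (TensorProduct.assoc ℂ A A A ((snd (inj δ)).r w ⊗ₜ γ))) =
      (K.S γ ⊗ₜ K.S δ) * (snd (inj y)).r (TensorProduct.map K.drl K.S.toLinearMap w) := by
    intro w
    induction w with
    | zero => simp only [map_zero, TensorProduct.zero_tmul, mul_zero]
    | add a b ha hb => simp only [map_add, TensorProduct.add_tmul, mul_add, ha, hb]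
    | tmul g h =>
      have h4 := K.R.l13_l (h * δ) (g ⊗ₜ γ)
      rw [TensorProduct.leftComm_tmul] at h4
      have h5 : (snd (inj δ)).r (g ⊗ₜ[ℂ] h) = g ⊗ₜ (h * δ) := rfl
      rw [h5, TensorProduct.assoc_tmul, h4, revS_leftComm, phi_R, K.S_mul, TensorProduct.map_tmul,
        snd_r_tmul, Algebra.TensorProduct.tmul_mul_tmul, inj_r, mul_assoc]
      rfl
  have h6 : (snd (inj y)).r (TensorProduct.map K.drl K.S.toLinearMap (K.cov₁ x)) =
      K.Rb.l (K.drl x ⊗ₜ y) := by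
    apply inj_injective
    rw [map_drl_S_cov₁, ← inj_mul', inj_S_symm_cov₁, mul_assoc, fst_mul_snd, ← inj_tmul, mul_inj]
  rw [h1, h2, h3, h6]

theorem D_mul_Rb (a : A) : K.W.D a * K.Rb = K.Rb * cop (K.W.D a) := by
  conv_rhs => rw [← D_mul_e, cop_mul, ← R_mul_Rb, ← mul_assoc (cop _), intertwine]
  rw [← mul_assoc, ← mul_assoc, Rb_mul_R, e_mul_D]

theorem l12_snd (y : Multiplier A) : l12 (snd y) = second y := by
  rw [l12, snd, fst, reassoc_tens]; rfl

theorem l23_R_mul_l12_inj (z : A ⊗[ℂ] A) :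
    l23 K.R * l12 (inj z) = inj (K.cov₁.lTensor A z) := by
  induction z with
  | zero => rw [inj_zero, l12_zero, mul_zero, map_zero, inj_zero]
  | add x y hx hy => rw [inj_add, l12_add, mul_add, hx, hy, map_add, inj_add]
  | tmul p q =>
    have h : second (inj q) = l23 (fst (inj q)) := rfl
    rw [inj_tmul, ← fst_mul_snd, l12_mul, l12_fst, l12_snd, ← mul_assoc, ← fst_l23, mul_assoc, h,
      ← l23_mul, ← inj_cov₁, fst_inj_mul_l23_inj]
    rfl

/-- `Δ(u b) = R̄ R̄²¹ (u ⊗ u) Δ(b)`. -/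
theorem D_u_l (b : A) : K.W.D (K.u.l b) = K.Rb * cop K.Rb * tens K.u K.u * K.W.D b :=
  ext_l fun z => by
    have h1 : ∀ w, (K.W.D (K.phi w)).l z =
        K.DS (TensorProduct.assoc ℂ A A A ((K.W.Dl z).rTensor A w)) := by
      intro w
      induction w with
      | zero => rw [map_zero, ← Dl_apply]; simp only [map_zero]
      | add x y hx hy => simp only [map_add, D_add, ← hx, ← hy]; rfl
      | tmul g h => rw [phi_tmul, D_mul, LinearMap.rTensor_tmul, DS_assoc]; rfl
    have h2 : TensorProduct.assoc ℂ A A A ((K.W.Dl z).rTensor A (K.cov₁ b)) =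
        (l13 K.R).l (K.cov₁.lTensor A ((K.W.D b).l z)) := by
      apply inj_injective
      rw [← dT_mul_inj, dT_cov₁, mul_assoc, ← l12_mul, mul_inj, mul_assoc, l23_R_mul_l12_inj,
        mul_inj]
    -- The two copies of R in (Δ ⊗ id)(R) = R¹³R²³ are contracted one after the other by
    -- `DS_leftComm_cov₁`. Moving Δ(S(h)) past the first R̄ flips it, which is why the second factor
    -- is R̄²¹.
    have h3 : ∀ z, K.DS ((l13 K.R).l (K.cov₁.lTensor A z)) =
        K.Rb.l ((cop K.Rb).l ((tens K.u K.u).l z)) := by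
      intro z
      induction z with
      | zero => simp only [map_zero]
      | add x y hx hy => simp only [map_add, hx, hy]
      | tmul p q =>
        have h4 : ∀ g h v, K.DS (TensorProduct.leftComm ℂ A A A (g ⊗ₜ (snd (inj h)).r v)) =
            (K.W.D (K.S h)).l (K.DS (TensorProduct.leftComm ℂ A A A (g ⊗ₜ v))) := by
          intro g h v
          induction v with
          | zero => simp only [map_zero, TensorProduct.tmul_zero]
          | add x y hx hy => simp only [map_add, TensorProduct.tmul_add, hx, hy]
          | tmul g' h' =>
            rw [snd_r_tmul, TensorProduct.leftComm_tmul, TensorProduct.leftComm_tmul, DS_tmul,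
              DS_tmul, inj_r, K.S_mul, D_mul, mul_l]
        have h5 : ∀ w, K.DS ((l13 K.R).l (p ⊗ₜ w)) = K.Rb.l (TensorProduct.comm ℂ A A
            (K.DS (TensorProduct.leftComm ℂ A A A (K.drl p ⊗ₜ w)))) := by
          intro w
          induction w with
          | zero => simp only [map_zero, TensorProduct.tmul_zero]
          | add x y hx hy => simp only [map_add, TensorProduct.tmul_add, hx, hy]
          | tmul g h =>
            have h6 := K.R.l13_l g (p ⊗ₜ h)
            rw [TensorProduct.leftComm_tmul] at h6
            rw [h6, ← snd_r_cov₁, h4, DS_leftComm_cov₁, ← mul_l, D_mul_Rb, mul_l, cop_l,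
              TensorProduct.leftComm_tmul, DS_tmul, TensorProduct.comm_tmul]
        rw [LinearMap.lTensor_tmul, h5, DS_leftComm_cov₁, cop_l, tens_l_tmul,
          TensorProduct.comm_tmul, u_l, u_l]
    rw [u_l, drl_apply, h1, h2, h3]
    rfl

theorem v_r_S (b : A) : K.v.r (K.S b) = K.S (K.u.l b) := by
  rw [v, RegularPair.aS, anti_r, LinearEquiv.symm_apply_apply]

theorem v_l_S (b : A) : K.v.l (K.S b) = K.S (K.u.r b) := by
  rw [v, RegularPair.aS, anti_l, LinearEquiv.symm_apply_apply]

/-- The image of `D_u_l` under S, which reverses Δ and all products and fixes R̄. -/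
theorem D_v_r (c : A) : K.W.D (K.v.r c) = K.W.D c * tens K.v K.v * (K.Rb * cop K.Rb) := by
  obtain ⟨b, rfl⟩ := K.S.surjective c
  rw [v_r_S, K.D_S, D_u_l, K.aSS_cop, K.aSS_mul, K.aSS_mul, K.aSS_mul, K.aSS_cop, aSS_Rb,
    K.aSS_tens, cop_mul, cop_mul, cop_mul, cop_cop, cop_tens, K.D_S, K.aSS_cop, ← mul_assoc]
  rfl

theorem aSS_aSS_mul (m : Multiplier (A ⊗[ℂ] A)) :
    K.aSS (K.aSS m) * tens K.u K.u = tens K.u K.u * m := by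
  have h : ∀ z, inj (K.SS (K.SS z)) * tens K.u K.u = tens K.u K.u * inj z := by
    intro z
    induction z with
    | zero => rw [map_zero, map_zero, inj_zero, zero_mul, mul_zero]
    | add x y hx hy => rw [map_add, map_add, inj_add, add_mul, hx, hy, inj_add, mul_add]
    | tmul x y =>
      rw [K.SS_tmul, K.SS_tmul, inj_tmul, inj_tmul, tens_mul, tens_mul, inj_S_S_mul_u,
        inj_S_S_mul_u]
  refine eq_of_mul_inj fun z => ?_
  rw [mul_assoc, mul_assoc, mul_inj m, ← h, ← h, ← mul_assoc, mul_inj, K.aSS_l_SS, K.aSS_r_SS]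

theorem mul_aSS_aSS (m : Multiplier (A ⊗[ℂ] A)) :
    tens K.v K.v * K.aSS (K.aSS m) = m * tens K.v K.v := by
  have h0 : ∀ a, K.v * inj (K.S (K.S a)) = inj a * K.v := fun a => by
    rw [← v_mul_aS_aS, K.aS_inj, K.aS_inj]
  have h : ∀ z, tens K.v K.v * inj (K.SS (K.SS z)) = inj z * tens K.v K.v := by
    intro z
    induction z with
    | zero => rw [map_zero, map_zero, inj_zero, zero_mul, mul_zero]
    | add x y hx hy => rw [map_add, map_add, inj_add, mul_add, hx, hy, inj_add, add_mul]
    | tmul x y =>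
      rw [K.SS_tmul, K.SS_tmul, inj_tmul, inj_tmul, tens_mul, tens_mul, h0, h0]
  refine eq_of_inj_mul fun z => ?_
  rw [← mul_assoc, ← mul_assoc, inj_mul' m, ← h, ← h, mul_assoc, inj_mul', K.aSS_r_SS, K.aSS_l_SS]

theorem D_S_S (a : A) : K.W.D (K.S (K.S a)) = K.aSS (K.aSS (K.W.D a)) := by
  rw [K.D_S, K.D_S, K.aSS_cop, K.aSS_cop, K.aSS_cop, cop_cop]

/-! ### The grouplike element -/

/-- The Drinfeld element as a unit. -/
def uUnit : (Multiplier A)ˣ := K.isUnit_u.unit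

/-- The image of the Drinfeld element under the antipode as a unit. -/
def vUnit : (Multiplier A)ˣ := K.isUnit_v.unit

theorem coe_uUnit : (K.uUnit : Multiplier A) = K.u := rfl
theorem coe_vUnit : (K.vUnit : Multiplier A) = K.v := rfl

/-- The grouplike element `u v⁻¹`. -/
def h : (Multiplier A)ˣ := K.uUnit * K.vUnit⁻¹

theorem h_mul_v : (K.h : Multiplier A) * K.v = K.u := by
  rw [← coe_vUnit, ← coe_uUnit, ← Units.val_mul, h, inv_mul_cancel_right]

/-- Conjugation by u ⊗ u is S² ⊗ S² and conjugation by v ⊗ v is its inverse, so X commutes with both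
and with their quotient. -/
theorem commute_tens_h {X : Multiplier (A ⊗[ℂ] A)} (hX : K.aSS (K.aSS X) = X) :
    tens (K.h : Multiplier A) K.h * X = X * tens (K.h : Multiplier A) K.h := by
  have h1 : Commute (tensUnit K.vUnit : Multiplier (A ⊗[ℂ] A)) X := by
    have := K.mul_aSS_aSS X
    rwa [hX] at this
  have h2 : tens K.u K.u * X = X * tens K.u K.u := by
    have := K.aSS_aSS_mul X
    rw [hX] at this
    exact this.symm
  have h3 : tens (K.h : Multiplier A) K.h * (tensUnit K.vUnit : Multiplier (A ⊗[ℂ] A)) =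
      tens K.u K.u := by
    change tens _ _ * tens K.v K.v = _
    rw [tens_mul, h_mul_v]
  refine (tensUnit K.vUnit).isUnit.mul_right_cancel ?_
  rw [mul_assoc, ← h1.eq, ← mul_assoc, h3, h2, mul_assoc, h3]

theorem tens_h_mul_e : tens (K.h : Multiplier A) K.h * K.W.e = K.W.e * tens ↑K.h ↑K.h :=
  K.commute_tens_h (by rw [aSS_e, aSS_cop_e])

theorem D_h_l (a : A) : K.W.D ((K.h : Multiplier A).l a) =
    tens (K.h : Multiplier A) K.h * K.W.D a := by
  have h1 : K.v.r ((K.h : Multiplier A).l a) = K.u.l (K.S (K.S a)) := by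
    apply inj_injective
    rw [← inj_mul', ← mul_inj, ← mul_inj, mul_assoc, ← v_mul_aS_aS, K.aS_inj, K.aS_inj,
      ← mul_assoc, h_mul_v]
  have h2 : tens K.u K.u = tens (K.h : Multiplier A) K.h * tens K.v K.v := by
    rw [tens_mul, h_mul_v]
  have h3 : cop K.Rb * K.W.D a = cop (K.W.D a) * cop K.Rb := by
    have h := congrArg cop (K.D_mul_Rb a)
    rw [cop_mul, cop_mul, cop_cop] at h
    exact h.symm
  have h4 : K.Rb * cop K.Rb * K.W.D a = K.W.D a * (K.Rb * cop K.Rb) := by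
    rw [mul_assoc, h3, ← mul_assoc, ← mul_assoc, D_mul_Rb]
  have h5 : K.aSS (K.aSS (K.Rb * cop K.Rb)) = K.Rb * cop K.Rb := by
    rw [K.aSS_mul, K.aSS_mul, K.aSS_cop, aSS_Rb, K.aSS_cop, aSS_Rb]
  have h6 : K.Rb * cop K.Rb * tens K.v K.v = tens K.v K.v * (K.Rb * cop K.Rb) := by
    have := K.mul_aSS_aSS (K.Rb * cop K.Rb)
    rw [h5] at this
    exact this.symm
  have h7 : K.Rb * cop K.Rb * (cop K.R * K.R) = K.W.e := by
    rw [mul_assoc, ← mul_assoc (cop _) (cop _), ← cop_mul, Rb_mul_R, cop_e_mul_R, Rb_mul_R]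
  have h8 : tens K.v K.v * K.W.e = K.W.e * tens K.v K.v := by
    have := K.mul_aSS_aSS K.W.e
    rwa [aSS_e, aSS_cop_e] at this
  -- Both sides are the coproduct of hav = uS²(a): the left by `D_v_r`, the right by `D_u_l` and the
  -- commutation of R̄R̄²¹ with Δ(a), v ⊗ v and h ⊗ h. Multiplying by R²¹R leaves E, absorbed by Δ,
  -- and v ⊗ v, which is invertible.
  have h9 : K.W.D ((K.h : Multiplier A).l a) * tens K.v K.v * (K.Rb * cop K.Rb) =
      tens (K.h : Multiplier A) K.h * K.W.D a * tens K.v K.v * (K.Rb * cop K.Rb) := by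
    rw [← D_v_r, h1, D_u_l, D_S_S, h2, mul_assoc _ (_ * _) (K.aSS _), mul_assoc (tens _ _),
      mul_aSS_aSS, ← mul_assoc, ← K.commute_tens_h h5, ← mul_assoc, mul_assoc _ _ (K.W.D a), h4,
      mul_assoc, mul_assoc _ _ (tens K.v K.v), h6]
    simp only [mul_assoc]
  have h10 := congrArg (fun m => m * (cop K.R * K.R)) h9
  rw [mul_assoc _ (_ * _), mul_assoc _ (_ * _), h7, mul_assoc, mul_assoc _ _ K.W.e, h8,
    ← mul_assoc, ← mul_assoc, D_mul_e, mul_assoc _ _ K.W.e, D_mul_e] at h10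
  exact (tensUnit K.vUnit).isUnit.mul_right_cancel h10

theorem D_h_r (a : A) : K.W.D ((K.h : Multiplier A).r a) =
    K.W.D a * (tens (K.h : Multiplier A) K.h * K.W.e) := by
  have h := K.W.eq_of_mul_D (X := K.W.D ((K.h : Multiplier A).r a))
    (Y := K.W.D a * tens (K.h : Multiplier A) K.h) fun b => by
      rw [← D_mul, Multiplier.compat, D_mul, D_h_l, mul_assoc]
  rwa [D_mul_e, mul_assoc] at h

theorem S_S_S_S (a : A) : inj (K.S (K.S (K.S (K.S a)))) * (K.h : Multiplier A) =
    (K.h : Multiplier A) * inj a := by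
  have h1 : inj (K.S (K.S (K.S (K.S a)))) * K.u = K.u * inj (K.S (K.S a)) := K.inj_S_S_mul_u _
  have h2 : K.v * inj (K.S (K.S a)) = inj a * K.v := by
    rw [← v_mul_aS_aS, K.aS_inj, K.aS_inj]
  refine K.isUnit_v.mul_right_cancel ?_
  rw [mul_assoc, h_mul_v, h1, mul_assoc, ← h2, ← mul_assoc, h_mul_v]

end QuasitriangularData

/-! ### Comparison with the multiplier algebra -/

/-- The passage from units of the plain structure to units of `M(A)`. -/
def downUnit (x : (Multiplier A)ˣ) : (Mult A)ˣ where
  val := down x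
  inv := down ↑x⁻¹
  val_inv := up_injective (by rw [up_mul, up_down, up_down, Units.mul_inv, up_one])
  inv_val := up_injective (by rw [up_mul, up_down, up_down, Units.inv_mul, up_one])

theorem exists_cover {R : Multiplier (A ⊗[ℂ] A)} (h : ∀ a, ∃ z, inj z = R * fst (inj a)) :
    ∃ f : A →ₗ[ℂ] A ⊗[ℂ] A, ∀ a, inj (f a) = R * fst (inj a) := by
  choose f hf using h
  have h1 : ∀ x y, (snd (inj y)).r (f x) = R.l (x ⊗ₜ y) := fun x y => by
    apply inj_injective
    rw [← inj_mul', hf, mul_assoc, fst_mul_snd, ← inj_tmul, mul_inj]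
  -- Elements are determined by their covers, so the pointwise choice `f` is automatically linear.
  have h2 : ∀ p q : A ⊗[ℂ] A, (∀ y, (snd (inj y)).r p = (snd (inj y)).r q) → p = q :=
    fun p q h => inj_injective (eq_of_mul_snd_inj fun y => by rw [inj_mul', inj_mul', h])
  refine ⟨⟨⟨f, fun x y => h2 _ _ fun z => ?_⟩, fun c x => h2 _ _ fun z => ?_⟩, hf⟩
  · rw [map_add, h1, h1, h1, TensorProduct.add_tmul, map_add]
  · rw [RingHom.id_apply, map_smul, h1, h1, ← TensorProduct.smul_tmul', map_smul]

theorem WeakMultiplierHopfAlgebra.IsQuasitriangular.exists_data {W : WeakMultiplierHopfAlgebra A}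
    {R : Mult (A ⊗[ℂ] A)} (hR : W.IsQuasitriangular R) (hcov : IsCovered R) :
    ∃ K : QuasitriangularData A, K.W = W ∧ K.R = up R := by
  obtain ⟨-, -, W', hW'⟩ := hR.regular
  have hopp : W.IsOpposite W' := fun a => congrArg up (hW' a)
  obtain ⟨Q, rfl, -⟩ := hopp.exists_regularPair
  obtain ⟨Rb, h1, h2, h3, h4⟩ := hR.eInverse
  obtain ⟨f, hf⟩ := exists_cover (R := up R) fun a => by
    obtain ⟨z, hz⟩ := (hcov a).1
    exact ⟨z, congrArg up hz⟩
  obtain ⟨g, hg⟩ := exists_cover (R := cop (up R)) fun a => by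
    obtain ⟨z, hz⟩ := (hcov a).2.2.1
    have hz' : inj z = up R * snd (inj a) := congrArg up hz
    exact ⟨TensorProduct.comm ℂ A A z, by rw [← cop_inj, hz', cop_mul, cop_snd]⟩
  exact ⟨{
    toRegularPair := Q
    R := up R
    Rb := up Rb
    R_mul_Rb := congrArg up h1
    Rb_mul_R := congrArg up h2
    R_mul_e := congrArg up h3
    Rb_mul_cop_e := congrArg up h4
    dT_R := fun p => congrArg up (hR.comul_id.1 p)
    R_mul_l12_e := congrArg up hR.comul_id.2.2.2
    idD_R := fun p => congrArg up (hR.id_comul.1 p)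
    R_mul_l23_e := congrArg up hR.id_comul.2.2.2
    intertwine := fun a => congrArg up (hR.intertwine a)
    cov₁ := f
    cov₂ := (TensorProduct.comm ℂ A A).toLinearMap ∘ₗ g
    inj_cov₁ := hf
    inj_cov₂ := fun a => by
      have h := congrArg cop (hg a)
      rw [cop_inj, cop_mul, cop_cop, cop_fst] at h
      exact h }, rfl, rfl⟩

namespace QuasitriangularData

variable (K : QuasitriangularData A)

theorem phi_eq_mul' (z : A ⊗[ℂ] A) : K.phi z =
    LinearMap.mul' ℂ A (K.S.toLinearMap.rTensor A (TensorProduct.comm ℂ A A z)) := by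
  induction z with
  | zero => simp only [map_zero]
  | add x y hx hy => simp only [map_add, hx, hy]
  | tmul x y => exact K.phi_tmul x y

theorem isDrinfeldElement_iff {R : Mult (A ⊗[ℂ] A)} (hR : K.R = up R) (x : Mult A) :
    IsDrinfeldElement K.S R x ↔ x = downUnit K.uUnit := by
  constructor
  -- The formula for the left action alone determines a multiplier of a non-degenerate algebra.
  · rintro ⟨h, -⟩
    refine up_injective (ext_l fun a => ?_)
    have h1 : incl (K.cov₁ a) = R * mtensor (incl a) 1 := up_injective (by
      have := K.inj_cov₁ a
      rw [hR] at this
      exact this)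
    exact (h a _ h1).trans (K.phi_eq_mul' _).symm
  · rintro rfl
    refine ⟨fun a p hp => ?_, fun a => rfl⟩
    have h1 : p = K.cov₁ a := inj_injective (by
      rw [inj_cov₁, hR]
      exact congrArg up hp)
    rw [h1, ← phi_eq_mul']
    rfl

theorem isAntiExtension_iff (x : Mult A) :
    IsAntiExtension K.S (downUnit K.uUnit : Mult A) x ↔ x = downUnit K.vUnit := by
  constructor
  · rintro ⟨h, -⟩
    refine up_injective (ext_l fun a => ?_)
    obtain ⟨a, rfl⟩ := K.S.surjective a
    exact (h a).trans (K.v_l_S a).symm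
  · rintro rfl
    exact ⟨fun a => K.v_l_S a, fun a => K.v_r_S a⟩

theorem isGrouplike :
    K.W.IsGrouplike ((downUnit K.uUnit * (downUnit K.vUnit)⁻¹ : (Mult A)ˣ) : Mult A) := by
  have h0 : up ((downUnit K.uUnit * (downUnit K.vUnit)⁻¹ : (Mult A)ˣ) : Mult A) = K.h := rfl
  generalize hx : ((downUnit K.uUnit * (downUnit K.vUnit)⁻¹ : (Mult A)ˣ) : Mult A) = x at h0
  have hE : up K.W.E = K.W.e := rfl
  have hT : up (mtensor x x * K.W.E) = tens (K.h : Multiplier A) K.h * K.W.e := by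
    rw [← h0]; rfl
  refine ⟨hx ▸ Units.isUnit _, ⟨fun a => up_injective ?_, fun a => up_injective ?_,
    up_injective ?_, up_injective ?_⟩, up_injective ?_⟩
  · have h1 : tens (K.h : Multiplier A) K.h * K.W.e * K.W.D a = K.W.D ((up x).l a) := by
      rw [mul_assoc, e_mul_D, h0, D_h_l]
    rw [up_mul, hT]
    exact h1
  · have h1 : K.W.D a * (tens (K.h : Multiplier A) K.h * K.W.e) = K.W.D ((up x).r a) := by
      rw [h0, D_h_r]
    rw [up_mul, hT]
    exact h1
  · rw [up_mul, hT, hE, ← mul_assoc, ← tens_h_mul_e, mul_assoc, e_mul_e]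
  · rw [up_mul, hT, hE, mul_assoc, e_mul_e]
  · rw [hT, up_mul, hE, up_mtensor, h0, tens_h_mul_e]

end QuasitriangularData

end WMHA

end

theorem mainTheorem5 {A : Type*} [NonUnitalRing A] [Module ℂ A] [IsScalarTower ℂ A A]
    [SMulCommClass ℂ A A] (W : WMHA.WeakMultiplierHopfAlgebra A) (R : WMHA.Mult (A ⊗[ℂ] A))
    (hR : W.IsQuasitriangular R) (hcov : WMHA.IsCovered R) :
    ∃ S : A ≃ₗ[ℂ] A,
      -- the antipode of `A` exists, is unique, and is the bijection `S` of `A`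
      (∀ S' : A →ₗ[ℂ] WMHA.Mult A,
        W.IsAntipode S' ↔ S' = WMHA.incl ∘ₗ S.toLinearMap) ∧
      -- the elements `u` and `v = S(u)` are well defined and invertible in `M(A)`
      ∃ u v : (WMHA.Mult A)ˣ,
        (∀ x : WMHA.Mult A, WMHA.IsDrinfeldElement S R x ↔ x = u) ∧
        (∀ x : WMHA.Mult A, WMHA.IsAntiExtension S u x ↔ x = v) ∧
        u * v = v * u ∧
        (∀ m : WMHA.Mult A, (u * v : WMHA.Mult A) * m = m * (u * v : WMHA.Mult A)) ∧
        W.IsGrouplike ((u * v⁻¹ : (WMHA.Mult A)ˣ) : WMHA.Mult A) ∧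
        ∀ a : A, WMHA.incl (S (S (S (S a)))) =
          ((u * v⁻¹ : (WMHA.Mult A)ˣ) : WMHA.Mult A) * WMHA.incl a *
            (((u * v⁻¹)⁻¹ : (WMHA.Mult A)ˣ) : WMHA.Mult A) := by
  open WMHA WMHA.Multiplier in
  have : NonDeg A := W.nonDeg
  obtain ⟨K, rfl, hK⟩ := hR.exists_data hcov
  refine ⟨K.S, K.isAntipode_iff, downUnit K.uUnit, downUnit K.vUnit, K.isDrinfeldElement_iff hK,
    K.isAntiExtension_iff, Units.ext (up_injective K.u_mul_v), fun m => up_injective ?_,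
    K.isGrouplike, fun a => up_injective ?_⟩
  · exact K.u_mul_v_central (up m)
  · have h := K.S_S_S_S a
    rw [← Units.eq_mul_inv_iff_mul_eq] at h
    exact h
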